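/- **Conventions.** A 2-category is a strict 2-category. It is \emph{cartesian} if it has finite 2-categorical products: a terminal object $1$ with $\mathcal K(Z,1)\cong 1$ for all $Z$, and for all $A,B$ an object $A\times B$ with projections inducing isomorphisms of categories $\mathcal K(Z,A\times B)\cong\mathcal K(Z,A)\times\mathcal K(Z,B)$. A \emph{cartesian 2-functor} is a strict 2-functor preserving terminal objects and binary products in this sense. Let $\mathcal{D}\mathsf{bl}$ be the 2-category of small pseudo double categories (strict composition in the tight direction), pseudo double functors (invertible comparison squares for loose composites and loose identities) and tight transformations. Let $\mathbb{L}\mathsf{oose}$ be the free strict double category on one loose arrow $0⇸1$. A \emph{loose bimodule} is a double functor $\mathbb M\to\mathbb{L}\mathsf{oose}$, and $\ell\mathcal{B}\mathsf{imod}$ is the strict slice 2-category $\mathcal{D}\mathsf{bl}\downarrow\mathbb{L}\mathsf{oose}$. The \emph{source} $\mathbb D_0$ and \emph{target} $\mathbb D_1$ of $\mathbb M$ are its fibres over $0$ and $1$. The \emph{carrier} $\mathsf{Car}(\mathbb M)$ is the category whose objects are the \emph{heteromorphisms} of $\mathbb M$ (loose arrows lying over $0⇸1$) and whose morphisms are the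 squares between them; it has a functor $\mathsf{codom}$ to the tight category of $\mathbb D_1$. The 2-category $\ell\mathcal{M}\mathsf{od}_{\mathsf r}$ of \emph{loose right modules} is the full sub-2-category of $\ell\mathcal{B}\mathsf{imod}$ on the loose bimodules whose source is a terminal double category (exactly one object, tight arrow, loose arrow and square). **Collapse.** The \emph{collapse} $\mathfrak c\mathbb M$ of a loose bimodule $\mathbb M$ has as source the terminal double category $\bullet$ and as target $\mathbb D_1$. Its heteromorphisms $\bullet⇸d_1$ are all the heteromorphisms $d_0⇸d_1$ of $\mathbb M$, with arbitrary $d_0$ in $\mathbb D_0$, and its squares between heteromorphisms are the squares of $\mathbb M$ between them, that is, the morphisms of $\mathsf{Car}(\mathbb M)$. The right action of $\mathbb D_1$ and its coherence squares are those of $\mathbb M$, and the left action of $\bullet$ is trivial. On a 1-cell $F:\mathbb M\to\mathbb N$ of $\ell\mathcal{B}\mathsf{imod}$, the 1-cell $\mathfrak cF$ is given by $F$ on the target and on heteromorphisms and the squares between them, and is the identity on $\bullet$; on a 2-cell $\alpha$, the 2-cell $\mathfrak c\alpha$ is given by the components of $\alpha$ on the target and on heteromorphisms, and is the identity at $\bullet$.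 **Theorem (Collapse of loose bimodule).** The 2-categories $\ell\mathcal{B}\mathsf{imod}$ and $\ell\mathcal{M}\mathsf{od}_{\mathsf r}$ are cartesian, and collapse defines a cartesian 2-functor $$\mathfrak c:\ell\mathcal{B}\mathsf{imod}\to\ell\mathcal{M}\mathsf{od}_{\mathsf r}.$$ Moreover, for every loose bimodule $\mathbb M$ there are an isomorphism $T$ from the target of $\mathfrak c\mathbb M$ to the target of $\mathbb M$ and an isomorphism of categories $\mathsf{Car}(\mathfrak c\mathbb M)\cong\mathsf{Car}(\mathbb M)$ that commutes with the functors $\mathsf{codom}$ along $T$. -/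

import Mathlib

open CategoryTheory Bicategory

universe v u

namespace LooseBimodule

set_option linter.checkUnivs false

/-- A (pseudo) double category, that is, a pseudo-category in the 2-category of categories. -/
structure DblCat : Type (max (u + 1) (v + 1)) where
  Obj : Type u
  [tight : Category.{v} Obj]
  /-- Loose arrows. -/
  Loose : Obj → Obj → Type u
  /-- Squares with top `m` and bottom `n`; their sides are `left` and `right`. -/
  Sq : ∀ {a b c d : Obj}, Loose a b → Loose c d → Type v
  left : ∀ {a b c d : Obj} {m : Loose a b} {n : Loose c d}, Sq m n → (a ⟶ c)
  right : ∀ {a b c d : Obj} {m : Loose a b} {n : Loose c d}, Sq m n → (b ⟶ d)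
  /-- Loose arrows and squares form a category, and `left`, `right` are functors. -/
  vid : ∀ {a b : Obj} (m : Loose a b), Sq m m
  vcomp : ∀ {a b c d e f : Obj} {m : Loose a b} {n : Loose c d} {p : Loose e f},
    Sq m n → Sq n p → Sq m p
  vid_vcomp : ∀ {a b c d : Obj} {m : Loose a b} {n : Loose c d} (s : Sq m n),
    vcomp (vid m) s = s
  vcomp_vid : ∀ {a b c d : Obj} {m : Loose a b} {n : Loose c d} (s : Sq m n),
    vcomp s (vid n) = s
  vassoc : ∀ {a b c d e f g h : Obj} {m : Loose a b} {n : Loose c d} {p : Loose e f}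
    {q : Loose g h} (s : Sq m n) (t : Sq n p) (w : Sq p q),
    vcomp (vcomp s t) w = vcomp s (vcomp t w)
  left_vid : ∀ {a b : Obj} (m : Loose a b), left (vid m) = 𝟙 a
  right_vid : ∀ {a b : Obj} (m : Loose a b), right (vid m) = 𝟙 b
  left_vcomp : ∀ {a b c d e f : Obj} {m : Loose a b} {n : Loose c d} {p : Loose e f}
    (s : Sq m n) (t : Sq n p), left (vcomp s t) = left s ≫ left t
  right_vcomp : ∀ {a b c d e f : Obj} {m : Loose a b} {n : Loose c d} {p : Loose e f}
    (s : Sq m n) (t : Sq n p), right (vcomp s t) = right s ≫ right t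
  /-- Loose identities, a functor from the tight category to the category of squares. -/
  unit : ∀ a : Obj, Loose a a
  unitSq : ∀ {a b : Obj}, (a ⟶ b) → Sq (unit a) (unit b)
  left_unitSq : ∀ {a b : Obj} (f : a ⟶ b), left (unitSq f) = f
  right_unitSq : ∀ {a b : Obj} (f : a ⟶ b), right (unitSq f) = f
  unitSq_id : ∀ a : Obj, unitSq (𝟙 a) = vid (unit a)
  unitSq_comp : ∀ {a b c : Obj} (f : a ⟶ b) (g : b ⟶ c),
    unitSq (f ≫ g) = vcomp (unitSq f) (unitSq g)
  /-- Loose composition, a functor on horizontally composable pairs. -/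
  comp : ∀ {a b c : Obj}, Loose a b → Loose b c → Loose a c
  hcomp : ∀ {a b c a' b' c' : Obj} {m : Loose a b} {n : Loose b c} {m' : Loose a' b'}
    {n' : Loose b' c'} (s : Sq m m') (t : Sq n n'), right s = left t → Sq (comp m n) (comp m' n')
  left_hcomp : ∀ {a b c a' b' c' : Obj} {m : Loose a b} {n : Loose b c} {m' : Loose a' b'}
    {n' : Loose b' c'} (s : Sq m m') (t : Sq n n') (h : right s = left t),
    left (hcomp s t h) = left s
  right_hcomp : ∀ {a b c a' b' c' : Obj} {m : Loose a b} {n : Loose b c} {m' : Loose a' b'}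
    {n' : Loose b' c'} (s : Sq m m') (t : Sq n n') (h : right s = left t),
    right (hcomp s t h) = right t
  hcomp_vid : ∀ {a b c : Obj} (m : Loose a b) (n : Loose b c),
    hcomp (vid m) (vid n) ((right_vid m).trans (left_vid n).symm) = vid (comp m n)
  hcomp_vcomp : ∀ {a b c a' b' c' a'' b'' c'' : Obj} {m : Loose a b} {n : Loose b c}
    {m' : Loose a' b'} {n' : Loose b' c'} {m'' : Loose a'' b''} {n'' : Loose b'' c''}
    (s : Sq m m') (t : Sq n n') (h : right s = left t)
    (s' : Sq m' m'') (t' : Sq n' n'') (h' : right s' = left t'),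
    hcomp (vcomp s s') (vcomp t t') (by rw [right_vcomp, left_vcomp, h, h']) =
      vcomp (hcomp s t h) (hcomp s' t' h')
  /-- Associators: invertible globular squares, natural. -/
  assoc : ∀ {a b c d : Obj} (m : Loose a b) (n : Loose b c) (p : Loose c d),
    Sq (comp (comp m n) p) (comp m (comp n p))
  left_assoc : ∀ {a b c d : Obj} (m : Loose a b) (n : Loose b c) (p : Loose c d),
    left (assoc m n p) = 𝟙 a
  right_assoc : ∀ {a b c d : Obj} (m : Loose a b) (n : Loose b c) (p : Loose c d),
    right (assoc m n p) = 𝟙 d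
  assoc_inv : ∀ {a b c d : Obj} (m : Loose a b) (n : Loose b c) (p : Loose c d),
    ∃ t, vcomp (assoc m n p) t = vid _ ∧ vcomp t (assoc m n p) = vid _
  assoc_naturality : ∀ {a b c d a' b' c' d' : Obj} {m : Loose a b} {n : Loose b c}
    {p : Loose c d} {m' : Loose a' b'} {n' : Loose b' c'} {p' : Loose c' d'}
    (s : Sq m m') (t : Sq n n') (w : Sq p p') (h : right s = left t) (h' : right t = left w),
    vcomp (hcomp (hcomp s t h) w ((right_hcomp s t h).trans h')) (assoc m' n' p') =
      vcomp (assoc m n p) (hcomp s (hcomp t w h') (h.trans (left_hcomp t w h').symm))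
  /-- Left unitors: invertible globular squares, natural. -/
  lunit : ∀ {a b : Obj} (m : Loose a b), Sq (comp (unit a) m) m
  left_lunit : ∀ {a b : Obj} (m : Loose a b), left (lunit m) = 𝟙 a
  right_lunit : ∀ {a b : Obj} (m : Loose a b), right (lunit m) = 𝟙 b
  lunit_inv : ∀ {a b : Obj} (m : Loose a b),
    ∃ t, vcomp (lunit m) t = vid _ ∧ vcomp t (lunit m) = vid _
  lunit_naturality : ∀ {a b a' b' : Obj} {m : Loose a b} {m' : Loose a' b'} (s : Sq m m'),
    vcomp (hcomp (unitSq (left s)) s (right_unitSq _)) (lunit m') = vcomp (lunit m) s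
  /-- Right unitors: invertible globular squares, natural. -/
  runit : ∀ {a b : Obj} (m : Loose a b), Sq (comp m (unit b)) m
  left_runit : ∀ {a b : Obj} (m : Loose a b), left (runit m) = 𝟙 a
  right_runit : ∀ {a b : Obj} (m : Loose a b), right (runit m) = 𝟙 b
  runit_inv : ∀ {a b : Obj} (m : Loose a b),
    ∃ t, vcomp (runit m) t = vid _ ∧ vcomp t (runit m) = vid _
  runit_naturality : ∀ {a b a' b' : Obj} {m : Loose a b} {m' : Loose a' b'} (s : Sq m m'),
    vcomp (hcomp s (unitSq (right s)) (left_unitSq _).symm) (runit m') = vcomp (runit m) s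
  pentagon : ∀ {a b c d e : Obj} (m : Loose a b) (n : Loose b c) (p : Loose c d) (q : Loose d e),
    vcomp (hcomp (assoc m n p) (vid q) ((right_assoc m n p).trans (left_vid q).symm))
        (vcomp (assoc m (comp n p) q)
          (hcomp (vid m) (assoc n p q) ((right_vid m).trans (left_assoc n p q).symm))) =
      vcomp (assoc (comp m n) p q) (assoc m n (comp p q))
  triangle : ∀ {a b c : Obj} (m : Loose a b) (n : Loose b c),
    vcomp (assoc m (unit b) n)
        (hcomp (vid m) (lunit n) ((right_vid m).trans (left_lunit n).symm)) =
      hcomp (runit m) (vid n) ((right_runit m).trans (left_vid n).symm)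

attribute [instance] DblCat.tight
attribute [simp] DblCat.vid_vcomp DblCat.vcomp_vid DblCat.vassoc DblCat.left_vid
  DblCat.right_vid DblCat.left_vcomp DblCat.right_vcomp DblCat.left_unitSq DblCat.right_unitSq
  DblCat.unitSq_id DblCat.unitSq_comp DblCat.left_hcomp DblCat.right_hcomp DblCat.hcomp_vid
  DblCat.left_assoc DblCat.right_assoc DblCat.left_lunit DblCat.right_lunit
  DblCat.left_runit DblCat.right_runit

/-- A pseudo double functor; `μ` and `η` compare composites and loose identities. -/
structure DblFunctor (D E : DblCat.{v, u}) : Type (max u v) where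
  obj : D.Obj → E.Obj
  map : ∀ {a b : D.Obj}, (a ⟶ b) → (obj a ⟶ obj b)
  map_id : ∀ a : D.Obj, map (𝟙 a) = 𝟙 (obj a)
  map_comp : ∀ {a b c : D.Obj} (f : a ⟶ b) (g : b ⟶ c), map (f ≫ g) = map f ≫ map g
  loose : ∀ {a b : D.Obj}, D.Loose a b → E.Loose (obj a) (obj b)
  sq : ∀ {a b c d : D.Obj} {m : D.Loose a b} {n : D.Loose c d},
    D.Sq m n → E.Sq (loose m) (loose n)
  left_sq : ∀ {a b c d : D.Obj} {m : D.Loose a b} {n : D.Loose c d} (s : D.Sq m n),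
    E.left (sq s) = map (D.left s)
  right_sq : ∀ {a b c d : D.Obj} {m : D.Loose a b} {n : D.Loose c d} (s : D.Sq m n),
    E.right (sq s) = map (D.right s)
  sq_vid : ∀ {a b : D.Obj} (m : D.Loose a b), sq (D.vid m) = E.vid (loose m)
  sq_vcomp : ∀ {a b c d e f : D.Obj} {m : D.Loose a b} {n : D.Loose c d} {p : D.Loose e f}
    (s : D.Sq m n) (t : D.Sq n p), sq (D.vcomp s t) = E.vcomp (sq s) (sq t)
  μ : ∀ {a b c : D.Obj} (m : D.Loose a b) (n : D.Loose b c),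
    E.Sq (E.comp (loose m) (loose n)) (loose (D.comp m n))
  left_μ : ∀ {a b c : D.Obj} (m : D.Loose a b) (n : D.Loose b c), E.left (μ m n) = 𝟙 _
  right_μ : ∀ {a b c : D.Obj} (m : D.Loose a b) (n : D.Loose b c), E.right (μ m n) = 𝟙 _
  μ_inv : ∀ {a b c : D.Obj} (m : D.Loose a b) (n : D.Loose b c),
    ∃ t, E.vcomp (μ m n) t = E.vid _ ∧ E.vcomp t (μ m n) = E.vid _
  μ_naturality : ∀ {a b c a' b' c' : D.Obj} {m : D.Loose a b} {n : D.Loose b c}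
    {m' : D.Loose a' b'} {n' : D.Loose b' c'} (s : D.Sq m m') (t : D.Sq n n')
    (h : D.right s = D.left t),
    E.vcomp (E.hcomp (sq s) (sq t) (by rw [right_sq, left_sq, h])) (μ m' n') =
      E.vcomp (μ m n) (sq (D.hcomp s t h))
  η : ∀ a : D.Obj, E.Sq (E.unit (obj a)) (loose (D.unit a))
  left_η : ∀ a : D.Obj, E.left (η a) = 𝟙 _
  right_η : ∀ a : D.Obj, E.right (η a) = 𝟙 _
  η_inv : ∀ a : D.Obj, ∃ t, E.vcomp (η a) t = E.vid _ ∧ E.vcomp t (η a) = E.vid _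
  η_naturality : ∀ {a b : D.Obj} (f : a ⟶ b),
    E.vcomp (E.unitSq (map f)) (η b) = E.vcomp (η a) (sq (D.unitSq f))
  map_assoc : ∀ {a b c d : D.Obj} (m : D.Loose a b) (n : D.Loose b c) (p : D.Loose c d),
    E.vcomp (E.hcomp (μ m n) (E.vid (loose p)) ((right_μ m n).trans (E.left_vid _).symm))
        (E.vcomp (μ (D.comp m n) p) (sq (D.assoc m n p))) =
      E.vcomp (E.assoc (loose m) (loose n) (loose p))
        (E.vcomp (E.hcomp (E.vid (loose m)) (μ n p) ((E.right_vid _).trans (left_μ n p).symm))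
          (μ m (D.comp n p)))
  map_lunit : ∀ {a b : D.Obj} (m : D.Loose a b),
    E.vcomp (E.hcomp (η a) (E.vid (loose m)) ((right_η a).trans (E.left_vid _).symm))
        (E.vcomp (μ (D.unit a) m) (sq (D.lunit m))) = E.lunit (loose m)
  map_runit : ∀ {a b : D.Obj} (m : D.Loose a b),
    E.vcomp (E.hcomp (E.vid (loose m)) (η b) ((E.right_vid _).trans (left_η b).symm))
        (E.vcomp (μ m (D.unit b)) (sq (D.runit m))) = E.runit (loose m)

attribute [simp] DblFunctor.map_id DblFunctor.map_comp DblFunctor.left_sq DblFunctor.right_sq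
  DblFunctor.sq_vid DblFunctor.sq_vcomp DblFunctor.left_μ DblFunctor.right_μ
  DblFunctor.left_η DblFunctor.right_η

/-- A tight transformation of pseudo double functors. -/
@[ext]
structure TightTrans {D E : DblCat.{v, u}} (F G : DblFunctor D E) : Type (max u v) where
  app : ∀ a : D.Obj, F.obj a ⟶ G.obj a
  sq : ∀ {a b : D.Obj} (m : D.Loose a b), E.Sq (F.loose m) (G.loose m)
  left_sq : ∀ {a b : D.Obj} (m : D.Loose a b), E.left (sq m) = app a
  right_sq : ∀ {a b : D.Obj} (m : D.Loose a b), E.right (sq m) = app b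
  naturality : ∀ {a b : D.Obj} (f : a ⟶ b), F.map f ≫ app b = app a ≫ G.map f
  sq_naturality : ∀ {a b c d : D.Obj} {m : D.Loose a b} {n : D.Loose c d} (s : D.Sq m n),
    E.vcomp (F.sq s) (sq n) = E.vcomp (sq m) (G.sq s)
  sq_comp : ∀ {a b c : D.Obj} (m : D.Loose a b) (n : D.Loose b c),
    E.vcomp (F.μ m n) (sq (D.comp m n)) =
      E.vcomp (E.hcomp (sq m) (sq n) ((right_sq m).trans (left_sq n).symm)) (G.μ m n)
  sq_unit : ∀ a : D.Obj,
    E.vcomp (F.η a) (sq (D.unit a)) = E.vcomp (E.unitSq (app a)) (G.η a)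

attribute [simp] TightTrans.left_sq TightTrans.right_sq

namespace DblCat

variable (E : DblCat.{v, u})

theorem hcomp_congr {a b c a' b' c' : E.Obj} {m : E.Loose a b} {n : E.Loose b c}
    {m' : E.Loose a' b'} {n' : E.Loose b' c'} {s s₁ : E.Sq m m'} {t t₁ : E.Sq n n'}
    (h : E.right s = E.left t) (hs : s = s₁) (ht : t = t₁) :
    E.hcomp s t h = E.hcomp s₁ t₁ (by rw [← hs, ← ht, h]) := by
  subst hs ht; rfl

theorem inv_vcomp {a b c d e f : E.Obj} {m : E.Loose a b} {n : E.Loose c d} {p : E.Loose e f}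
    {s : E.Sq m n} {t : E.Sq n p}
    (hs : ∃ s', E.vcomp s s' = E.vid _ ∧ E.vcomp s' s = E.vid _)
    (ht : ∃ t', E.vcomp t t' = E.vid _ ∧ E.vcomp t' t = E.vid _) :
    ∃ w, E.vcomp (E.vcomp s t) w = E.vid _ ∧ E.vcomp w (E.vcomp s t) = E.vid _ := by
  obtain ⟨s', h1, h2⟩ := hs
  obtain ⟨t', h3, h4⟩ := ht
  refine ⟨E.vcomp t' s', ?_, ?_⟩
  · rw [E.vassoc, ← E.vassoc t, h3, E.vid_vcomp, h1]
  · rw [E.vassoc, ← E.vassoc s', h2, E.vid_vcomp, h4]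

end DblCat

namespace DblFunctor

variable {C D E E' : DblCat.{v, u}}

theorem inv_sq (F : DblFunctor D E) {a b c d : D.Obj} {m : D.Loose a b} {n : D.Loose c d}
    {s : D.Sq m n} (hs : ∃ s', D.vcomp s s' = D.vid _ ∧ D.vcomp s' s = D.vid _) :
    ∃ w, E.vcomp (F.sq s) w = E.vid _ ∧ E.vcomp w (F.sq s) = E.vid _ := by
  obtain ⟨s', h1, h2⟩ := hs
  exact ⟨F.sq s', by rw [← F.sq_vcomp, h1, F.sq_vid], by rw [← F.sq_vcomp, h2, F.sq_vid]⟩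

/-- The identity double functor. -/
def id (D : DblCat.{v, u}) : DblFunctor D D where
  obj a := a
  map f := f
  map_id _ := rfl
  map_comp _ _ := rfl
  loose m := m
  sq s := s
  left_sq _ := rfl
  right_sq _ := rfl
  sq_vid _ := rfl
  sq_vcomp _ _ := rfl
  μ m n := D.vid _
  left_μ _ _ := D.left_vid _
  right_μ _ _ := D.right_vid _
  μ_inv _ _ := ⟨D.vid _, D.vid_vcomp _, D.vid_vcomp _⟩
  μ_naturality s t h := by simp
  η a := D.vid _
  left_η _ := D.left_vid _
  right_η _ := D.right_vid _
  η_inv _ := ⟨D.vid _, D.vid_vcomp _, D.vid_vcomp _⟩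
  η_naturality f := by simp
  map_assoc m n p := by simp
  map_lunit m := by simp
  map_runit m := by simp

/-- Composition of pseudo double functors. -/
def comp (F : DblFunctor C D) (G : DblFunctor D E) : DblFunctor C E where
  obj a := G.obj (F.obj a)
  map f := G.map (F.map f)
  map_id _ := by simp
  map_comp _ _ := by simp
  loose m := G.loose (F.loose m)
  sq s := G.sq (F.sq s)
  left_sq _ := by simp
  right_sq _ := by simp
  sq_vid _ := by simp
  sq_vcomp _ _ := by simp
  μ m n := E.vcomp (G.μ (F.loose m) (F.loose n)) (G.sq (F.μ m n))
  left_μ _ _ := by simp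
  right_μ _ _ := by simp
  μ_inv m n := E.inv_vcomp (G.μ_inv _ _) (G.inv_sq (F.μ_inv m n))
  μ_naturality s t h := by
    rw [← E.vassoc, G.μ_naturality _ _ (by simp [h]), E.vassoc, E.vassoc, ← G.sq_vcomp,
      ← G.sq_vcomp, F.μ_naturality]
  η a := E.vcomp (G.η (F.obj a)) (G.sq (F.η a))
  left_η _ := by simp
  right_η _ := by simp
  η_inv a := E.inv_vcomp (G.η_inv _) (G.inv_sq (F.η_inv a))
  η_naturality f := by
    rw [← E.vassoc, G.η_naturality, E.vassoc, E.vassoc, ← G.sq_vcomp, ← G.sq_vcomp,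
      F.η_naturality]
  map_assoc m n p := by
    have h1 := G.μ_naturality (F.μ m n) (D.vid (F.loose p)) (by simp)
    have h2 := G.μ_naturality (D.vid (F.loose m)) (F.μ n p) (by simp)
    have e1 := E.hcomp_vcomp (G.μ (F.loose m) (F.loose n)) (E.vid (G.loose (F.loose p))) (by simp)
      (G.sq (F.μ m n)) (G.sq (D.vid (F.loose p))) (by simp)
    have e2 := E.hcomp_vcomp (E.vid (G.loose (F.loose m))) (G.μ (F.loose n) (F.loose p)) (by simp)
      (G.sq (D.vid (F.loose m))) (G.sq (F.μ n p)) (by simp)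
    simp only [sq_vid, DblCat.vid_vcomp] at e1 e2 h1 h2
    have k := congrArg G.sq (F.map_assoc m n p)
    simp only [sq_vcomp] at k
    rw [e1, e2, E.vassoc, E.vassoc, ← E.vassoc _ (G.μ _ _), h1, E.vassoc, k, ← E.vassoc (G.μ _ _),
      ← E.vassoc (E.hcomp _ _ _), G.map_assoc]
    simp only [DblCat.vassoc]
    rw [← E.vassoc (E.hcomp _ (G.sq (F.μ n p)) _), h2, E.vassoc]
  map_lunit m := by
    have h1 := G.μ_naturality (F.η _) (D.vid (F.loose m)) (by simp)
    have e1 := E.hcomp_vcomp (G.η _) (E.vid (G.loose (F.loose m))) (by simp)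
      (G.sq (F.η _)) (G.sq (D.vid (F.loose m))) (by simp)
    simp only [sq_vid, DblCat.vid_vcomp] at e1 h1
    have k := congrArg G.sq (F.map_lunit m)
    simp only [sq_vcomp] at k
    rw [e1, E.vassoc, E.vassoc, ← E.vassoc _ (G.μ _ _), h1, E.vassoc, k, G.map_lunit]
  map_runit m := by
    have h1 := G.μ_naturality (D.vid (F.loose m)) (F.η _) (by simp)
    have e1 := E.hcomp_vcomp (E.vid (G.loose (F.loose m))) (G.η _) (by simp)
      (G.sq (D.vid (F.loose m))) (G.sq (F.η _)) (by simp)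
    simp only [sq_vid, DblCat.vid_vcomp] at e1 h1
    have k := congrArg G.sq (F.map_runit m)
    simp only [sq_vcomp] at k
    rw [e1, E.vassoc, E.vassoc, ← E.vassoc _ (G.μ _ _), h1, E.vassoc, k, G.map_runit]

theorem ext_data {F G : DblFunctor D E} (hobj : ∀ a, F.obj a = G.obj a)
    (hmap : ∀ {a b : D.Obj} (f : a ⟶ b), HEq (F.map f) (G.map f))
    (hloose : ∀ {a b : D.Obj} (m : D.Loose a b), HEq (F.loose m) (G.loose m))
    (hsq : ∀ {a b c d : D.Obj} {m : D.Loose a b} {n : D.Loose c d} (s : D.Sq m n),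
      HEq (F.sq s) (G.sq s))
    (hμ : ∀ {a b c : D.Obj} (m : D.Loose a b) (n : D.Loose b c), HEq (F.μ m n) (G.μ m n))
    (hη : ∀ a : D.Obj, HEq (F.η a) (G.η a)) : F = G := by
  cases F with | mk Fo Fm _ _ Fl Fs _ _ _ _ Fμ _ _ _ _ Fη _ _ _ _ _ _ _
  cases G with | mk Go Gm _ _ Gl Gs _ _ _ _ Gμ _ _ _ _ Gη _ _ _ _ _ _ _
  dsimp only at *
  obtain rfl : Fo = Go := funext hobj
  obtain rfl : @Fm = @Gm := by
    funext a b f; exact eq_of_heq (hmap f)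
  obtain rfl : @Fl = @Gl := by
    funext a b m; exact eq_of_heq (hloose m)
  obtain rfl : @Fs = @Gs := by
    funext a b c d m n s; exact eq_of_heq (hsq s)
  obtain rfl : @Fμ = @Gμ := by
    funext a b c m n; exact eq_of_heq (hμ m n)
  obtain rfl : Fη = Gη := by
    funext a; exact eq_of_heq (hη a)
  rfl

end DblFunctor

namespace TightTrans

variable {C D E E' : DblCat.{v, u}}

/-- The identity transformation. -/
def id (F : DblFunctor D E) : TightTrans F F where
  app a := 𝟙 _
  sq m := E.vid _
  left_sq _ := by simp
  right_sq _ := by simp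
  naturality _ := by simp
  sq_naturality _ := by simp
  sq_comp _ _ := by simp
  sq_unit _ := by simp

/-- Vertical composition of transformations. -/
def comp {F G H : DblFunctor D E} (α : TightTrans F G) (β : TightTrans G H) : TightTrans F H where
  app a := α.app a ≫ β.app a
  sq m := E.vcomp (α.sq m) (β.sq m)
  left_sq _ := by simp
  right_sq _ := by simp
  naturality f := by rw [← Category.assoc, α.naturality, Category.assoc, β.naturality,
    Category.assoc]
  sq_naturality s := by rw [← E.vassoc, α.sq_naturality, E.vassoc, β.sq_naturality, E.vassoc]
  sq_comp m n := by
    rw [E.hcomp_vcomp _ _ (by simp) _ _ (by simp), ← E.vassoc, α.sq_comp, E.vassoc, β.sq_comp,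
      E.vassoc]
  sq_unit a := by rw [← E.vassoc, α.sq_unit, E.vassoc, β.sq_unit, E.unitSq_comp, E.vassoc]

/-- Whiskering on the left by a double functor. -/
def whiskerLeft (F : DblFunctor C D) {G H : DblFunctor D E} (α : TightTrans G H) :
    TightTrans (F.comp G) (F.comp H) where
  app a := α.app (F.obj a)
  sq m := α.sq (F.loose m)
  left_sq _ := α.left_sq _
  right_sq _ := α.right_sq _
  naturality f := α.naturality _
  sq_naturality s := α.sq_naturality _
  sq_comp m n := by
    dsimp only [DblFunctor.comp]
    rw [E.vassoc, α.sq_naturality, ← E.vassoc, α.sq_comp, E.vassoc]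
  sq_unit a := by
    dsimp only [DblFunctor.comp]
    rw [E.vassoc, α.sq_naturality, ← E.vassoc, α.sq_unit, E.vassoc]

/-- Whiskering on the right by a double functor. -/
def whiskerRight {F G : DblFunctor C D} (α : TightTrans F G) (H : DblFunctor D E) :
    TightTrans (F.comp H) (G.comp H) where
  app a := H.map (α.app a)
  sq m := H.sq (α.sq m)
  left_sq m := (H.left_sq _).trans (congrArg H.map (α.left_sq m))
  right_sq m := (H.right_sq _).trans (congrArg H.map (α.right_sq m))
  naturality f := by
    dsimp only [DblFunctor.comp]
    rw [← H.map_comp, α.naturality, H.map_comp]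
  sq_naturality s := by
    dsimp only [DblFunctor.comp]
    rw [← H.sq_vcomp, α.sq_naturality, H.sq_vcomp]
  sq_comp m n := by
    dsimp only [DblFunctor.comp]
    rw [E.vassoc, ← H.sq_vcomp, α.sq_comp, H.sq_vcomp, ← E.vassoc, ← H.μ_naturality, E.vassoc]
  sq_unit a := by
    dsimp only [DblFunctor.comp]
    rw [E.vassoc, ← H.sq_vcomp, α.sq_unit, H.sq_vcomp, ← E.vassoc, ← H.η_naturality, E.vassoc]

end TightTrans

instance : CategoryStruct.{max u v} DblCat.{v, u} where
  Hom D E := DblFunctor D E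
  id D := DblFunctor.id D
  comp F G := DblFunctor.comp F G

instance (D E : DblCat.{v, u}) : Category.{max u v} (D ⟶ E) where
  Hom F G := TightTrans F G
  id F := TightTrans.id F
  comp α β := TightTrans.comp α β
  id_comp α := by
    apply TightTrans.ext
    · funext a; exact Category.id_comp _
    · funext a b m; exact E.vid_vcomp _
  comp_id α := by
    apply TightTrans.ext
    · funext a; exact Category.comp_id _
    · funext a b m; exact E.vcomp_vid _
  assoc α β γ := by
    apply TightTrans.ext
    · funext a; exact Category.assoc _ _ _
    · funext a b m; exact E.vassoc _ _ _

namespace DblCat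

variable {C D E E' : DblCat.{v, u}}

theorem comp_assoc (F : C ⟶ D) (G : D ⟶ E) (H : E ⟶ E') : (F ≫ G) ≫ H = F ≫ G ≫ H :=
  DblFunctor.ext_data (fun _ => rfl) (fun _ => HEq.rfl) (fun _ => HEq.rfl)
    (fun _ => HEq.rfl)
    (fun _ _ => heq_of_eq
      ((congrArg (E'.vcomp _) (DblFunctor.sq_vcomp H _ _)).trans (E'.vassoc _ _ _).symm))
    (fun _ => heq_of_eq
      ((congrArg (E'.vcomp _) (DblFunctor.sq_vcomp H _ _)).trans (E'.vassoc _ _ _).symm))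

theorem id_comp' (F : C ⟶ D) : 𝟙 C ≫ F = F :=
  DblFunctor.ext_data (fun _ => rfl) (fun _ => HEq.rfl) (fun _ => HEq.rfl)
    (fun _ => HEq.rfl)
    (fun _ _ => heq_of_eq
      ((congrArg (D.vcomp _) (DblFunctor.sq_vid F _)).trans (D.vcomp_vid _)))
    (fun _ => heq_of_eq
      ((congrArg (D.vcomp _) (DblFunctor.sq_vid F _)).trans (D.vcomp_vid _)))

theorem comp_id' (F : C ⟶ D) : F ≫ 𝟙 D = F :=
  DblFunctor.ext_data (fun _ => rfl) (fun _ => HEq.rfl) (fun _ => HEq.rfl)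
    (fun _ => HEq.rfl) (fun _ _ => heq_of_eq (D.vid_vcomp _))
    (fun _ => heq_of_eq (D.vid_vcomp _))

theorem hom_ext₂ {F G : C ⟶ D} {α β : F ⟶ G} (h₁ : ∀ a, TightTrans.app α a = TightTrans.app β a)
    (h₂ : ∀ {a b : C.Obj} (m : C.Loose a b), TightTrans.sq α m = TightTrans.sq β m) : α = β :=
  TightTrans.ext (funext h₁) (by funext a b m; exact h₂ m)

theorem eqToHom_app {F G : C ⟶ D} (h : F = G) (a : C.Obj) :
    HEq (TightTrans.app (eqToHom h) a) (𝟙 (DblFunctor.obj F a)) := by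
  subst h; rfl

theorem eqToHom_sq {F G : C ⟶ D} (h : F = G) {a b : C.Obj} (m : C.Loose a b) :
    HEq (TightTrans.sq (eqToHom h) m) (D.vid (DblFunctor.loose F m)) := by
  subst h; rfl

/-- Whiskering a 2-cell on the left. -/
def wL (F : C ⟶ D) {G H : D ⟶ E} (α : G ⟶ H) : F ≫ G ⟶ F ≫ H := TightTrans.whiskerLeft F α

/-- Whiskering a 2-cell on the right. -/
def wR {F G : C ⟶ D} (α : F ⟶ G) (H : D ⟶ E) : F ≫ H ⟶ G ≫ H := TightTrans.whiskerRight α H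

theorem whiskerLeft_eqToHom' (F : C ⟶ D) {G H : D ⟶ E} (h : G = H) :
    wL F (eqToHom h) =
      eqToHom (congrArg (fun K => F ≫ K) h) := by
  subst h; rfl

theorem whiskerRight_eqToHom' {F G : C ⟶ D} (h : F = G) (H : D ⟶ E) :
    wR (eqToHom h) H =
      eqToHom (congrArg (fun K => K ≫ H) h) := by
  subst h
  exact hom_ext₂ (fun a => DblFunctor.map_id H _) (fun m => DblFunctor.sq_vid H _)

/-- A transformation which is composed with identities on both sides. -/
theorem conj_eq {F F' G G' : C ⟶ D} (hF : F = F') (hG : G' = G) (α : F ⟶ G) (β : F' ⟶ G')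
    (h₁ : ∀ a, HEq (TightTrans.app α a) (TightTrans.app β a))
    (h₂ : ∀ {a b : C.Obj} (m : C.Loose a b), HEq (TightTrans.sq α m) (TightTrans.sq β m)) :
    α = eqToHom hF ≫ β ≫ eqToHom hG := by
  subst hF hG
  simp only [eqToHom_refl, Category.id_comp, Category.comp_id]
  exact hom_ext₂ (fun a => eq_of_heq (h₁ a)) (fun m => eq_of_heq (h₂ m))

end DblCat

/-- The 2-category of pseudo double categories, pseudo double functors and tight
transformations. -/
instance : Bicategory.{max u v, max u v} DblCat.{v, u} where
  whiskerLeft F _ _ α := DblCat.wL F α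
  whiskerRight α H := DblCat.wR α H
  associator F G H := eqToIso (DblCat.comp_assoc F G H)
  leftUnitor F := eqToIso (DblCat.id_comp' F)
  rightUnitor F := eqToIso (DblCat.comp_id' F)
  whiskerLeft_id F G := rfl
  whiskerLeft_comp F _ _ _ α β := rfl
  id_whiskerLeft α := DblCat.conj_eq (DblCat.id_comp' _) (DblCat.id_comp' _).symm
      (DblCat.wL (𝟙 _) α) α (fun _ => HEq.rfl) (fun _ => HEq.rfl)
  comp_whiskerLeft F G _ _ α :=
    DblCat.conj_eq (DblCat.comp_assoc _ _ _) (DblCat.comp_assoc _ _ _).symm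
      (DblCat.wL (F ≫ G) α) (DblCat.wL F (DblCat.wL G α)) (fun _ => HEq.rfl) (fun _ => HEq.rfl)
  id_whiskerRight F G :=
    DblCat.hom_ext₂ (fun _ => DblFunctor.map_id G _) (fun _ => DblFunctor.sq_vid G _)
  comp_whiskerRight α β H :=
    DblCat.hom_ext₂ (fun _ => DblFunctor.map_comp H _ _) (fun _ => DblFunctor.sq_vcomp H _ _)
  whiskerRight_id α := DblCat.conj_eq (DblCat.comp_id' _) (DblCat.comp_id' _).symm
      (DblCat.wR α (𝟙 _)) α (fun _ => HEq.rfl) (fun _ => HEq.rfl)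
  whiskerRight_comp α G H :=
    DblCat.conj_eq (DblCat.comp_assoc _ _ _).symm (DblCat.comp_assoc _ _ _)
      (DblCat.wR α (G ≫ H)) (DblCat.wR (DblCat.wR α G) H) (fun _ => HEq.rfl) (fun _ => HEq.rfl)
  whisker_assoc F _ _ α H :=
    DblCat.conj_eq (DblCat.comp_assoc _ _ _) (DblCat.comp_assoc _ _ _).symm
      (DblCat.wR (DblCat.wL F α) H) (DblCat.wL F (DblCat.wR α H)) (fun _ => HEq.rfl) (fun _ => HEq.rfl)
  whisker_exchange α β :=
    DblCat.hom_ext₂ (fun a => (TightTrans.naturality β (TightTrans.app α a)).symm)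
      (fun m => (TightTrans.sq_naturality β (TightTrans.sq α m)).symm)
  pentagon F G H K := by
    simp only [eqToIso.hom, DblCat.whiskerLeft_eqToHom', DblCat.whiskerRight_eqToHom',
      eqToHom_trans]
  triangle F G := by
    simp only [eqToIso.hom, DblCat.whiskerLeft_eqToHom', DblCat.whiskerRight_eqToHom',
      eqToHom_trans]

instance : Bicategory.Strict DblCat.{v, u} where
  id_comp := DblCat.id_comp'
  comp_id := DblCat.comp_id'
  assoc := DblCat.comp_assoc
  leftUnitor_eqToIso _ := rfl
  rightUnitor_eqToIso _ := rfl
  associator_eqToIso _ _ _ := rfl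

/-! ### Strict slices -/

section Slice

universe w v' u'

variable {B : Type u'} [Bicategory.{w, v'} B]

/-- Objects of the strict slice 2-category over `X`. -/
structure Slice (X : B) where
  dom : B
  hom : dom ⟶ X

namespace Slice

variable {X : B}

/-- Arrows of the strict slice: strictly commuting triangles. -/
@[ext]
structure Hom (M N : Slice X) where
  arr : M.dom ⟶ N.dom
  w : arr ≫ N.hom = M.hom

/-- 2-cells of the strict slice: those whose whiskering with the projection to `X` is an
identity. -/
@[ext]
structure Hom₂ {M N : Slice X} (F G : Hom M N) where
  cell : F.arr ⟶ G.arr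
  w : cell ▷ N.hom = eqToHom (F.w.trans G.w.symm)

attribute [simp] Hom₂.w

variable [Bicategory.Strict B]

instance : CategoryStruct (Slice X) where
  Hom M N := Hom M N
  id M := ⟨𝟙 M.dom, Bicategory.Strict.id_comp _⟩
  comp F G := ⟨F.arr ≫ G.arr, by rw [Bicategory.Strict.assoc, G.w, F.w]⟩

instance (M N : Slice X) : Category (M ⟶ N) where
  Hom F G := Hom₂ F G
  id F := ⟨𝟙 (Hom.arr F), by simp⟩
  comp α β := ⟨α.cell ≫ β.cell, by simp⟩
  id_comp _ := Hom₂.ext (Category.id_comp _)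
  comp_id _ := Hom₂.ext (Category.comp_id _)
  assoc _ _ _ := Hom₂.ext (Category.assoc _ _ _)

theorem eqToHom_cell {M N : Slice X} {F G : M ⟶ N} (h : F = G) :
    Hom₂.cell (eqToHom h) = eqToHom (congrArg Hom.arr h) := by
  subst h; rfl

theorem hom_comp_assoc {M N P Q : Slice X} (F : M ⟶ N) (G : N ⟶ P) (H : P ⟶ Q) :
    (F ≫ G) ≫ H = F ≫ G ≫ H := Hom.ext (Bicategory.Strict.assoc _ _ _)

theorem hom_id_comp {M N : Slice X} (F : M ⟶ N) : 𝟙 M ≫ F = F :=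
  Hom.ext (Bicategory.Strict.id_comp _)

theorem hom_comp_id {M N : Slice X} (F : M ⟶ N) : F ≫ 𝟙 N = F :=
  Hom.ext (Bicategory.Strict.comp_id _)

/-- Whiskering on the left in the slice. -/
def whiskerL {M N P : Slice X} (F : M ⟶ N) {G H : N ⟶ P} (α : G ⟶ H) : F ≫ G ⟶ F ≫ H :=
  Hom₂.mk (Hom.arr F ◁ Hom₂.cell α) (by
    have := Hom₂.w α
    rw [whisker_assoc, this]
    simp [Bicategory.Strict.associator_eqToIso])

/-- Whiskering on the right in the slice. -/
def whiskerR {M N P : Slice X} {F G : M ⟶ N} (α : F ⟶ G) (H : N ⟶ P) : F ≫ H ⟶ G ≫ H :=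
  Hom₂.mk (Hom₂.cell α ▷ Hom.arr H) (by
    have e := Hom.w H
    have h1 := Hom₂.w α
    have h2 := whiskerRight_comp (Hom₂.cell α) (Hom.arr H) P.hom
    rw [Bicategory.whiskerRight_congr e, h1] at h2
    have h3 := congrArg (fun x => (α_ _ _ _).hom ≫ x ≫ (α_ _ _ _).inv) h2
    simp only [Category.assoc, Iso.hom_inv_id_assoc, Iso.hom_inv_id, Category.comp_id] at h3
    rw [← h3]
    simp [Bicategory.Strict.associator_eqToIso])

/-- An identity-like invertible 2-cell lifts to the slice. -/
def isoMk {M N : Slice X} {F G : M ⟶ N} (e : Hom.arr F ≅ Hom.arr G)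
    (h : Hom.arr F = Hom.arr G) (he : e = eqToIso h) : F ≅ G where
  hom := Hom₂.mk e.hom (by rw [he]; simp)
  inv := Hom₂.mk e.inv (by rw [he]; simp)
  hom_inv_id := Hom₂.ext e.hom_inv_id
  inv_hom_id := Hom₂.ext e.inv_hom_id

theorem isoMk_eq {M N : Slice X} {F G : M ⟶ N} (e : Hom.arr F ≅ Hom.arr G)
    (h : Hom.arr F = Hom.arr G) (he : e = eqToIso h) (h' : F = G) :
    isoMk e h he = eqToIso h' := by
  subst h' he; rfl

/-- The strict slice 2-category over `X`. -/
instance : Bicategory (Slice X) where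
  whiskerLeft F _ _ α := whiskerL F α
  whiskerRight α H := whiskerR α H
  associator F G H := isoMk (α_ _ _ _) _ (Bicategory.Strict.associator_eqToIso _ _ _)
  leftUnitor F := isoMk (λ_ _) _ (Bicategory.Strict.leftUnitor_eqToIso _)
  rightUnitor F := isoMk (ρ_ _) _ (Bicategory.Strict.rightUnitor_eqToIso _)
  whiskerLeft_id _ _ := Hom₂.ext (Bicategory.whiskerLeft_id _ _)
  whiskerLeft_comp _ _ _ _ _ _ := Hom₂.ext (Bicategory.whiskerLeft_comp _ _ _)
  id_whiskerLeft α := Hom₂.ext (Bicategory.id_whiskerLeft (Hom₂.cell α))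
  comp_whiskerLeft F G _ _ α :=
    Hom₂.ext (Bicategory.comp_whiskerLeft (Hom.arr F) (Hom.arr G) (Hom₂.cell α))
  id_whiskerRight _ _ := Hom₂.ext (Bicategory.id_whiskerRight _ _)
  comp_whiskerRight _ _ _ := Hom₂.ext (Bicategory.comp_whiskerRight _ _ _)
  whiskerRight_id α := Hom₂.ext (Bicategory.whiskerRight_id (Hom₂.cell α))
  whiskerRight_comp α G H :=
    Hom₂.ext (Bicategory.whiskerRight_comp (Hom₂.cell α) (Hom.arr G) (Hom.arr H))
  whisker_assoc F _ _ α H :=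
    Hom₂.ext (Bicategory.whisker_assoc (Hom.arr F) (Hom₂.cell α) (Hom.arr H))
  whisker_exchange α β := Hom₂.ext (Bicategory.whisker_exchange (Hom₂.cell α) (Hom₂.cell β))
  pentagon F G H K :=
    Hom₂.ext (Bicategory.pentagon (Hom.arr F) (Hom.arr G) (Hom.arr H) (Hom.arr K))
  triangle F G := Hom₂.ext (Bicategory.triangle (Hom.arr F) (Hom.arr G))

instance : Bicategory.Strict (Slice X) where
  id_comp := hom_id_comp
  comp_id := hom_comp_id
  assoc := hom_comp_assoc
  leftUnitor_eqToIso F := isoMk_eq _ _ _ (hom_id_comp F)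
  rightUnitor_eqToIso F := isoMk_eq _ _ _ (hom_comp_id F)
  associator_eqToIso F G H := isoMk_eq _ _ _ (hom_comp_assoc F G H)

end Slice

end Slice

/-! ### The walking loose arrow -/

/-- The objects of the walking loose arrow. -/
inductive LooseObj : Type u
  | zero
  | one

/-- The loose arrows of the walking loose arrow: two identities and one arrow `0 ⇸ 1`. -/
inductive LooseArr : LooseObj.{u} → LooseObj.{u} → Type u
  | unit (a : LooseObj) : LooseArr a a
  | two : LooseArr LooseObj.zero LooseObj.one

/-- The walking loose arrow has only identity tight arrows. -/
@[reducible]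
def LooseObj.category : Category.{v} LooseObj.{u} where
  Hom a b := ULift.{v} (PLift (a = b))
  id _ := ⟨⟨rfl⟩⟩
  comp := fun ⟨⟨h⟩⟩ ⟨⟨h'⟩⟩ => ⟨⟨h.trans h'⟩⟩

theorem ulift_eq {p : Prop} (f g : ULift.{v} (PLift p)) : f = g :=
  ULift.ext _ _ (PLift.down_injective (Subsingleton.elim _ _))

theorem LooseArr.eq {a b : LooseObj.{u}} (m n : LooseArr a b) : m = n := by
  cases m <;> cases n <;> rfl

namespace LooseArr

/-- Composition in the walking loose arrow. -/
def comp : ∀ {a b c : LooseObj.{u}}, LooseArr a b → LooseArr b c → LooseArr a c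
  | _, _, _, unit _, n => n
  | _, _, _, two, unit _ => two

end LooseArr

/-- The walking loose arrow has only identity squares: there is a square from `m` to `n` if and
only if `m` and `n` are the same loose arrow, and it is then unique. -/
def LooseSq {a b c d : LooseObj.{u}} (m : LooseArr a b) (n : LooseArr c d) : Type v :=
  ULift.{v} (PLift (a = c ∧ b = d ∧ HEq m n))

instance {a b c d : LooseObj.{u}} (m : LooseArr a b) (n : LooseArr c d) :
    Subsingleton (LooseSq.{v} m n) :=
  ⟨fun f g => ulift_eq f g⟩

namespace LooseSq

/-- Parallel arrows of the walking loose arrow are equal. -/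
def ofEq {a b c d : LooseObj.{u}} (m : LooseArr a b) (n : LooseArr c d) (h : a = c)
    (h' : b = d) : LooseSq.{v} m n :=
  ⟨⟨h, h', by subst h h'; rw [LooseArr.eq m n]⟩⟩

end LooseSq

/-- The walking loose arrow, as a (strict) double category. -/
def WalkingLoose : DblCat.{v, u} where
  Obj := LooseObj.{u}
  tight := LooseObj.category.{v, u}
  Loose := LooseArr
  Sq m n := LooseSq m n
  left s := ⟨⟨s.down.down.1⟩⟩
  right s := ⟨⟨s.down.down.2.1⟩⟩
  vid m := LooseSq.ofEq m m rfl rfl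
  vcomp s t := LooseSq.ofEq _ _ (s.down.down.1.trans t.down.down.1)
    (s.down.down.2.1.trans t.down.down.2.1)
  vid_vcomp _ := Subsingleton.elim _ _
  vcomp_vid _ := Subsingleton.elim _ _
  vassoc _ _ _ := Subsingleton.elim _ _
  left_vid _ := ulift_eq _ _
  right_vid _ := ulift_eq _ _
  left_vcomp _ _ := ulift_eq _ _
  right_vcomp _ _ := ulift_eq _ _
  unit a := LooseArr.unit a
  unitSq f := LooseSq.ofEq _ _ f.down.down f.down.down
  left_unitSq _ := ulift_eq _ _
  right_unitSq _ := ulift_eq _ _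
  unitSq_id _ := Subsingleton.elim _ _
  unitSq_comp _ _ := Subsingleton.elim _ _
  comp := LooseArr.comp
  hcomp s t _ := LooseSq.ofEq _ _ s.down.down.1 t.down.down.2.1
  left_hcomp _ _ _ := ulift_eq _ _
  right_hcomp _ _ _ := ulift_eq _ _
  hcomp_vid _ _ := Subsingleton.elim _ _
  hcomp_vcomp _ _ _ _ _ _ := Subsingleton.elim _ _
  assoc _ _ _ := LooseSq.ofEq _ _ rfl rfl
  left_assoc _ _ _ := ulift_eq _ _
  right_assoc _ _ _ := ulift_eq _ _
  assoc_inv _ _ _ := ⟨LooseSq.ofEq _ _ rfl rfl, Subsingleton.elim _ _, Subsingleton.elim _ _⟩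
  assoc_naturality _ _ _ _ _ := Subsingleton.elim _ _
  lunit _ := LooseSq.ofEq _ _ rfl rfl
  left_lunit _ := ulift_eq _ _
  right_lunit _ := ulift_eq _ _
  lunit_inv _ := ⟨LooseSq.ofEq _ _ rfl rfl, Subsingleton.elim _ _, Subsingleton.elim _ _⟩
  lunit_naturality _ := Subsingleton.elim _ _
  runit _ := LooseSq.ofEq _ _ rfl rfl
  left_runit _ := ulift_eq _ _
  right_runit _ := ulift_eq _ _
  runit_inv _ := ⟨LooseSq.ofEq _ _ rfl rfl, Subsingleton.elim _ _, Subsingleton.elim _ _⟩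
  runit_naturality _ := Subsingleton.elim _ _
  pentagon _ _ _ _ := Subsingleton.elim _ _
  triangle _ _ := Subsingleton.elim _ _

namespace WalkingLoose

variable {D : DblCat.{v, u}}

theorem tight_eq {a b : WalkingLoose.{v, u}.Obj} (f g : a ⟶ b) : f = g :=
  ulift_eq f g

theorem loose_eq {a b : WalkingLoose.{v, u}.Obj} (m n : WalkingLoose.{v, u}.Loose a b) :
    m = n :=
  LooseArr.eq (a := a) (b := b) m n

theorem sq_eq {a b c d : WalkingLoose.{v, u}.Obj} {m : WalkingLoose.{v, u}.Loose a b}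
    {n : WalkingLoose.{v, u}.Loose c d} (s t : WalkingLoose.{v, u}.Sq m n) : s = t :=
  ulift_eq s t

/-- A double functor to the walking loose arrow is determined by its action on objects. -/
theorem functor_ext {F G : D ⟶ WalkingLoose.{v, u}}
    (h : ∀ a, DblFunctor.obj F a = DblFunctor.obj G a) : F = G := by
  have hs : ∀ {a a' b b' c c' d d' : WalkingLoose.{v, u}.Obj} (_ : a = a') (_ : b = b')
      (_ : c = c') (_ : d = d') (m : WalkingLoose.{v, u}.Loose a b)
      (m' : WalkingLoose.{v, u}.Loose a' b') (n : WalkingLoose.{v, u}.Loose c d)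
      (n' : WalkingLoose.{v, u}.Loose c' d') (s : WalkingLoose.{v, u}.Sq m n)
      (s' : WalkingLoose.{v, u}.Sq m' n'), HEq s s' := by
    intro a a' b b' c c' d d' h1 h2 h3 h4 m m' n n' s s'
    subst h1 h2 h3 h4
    obtain rfl := loose_eq m m'
    obtain rfl := loose_eq n n'
    exact heq_of_eq (sq_eq _ _)
  refine DblFunctor.ext_data h (fun f => ?_) (fun m => ?_)
    (fun s => hs (h _) (h _) (h _) (h _) _ _ _ _ _ _)
    (fun m n => hs (h _) (h _) (h _) (h _) _ _ _ _ _ _)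
    (fun a => hs (h _) (h _) (h _) (h _) _ _ _ _ _ _)
  · have ht : ∀ {a a' b b' : WalkingLoose.{v, u}.Obj} (_ : a = a') (_ : b = b')
        (f : a ⟶ b) (f' : a' ⟶ b'), HEq f f' := by
      intro a a' b b' h1 h2 f f'
      subst h1 h2
      exact heq_of_eq (tight_eq _ _)
    exact ht (h _) (h _) _ _
  · have hl : ∀ {a a' b b' : WalkingLoose.{v, u}.Obj} (_ : a = a') (_ : b = b')
        (m : WalkingLoose.{v, u}.Loose a b) (m' : WalkingLoose.{v, u}.Loose a' b'), HEq m m' := by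
      intro a a' b b' h1 h2 m m'
      subst h1 h2
      exact heq_of_eq (loose_eq _ _)
    exact hl (h _) (h _) _ _

/-- Parallel transformations between double functors to the walking loose arrow are equal. -/
theorem trans_ext {F G : D ⟶ WalkingLoose.{v, u}} (α β : F ⟶ G) : α = β :=
  DblCat.hom_ext₂ (fun _ => tight_eq _ _) (fun _ => sq_eq _ _)

/-- A double functor to the walking loose arrow, from its action on objects and the fact that
arrows go the right way. -/
def lift (D : DblCat.{v, u}) (obj : D.Obj → LooseObj.{u})
    (map : ∀ {a b : D.Obj}, (a ⟶ b) → obj a = obj b)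
    (loose : ∀ {a b : D.Obj}, D.Loose a b → LooseArr (obj a) (obj b)) :
    D ⟶ WalkingLoose.{v, u} :=
  DblFunctor.mk (D := D) (E := WalkingLoose.{v, u}) obj
    (fun f => ⟨⟨map f⟩⟩)
    (fun _ => tight_eq _ _)
    (fun _ _ => tight_eq _ _)
    loose
    (fun s => LooseSq.ofEq _ _ (map (D.left s)) (map (D.right s)))
    (fun _ => tight_eq _ _)
    (fun _ => tight_eq _ _)
    (fun _ => sq_eq _ _)
    (fun _ _ => sq_eq _ _)
    (fun _ _ => LooseSq.ofEq _ _ rfl rfl)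
    (fun _ _ => tight_eq _ _)
    (fun _ _ => tight_eq _ _)
    (fun _ _ => ⟨LooseSq.ofEq _ _ rfl rfl, sq_eq _ _, sq_eq _ _⟩)
    (fun _ _ _ => sq_eq _ _)
    (fun _ => LooseSq.ofEq _ _ rfl rfl)
    (fun _ => tight_eq _ _)
    (fun _ => tight_eq _ _)
    (fun _ => ⟨LooseSq.ofEq _ _ rfl rfl, sq_eq _ _, sq_eq _ _⟩)
    (fun _ => sq_eq _ _)
    (fun _ _ _ => sq_eq _ _)
    (fun _ => sq_eq _ _)
    (fun _ => sq_eq _ _)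

end WalkingLoose

/-! ### Loose bimodules and loose right modules -/

/-- The 2-category of loose bimodules: the strict slice of the 2-category of double categories
over the walking loose arrow. -/
abbrev LBimod : Type (max (u + 1) (v + 1)) := Slice (WalkingLoose.{v, u})

namespace LBimod

/-- The label of an object of the collage. -/
def label (M : LBimod.{v, u}) (x : M.dom.Obj) : LooseObj.{u} := DblFunctor.obj M.hom x

/-- The pullback of a loose bimodule along an object `i` of the walking loose arrow. As the only
tight arrow, loose arrow and square over `i` are identities, all arrows and squares of the collage
between objects labelled `i` belong to it. -/
def fiber (M : LBimod.{v, u}) (i : LooseObj.{u}) : DblCat.{v, u} where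
  Obj := {x : M.dom.Obj // M.label x = i}
  tight :=
    { Hom := fun a b => a.1 ⟶ b.1
      id := fun a => 𝟙 a.1
      comp := fun f g => M.dom.tight.comp f g
      id_comp := fun f => M.dom.tight.id_comp f
      comp_id := fun f => M.dom.tight.comp_id f
      assoc := fun f g h => M.dom.tight.assoc f g h }
  Loose a b := M.dom.Loose a.1 b.1
  Sq m n := M.dom.Sq m n
  left s := M.dom.left s
  right s := M.dom.right s
  vid m := M.dom.vid m
  vcomp s t := M.dom.vcomp s t
  vid_vcomp s := M.dom.vid_vcomp s
  vcomp_vid s := M.dom.vcomp_vid s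
  vassoc s t w := M.dom.vassoc s t w
  left_vid m := M.dom.left_vid m
  right_vid m := M.dom.right_vid m
  left_vcomp s t := M.dom.left_vcomp s t
  right_vcomp s t := M.dom.right_vcomp s t
  unit a := M.dom.unit a.1
  unitSq f := M.dom.unitSq f
  left_unitSq f := M.dom.left_unitSq f
  right_unitSq f := M.dom.right_unitSq f
  unitSq_id a := M.dom.unitSq_id a.1
  unitSq_comp f g := M.dom.unitSq_comp f g
  comp m n := M.dom.comp m n
  hcomp s t h := M.dom.hcomp s t h
  left_hcomp s t h := M.dom.left_hcomp s t h
  right_hcomp s t h := M.dom.right_hcomp s t h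
  hcomp_vid m n := M.dom.hcomp_vid m n
  hcomp_vcomp s t h s' t' h' := M.dom.hcomp_vcomp s t h s' t' h'
  assoc m n p := M.dom.assoc m n p
  left_assoc m n p := M.dom.left_assoc m n p
  right_assoc m n p := M.dom.right_assoc m n p
  assoc_inv m n p := M.dom.assoc_inv m n p
  assoc_naturality s t w h h' := M.dom.assoc_naturality s t w h h'
  lunit m := M.dom.lunit m
  left_lunit m := M.dom.left_lunit m
  right_lunit m := M.dom.right_lunit m
  lunit_inv m := M.dom.lunit_inv m
  lunit_naturality s := M.dom.lunit_naturality s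
  runit m := M.dom.runit m
  left_runit m := M.dom.left_runit m
  right_runit m := M.dom.right_runit m
  runit_inv m := M.dom.runit_inv m
  runit_naturality s := M.dom.runit_naturality s
  pentagon m n p q := M.dom.pentagon m n p q
  triangle m n := M.dom.triangle m n

/-- The source of a loose bimodule. -/
abbrev source (M : LBimod.{v, u}) : DblCat.{v, u} := M.fiber LooseObj.zero

/-- The target of a loose bimodule. -/
abbrev target (M : LBimod.{v, u}) : DblCat.{v, u} := M.fiber LooseObj.one

/-- Morphisms of loose bimodules preserve labels. -/
theorem label_map {M N : LBimod.{v, u}} (F : M ⟶ N) (x : M.dom.Obj) :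
    N.label (DblFunctor.obj (Slice.Hom.arr F) x) = M.label x :=
  congrArg (fun K : M.dom ⟶ WalkingLoose => DblFunctor.obj K x) (Slice.Hom.w F)

end LBimod

/-- The terminal double categories: those with exactly one object, one tight arrow, one loose
arrow and one square. -/
structure DblCat.IsTerminal (D : DblCat.{v, u}) : Prop where
  obj : Nonempty (Unique D.Obj)
  tight : ∀ a b : D.Obj, Nonempty (Unique (a ⟶ b))
  loose : ∀ a b : D.Obj, Nonempty (Unique (D.Loose a b))
  sq : ∀ {a b c d : D.Obj} (m : D.Loose a b) (n : D.Loose c d), Nonempty (Unique (D.Sq m n))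

/-- The 2-category of loose right modules: loose bimodules whose source is terminal, with all
arrows and 2-cells of loose bimodules between them. -/
abbrev LModR : Type (max (u + 1) (v + 1)) :=
  InducedBicategory LBimod.{v, u}
    (fun M : {M : LBimod.{v, u} // M.source.IsTerminal} => M.1)

/-! ### Collapse -/

namespace Collapse

variable (M : LBimod.{v, u})

/-- The objects of the collapse: a single object labelled `0` and the objects of the target. -/
inductive Obj : Type u
  | pt
  | of (d : M.target.Obj)

variable {M}

/-- The tight arrows of the collapse: the identity of the point and those of the target. -/
def Tight : Obj M → Obj M → Type v
  | .pt, .pt => PUnit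
  | .of d, .of d' => d.1 ⟶ d'.1
  | .pt, .of _ => PEmpty
  | .of _, .pt => PEmpty

/-- Identity tight arrows. -/
def tightId : ∀ a : Obj M, Tight a a
  | .pt => PUnit.unit
  | .of d => 𝟙 d.1

/-- Composition of tight arrows. -/
def tightComp : ∀ {a b c : Obj M}, Tight a b → Tight b c → Tight a c
  | .pt, .pt, _, _, g => g
  | .of _, .of _, .of _, f, g => CategoryStruct.comp (obj := M.dom.Obj) f g
  | .pt, .of _, _, f, _ => PEmpty.elim f
  | .of _, .pt, _, f, _ => PEmpty.elim f
  | .of _, .of _, .pt, _, g => PEmpty.elim g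

/-- The tight category of the collapse. -/
@[reducible]
def tightCategory : Category.{v} (Obj M) where
  Hom := Tight
  id := tightId
  comp := tightComp
  id_comp {a b} f := by
    cases a <;> cases b <;> first | exact PEmpty.elim f | rfl | exact Category.id_comp (obj := M.dom.Obj) f
  comp_id {a b} f := by
    cases a <;> cases b <;> first | exact PEmpty.elim f | rfl | exact Category.comp_id (obj := M.dom.Obj) f
  assoc {a b c d} f g h := by
    cases a <;> cases b <;> first
      | exact PEmpty.elim f
      | rfl
      | (cases c <;> cases d <;> first
          | exact PEmpty.elim g
          | exact PEmpty.elim h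
          | exact Category.assoc (obj := M.dom.Obj) f g h)

/-- The loose arrows of the collapse: the identity of the point, the heteromorphisms of `M` with
their sources forgotten, and the loose arrows of the target. -/
inductive Loose : Obj M → Obj M → Type u
  | pt : Loose .pt .pt
  | het {d₀ : M.source.Obj} {d₁ : M.target.Obj} (m : M.dom.Loose d₀.1 d₁.1) : Loose .pt (.of d₁)
  | of {d d' : M.target.Obj} (m : M.dom.Loose d.1 d'.1) : Loose (.of d) (.of d')

/-- The squares of the collapse: the identity square of the point, all squares of `M` between
heteromorphisms, and the squares of the target. -/
def Sq : ∀ {a b c d : Obj M}, Loose a b → Loose c d → Type v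
  | _, _, _, _, .pt, .pt => PUnit
  | _, _, _, _, .het m, .het m' => M.dom.Sq m m'
  | _, _, _, _, .of m, .of m' => M.dom.Sq m m'
  | _, _, _, _, .pt, .het _ => PEmpty
  | _, _, _, _, .pt, .of _ => PEmpty
  | _, _, _, _, .het _, .pt => PEmpty
  | _, _, _, _, .het _, .of _ => PEmpty
  | _, _, _, _, .of _, .pt => PEmpty
  | _, _, _, _, .of _, .het _ => PEmpty

/-- Left sides. -/
def left : ∀ {a b c d : Obj M} {m : Loose a b} {n : Loose c d}, Sq m n → Tight a c
  | _, _, _, _, .pt, .pt, _ => PUnit.unit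
  | _, _, _, _, .het _, .het _, _ => PUnit.unit
  | _, _, _, _, .of _, .of _, s => M.dom.left s
  | _, _, _, _, .pt, .het _, s => PEmpty.elim s
  | _, _, _, _, .pt, .of _, s => PEmpty.elim s
  | _, _, _, _, .het _, .pt, s => PEmpty.elim s
  | _, _, _, _, .het _, .of _, s => PEmpty.elim s
  | _, _, _, _, .of _, .pt, s => PEmpty.elim s
  | _, _, _, _, .of _, .het _, s => PEmpty.elim s

/-- Right sides. -/
def right : ∀ {a b c d : Obj M} {m : Loose a b} {n : Loose c d}, Sq m n → Tight b d
  | _, _, _, _, .pt, .pt, _ => PUnit.unit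
  | _, _, _, _, .het _, .het _, s => M.dom.right s
  | _, _, _, _, .of _, .of _, s => M.dom.right s
  | _, _, _, _, .pt, .het _, s => PEmpty.elim s
  | _, _, _, _, .pt, .of _, s => PEmpty.elim s
  | _, _, _, _, .het _, .pt, s => PEmpty.elim s
  | _, _, _, _, .het _, .of _, s => PEmpty.elim s
  | _, _, _, _, .of _, .pt, s => PEmpty.elim s
  | _, _, _, _, .of _, .het _, s => PEmpty.elim s

/-- Identity squares. -/
def vid : ∀ {a b : Obj M} (m : Loose a b), Sq m m
  | _, _, .pt => PUnit.unit
  | _, _, .het m => M.dom.vid m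
  | _, _, .of m => M.dom.vid m

/-- Vertical composition of squares. -/
def vcomp : ∀ {a b c d e f : Obj M} {m : Loose a b} {n : Loose c d} {p : Loose e f},
    Sq m n → Sq n p → Sq m p
  | _, _, _, _, _, _, .pt, .pt, _, _, t => t
  | _, _, _, _, _, _, .het _, .het _, .het _, s, t => M.dom.vcomp s t
  | _, _, _, _, _, _, .of _, .of _, .of _, s, t => M.dom.vcomp s t
  | _, _, _, _, _, _, .pt, .het _, _, s, _ => PEmpty.elim s
  | _, _, _, _, _, _, .pt, .of _, _, s, _ => PEmpty.elim s
  | _, _, _, _, _, _, .het _, .pt, _, s, _ => PEmpty.elim s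
  | _, _, _, _, _, _, .het _, .of _, _, s, _ => PEmpty.elim s
  | _, _, _, _, _, _, .of _, .pt, _, s, _ => PEmpty.elim s
  | _, _, _, _, _, _, .of _, .het _, _, s, _ => PEmpty.elim s
  | _, _, _, _, _, _, .het _, .het _, .pt, _, t => PEmpty.elim t
  | _, _, _, _, _, _, .het _, .het _, .of _, _, t => PEmpty.elim t
  | _, _, _, _, _, _, .of _, .of _, .pt, _, t => PEmpty.elim t
  | _, _, _, _, _, _, .of _, .of _, .het _, _, t => PEmpty.elim t

/-- Loose identities. -/
def unit : ∀ a : Obj M, Loose a a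
  | .pt => .pt
  | .of d => .of (M.dom.unit d.1)

/-- Loose identity squares. -/
def unitSq : ∀ {a b : Obj M}, Tight a b → Sq (unit a) (unit b)
  | .pt, .pt, _ => PUnit.unit
  | .of _, .of _, f => M.dom.unitSq f
  | .pt, .of _, f => PEmpty.elim f
  | .of _, .pt, f => PEmpty.elim f

/-- Loose composition: heteromorphisms are acted on the right by the loose arrows of the
target, as in `M`. -/
def comp : ∀ {a b c : Obj M}, Loose a b → Loose b c → Loose a c
  | _, _, _, .pt, n => n
  | _, _, _, .het m, .of n => .het (M.dom.comp m n)
  | _, _, _, .of m, .of n => .of (M.dom.comp m n)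

/-- Horizontal composition of squares. -/
def hcomp : ∀ {a b c a' b' c' : Obj M} {m : Loose a b} {n : Loose b c} {m' : Loose a' b'}
    {n' : Loose b' c'} (s : Sq m m') (t : Sq n n'), right s = left t →
      Sq (comp m n) (comp m' n')
  | _, _, _, _, _, _, .pt, _, .pt, _, _, t, _ => t
  | _, _, _, _, _, _, .het _, .of _, .het _, .of _, s, t, h => M.dom.hcomp s t h
  | _, _, _, _, _, _, .of _, .of _, .of _, .of _, s, t, h => M.dom.hcomp s t h
  | _, _, _, _, _, _, .pt, _, .het _, _, s, _, _ => PEmpty.elim s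
  | _, _, _, _, _, _, .pt, _, .of _, _, s, _, _ => PEmpty.elim s
  | _, _, _, _, _, _, .het _, _, .pt, _, s, _, _ => PEmpty.elim s
  | _, _, _, _, _, _, .het _, _, .of _, _, s, _, _ => PEmpty.elim s
  | _, _, _, _, _, _, .of _, _, .pt, _, s, _, _ => PEmpty.elim s
  | _, _, _, _, _, _, .of _, _, .het _, _, s, _, _ => PEmpty.elim s

/-- Associators. -/
def assoc : ∀ {a b c d : Obj M} (m : Loose a b) (n : Loose b c) (p : Loose c d),
    Sq (comp (comp m n) p) (comp m (comp n p))
  | _, _, _, _, .pt, n, p => vid (comp n p)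
  | _, _, _, _, .het m, .of n, .of p => M.dom.assoc m n p
  | _, _, _, _, .of m, .of n, .of p => M.dom.assoc m n p

/-- Left unitors. -/
def lunit : ∀ {a b : Obj M} (m : Loose a b), Sq (comp (unit a) m) m
  | _, _, .pt => PUnit.unit
  | _, _, .het m => M.dom.vid m
  | _, _, .of m => M.dom.lunit m

/-- Right unitors. -/
def runit : ∀ {a b : Obj M} (m : Loose a b), Sq (comp m (unit b)) m
  | _, _, .pt => PUnit.unit
  | _, _, .het m => M.dom.runit m
  | _, _, .of m => M.dom.runit m

variable (M)

/-- The double category underlying the collapse (its collage). -/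
def collage : DblCat.{v, u} where
  Obj := Obj M
  tight := tightCategory
  Loose := Loose
  Sq m n := Sq m n
  left s := left s
  right s := right s
  vid := vid
  vcomp s t := vcomp s t
  vid_vcomp {a b c d m n} s := by
    cases m <;> cases n <;> first | exact PEmpty.elim s | rfl | exact M.dom.vid_vcomp s
  vcomp_vid {a b c d m n} s := by
    cases m <;> cases n <;> first | exact PEmpty.elim s | rfl | exact M.dom.vcomp_vid s
  vassoc {_ _ _ _ _ _ _ _ m n p q} s t w := by
    cases m <;> cases n <;> first
      | exact PEmpty.elim s
      | rfl
      | (cases p <;> cases q <;> first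
          | exact PEmpty.elim t
          | exact PEmpty.elim w
          | exact M.dom.vassoc s t w)
  left_vid m := by cases m <;> first | rfl | exact M.dom.left_vid _
  right_vid m := by cases m <;> first | rfl | exact M.dom.right_vid _
  left_vcomp {_ _ _ _ _ _ m n p} s t := by
    cases m <;> cases n <;> first
      | exact PEmpty.elim s
      | rfl
      | (cases p <;> first | exact PEmpty.elim t | rfl | exact M.dom.left_vcomp s t)
  right_vcomp {_ _ _ _ _ _ m n p} s t := by
    cases m <;> cases n <;> first
      | exact PEmpty.elim s
      | rfl
      | (cases p <;> first | exact PEmpty.elim t | rfl | exact M.dom.right_vcomp s t)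
  unit := unit
  unitSq f := unitSq f
  left_unitSq {a b} f := by
    cases a <;> cases b <;> first | exact PEmpty.elim f | rfl | exact M.dom.left_unitSq _
  right_unitSq {a b} f := by
    cases a <;> cases b <;> first | exact PEmpty.elim f | rfl | exact M.dom.right_unitSq _
  unitSq_id a := by cases a <;> first | rfl | exact M.dom.unitSq_id _
  unitSq_comp {a b c} f g := by
    cases a <;> cases b <;> first
      | exact PEmpty.elim f
      | (cases c <;> first | exact PEmpty.elim g | rfl | exact M.dom.unitSq_comp _ _)
  comp := comp
  hcomp s t h := hcomp s t h
  left_hcomp {_ _ _ _ _ _ m n m' n'} s t h := by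
    cases m <;> cases m' <;> first
      | exact PEmpty.elim s
      | rfl
      | (cases n; cases n'; first | rfl | exact M.dom.left_hcomp s t h)
  right_hcomp {_ _ _ _ _ _ m n m' n'} s t h := by
    cases m <;> cases m' <;> first
      | exact PEmpty.elim s
      | rfl
      | (cases n; cases n'; exact M.dom.right_hcomp s t h)
  hcomp_vid m n := by cases m <;> first | rfl | (cases n; exact M.dom.hcomp_vid _ _)
  hcomp_vcomp {_ _ _ _ _ _ _ _ _ m n m' n' m'' n''} s t h s' t' h' := by
    cases m <;> cases m' <;> first
      | exact PEmpty.elim s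
      | (cases m'' <;> first
          | exact PEmpty.elim s'
          | rfl
          | (cases n; cases n'; cases n''; exact M.dom.hcomp_vcomp s t h s' t' h'))
  assoc := assoc
  left_assoc m n p := by
    cases m <;> cases n <;> cases p <;> first
      | rfl
      | exact M.dom.left_assoc _ _ _
  right_assoc m n p := by
    cases m <;> cases n <;> cases p <;> first
      | rfl
      | exact M.dom.right_assoc _ _ _
      | exact M.dom.right_vid _
  assoc_inv m n p := by
    cases m <;> cases n <;> cases p <;> first
      | exact ⟨PUnit.unit, rfl, rfl⟩
      | exact M.dom.assoc_inv _ _ _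
      | exact ⟨M.dom.vid _, M.dom.vid_vcomp _, M.dom.vid_vcomp _⟩
  assoc_naturality {_ _ _ _ _ _ _ _ m n p m' n' p'} s t w h h' := by
    cases m <;> cases m' <;> first
      | exact PEmpty.elim s
      | (cases n; cases p; cases n'; cases p'; exact M.dom.assoc_naturality s t w h h')
      | skip
    cases n <;> cases n' <;> first
      | exact PEmpty.elim t
      | (cases p; cases p'; exact (M.dom.vcomp_vid _).trans (M.dom.vid_vcomp _).symm)
      | skip
    cases p <;> cases p' <;> first
      | exact PEmpty.elim w
      | rfl
      | exact (M.dom.vcomp_vid _).trans (M.dom.vid_vcomp _).symm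
  lunit := lunit
  left_lunit m := by cases m <;> first | rfl | exact M.dom.left_lunit _
  right_lunit m := by
    cases m <;> first | rfl | exact M.dom.right_lunit _ | exact M.dom.right_vid _
  lunit_inv m := by
    cases m <;> first
      | exact ⟨PUnit.unit, rfl, rfl⟩
      | exact M.dom.lunit_inv _
      | exact ⟨M.dom.vid _, M.dom.vid_vcomp _, M.dom.vid_vcomp _⟩
  lunit_naturality {_ _ _ _ m n} s := by
    cases m <;> cases n <;> first
      | exact PEmpty.elim s
      | rfl
      | exact M.dom.lunit_naturality s
      | exact (M.dom.vcomp_vid _).trans (M.dom.vid_vcomp _).symm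
  runit := runit
  left_runit m := by cases m <;> first | rfl | exact M.dom.left_runit _
  right_runit m := by cases m <;> first | rfl | exact M.dom.right_runit _
  runit_inv m := by
    cases m <;> first | exact ⟨PUnit.unit, rfl, rfl⟩ | exact M.dom.runit_inv _
  runit_naturality {_ _ _ _ m n} s := by
    cases m <;> cases n <;> first | exact PEmpty.elim s | rfl | exact M.dom.runit_naturality s
  pentagon m n p q := by
    cases m <;> cases n <;> cases p <;> cases q <;> first
      | rfl
      | exact M.dom.pentagon _ _ _ _
      | exact M.dom.vid_vcomp _
      | exact (congrArg (fun z => M.dom.vcomp z _) (M.dom.hcomp_vid _ _)).trans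
          (M.dom.vid_vcomp _)
      | exact (congrArg (fun z => M.dom.vcomp z _) (M.dom.hcomp_vid _ _)).trans
          ((M.dom.vid_vcomp _).trans ((M.dom.vid_vcomp _).trans (M.dom.vcomp_vid _).symm))
  triangle m n := by
    cases m <;> cases n <;> first
      | rfl
      | exact M.dom.triangle _ _
      | exact M.dom.vid_vcomp _

/-- The collapse of a loose bimodule, as a loose bimodule. -/
def bimod : LBimod.{v, u} where
  dom := collage M
  hom := WalkingLoose.lift (collage M)
    (fun | .pt => LooseObj.zero | .of _ => LooseObj.one)
    (fun {a b} f => by cases a <;> cases b <;> first | exact PEmpty.elim f | rfl)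
    (fun {_ _} m => match m with
      | .pt => LooseArr.unit _
      | .het _ => LooseArr.two
      | .of _ => LooseArr.unit _)

/-- The source of the collapse is terminal. -/
theorem source_isTerminal : (bimod M).source.IsTerminal := by
  have h : ∀ a : (bimod M).source.Obj, a = ⟨Obj.pt, rfl⟩ := by
    rintro ⟨a | a, ha⟩
    · rfl
    · cases ha
  refine ⟨⟨⟨⟨⟨Obj.pt, rfl⟩⟩, h⟩⟩, fun a b => ?_, fun a b => ?_, fun {a b c d} m n => ?_⟩
  · obtain rfl := h a
    obtain rfl := h b
    exact ⟨⟨⟨PUnit.unit⟩, fun _ => rfl⟩⟩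
  · obtain rfl := h a
    obtain rfl := h b
    exact ⟨⟨⟨Loose.pt⟩, fun m => by
      change Loose Obj.pt Obj.pt at m
      cases m; rfl⟩⟩
  · obtain rfl := h a
    obtain rfl := h b
    obtain rfl := h c
    obtain rfl := h d
    change Loose Obj.pt Obj.pt at m n
    cases m
    cases n
    exact ⟨⟨⟨PUnit.unit⟩, fun _ => rfl⟩⟩

/-- The collapse of a loose bimodule, as a loose right module. -/
def obj : LModR.{v, u} := ⟨bimod M, source_isTerminal M⟩

variable {M} {N : LBimod.{v, u}}

/-- The restriction of a morphism of loose bimodules to the objects with label `i`. -/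
def fiberObj (F : M ⟶ N) {i : LooseObj.{u}} (x : (M.fiber i).Obj) : (N.fiber i).Obj :=
  ⟨DblFunctor.obj (Slice.Hom.arr F) x.1, (LBimod.label_map F x.1).trans x.2⟩

/-- The action of the collapse of a morphism on objects. -/
def mapObj (F : M ⟶ N) : Obj M → Obj N
  | .pt => .pt
  | .of d => .of (fiberObj F d)

/-- The action of the collapse of a morphism on tight arrows. -/
def mapTight (F : M ⟶ N) : ∀ {a b : Obj M}, Tight a b → Tight (mapObj F a) (mapObj F b)
  | .pt, .pt, _ => PUnit.unit
  | .of _, .of _, f => DblFunctor.map (Slice.Hom.arr F) f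
  | .pt, .of _, f => PEmpty.elim f
  | .of _, .pt, f => PEmpty.elim f

/-- The action of the collapse of a morphism on loose arrows. -/
def mapLoose (F : M ⟶ N) : ∀ {a b : Obj M}, Loose a b → Loose (mapObj F a) (mapObj F b)
  | _, _, .pt => .pt
  | _, _, .het (d₀ := d₀) (d₁ := d₁) m =>
    .het (d₀ := fiberObj F d₀) (d₁ := fiberObj F d₁) (DblFunctor.loose (Slice.Hom.arr F) m)
  | _, _, .of m => .of (DblFunctor.loose (Slice.Hom.arr F) m)

/-- The action of the collapse of a morphism on squares. -/
def mapSq (F : M ⟶ N) : ∀ {a b c d : Obj M} {m : Loose a b} {n : Loose c d},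
    Sq m n → Sq (mapLoose F m) (mapLoose F n)
  | _, _, _, _, .pt, .pt, _ => PUnit.unit
  | _, _, _, _, .het _, .het _, s => DblFunctor.sq (Slice.Hom.arr F) s
  | _, _, _, _, .of _, .of _, s => DblFunctor.sq (Slice.Hom.arr F) s
  | _, _, _, _, .pt, .het _, s => PEmpty.elim s
  | _, _, _, _, .pt, .of _, s => PEmpty.elim s
  | _, _, _, _, .het _, .pt, s => PEmpty.elim s
  | _, _, _, _, .het _, .of _, s => PEmpty.elim s
  | _, _, _, _, .of _, .pt, s => PEmpty.elim s
  | _, _, _, _, .of _, .het _, s => PEmpty.elim s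

/-- The comparison of composites. -/
def mapμ (F : M ⟶ N) : ∀ {a b c : Obj M} (m : Loose a b) (n : Loose b c),
    Sq (comp (mapLoose F m) (mapLoose F n)) (mapLoose F (comp m n))
  | _, _, _, .pt, n => vid (mapLoose F n)
  | _, _, _, .het m, .of n => DblFunctor.μ (Slice.Hom.arr F) m n
  | _, _, _, .of m, .of n => DblFunctor.μ (Slice.Hom.arr F) m n

/-- The comparison of loose identities. -/
def mapη (F : M ⟶ N) : ∀ a : Obj M, Sq (unit (mapObj F a)) (mapLoose F (unit a))
  | .pt => PUnit.unit
  | .of d => DblFunctor.η (Slice.Hom.arr F) d.1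

/-- The collapse of a morphism of loose bimodules, as a pseudo double functor. -/
def mapFunctor (F : M ⟶ N) : DblFunctor (collage M) (collage N) where
  obj := mapObj F
  map f := mapTight F f
  map_id a := by cases a <;> first | rfl | exact DblFunctor.map_id _ _
  map_comp {a b c} f g := by
    cases a <;> cases b <;> first
      | exact PEmpty.elim f
      | (cases c <;> first | exact PEmpty.elim g | rfl | exact DblFunctor.map_comp _ _ _)
  loose := mapLoose F
  sq s := mapSq F s
  left_sq {_ _ _ _ m n} s := by
    cases m <;> cases n <;> first
      | exact PEmpty.elim s
      | rfl
      | exact DblFunctor.left_sq _ _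
  right_sq {_ _ _ _ m n} s := by
    cases m <;> cases n <;> first
      | exact PEmpty.elim s
      | rfl
      | exact DblFunctor.right_sq _ _
  sq_vid m := by cases m <;> first | rfl | exact DblFunctor.sq_vid _ _
  sq_vcomp {_ _ _ _ _ _ m n p} s t := by
    cases m <;> cases n <;> first
      | exact PEmpty.elim s
      | (cases p <;> first | exact PEmpty.elim t | rfl | exact DblFunctor.sq_vcomp _ _ _)
  μ := mapμ F
  left_μ m n := by
    cases m <;> cases n <;> first | rfl | exact DblFunctor.left_μ _ _ _
  right_μ m n := by
    cases m <;> cases n <;> first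
      | rfl
      | exact DblFunctor.right_μ _ _ _
      | exact N.dom.right_vid _
  μ_inv m n := by
    cases m <;> cases n <;> first
      | exact ⟨PUnit.unit, rfl, rfl⟩
      | exact DblFunctor.μ_inv _ _ _
      | exact ⟨N.dom.vid _, N.dom.vid_vcomp _, N.dom.vid_vcomp _⟩
  μ_naturality {_ _ _ _ _ _ m n m' n'} s t h := by
    cases m <;> cases m' <;> first
      | exact PEmpty.elim s
      | (cases n; cases n'; exact DblFunctor.μ_naturality (Slice.Hom.arr F) s t h)
      | (cases n <;> cases n' <;> first
          | exact PEmpty.elim t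
          | rfl
          | exact (N.dom.vcomp_vid _).trans (N.dom.vid_vcomp _).symm)
  η := mapη F
  left_η a := by cases a <;> first | rfl | exact DblFunctor.left_η _ _
  right_η a := by cases a <;> first | rfl | exact DblFunctor.right_η _ _
  η_inv a := by
    cases a <;> first | exact ⟨PUnit.unit, rfl, rfl⟩ | exact DblFunctor.η_inv _ _
  η_naturality {a b} f := by
    cases a <;> cases b <;> first
      | exact PEmpty.elim f
      | rfl
      | exact DblFunctor.η_naturality (Slice.Hom.arr F) _
  map_assoc m n p := by
    cases m <;> cases n <;> cases p <;> first
      | rfl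
      | exact DblFunctor.map_assoc (Slice.Hom.arr F) _ _ _
      | exact congrArg (fun z => N.dom.vcomp (N.dom.vid _) (N.dom.vcomp (N.dom.vid _) z))
          (DblFunctor.sq_vid (Slice.Hom.arr F) _)
      | exact (congrArg (fun z => N.dom.vcomp z _) (N.dom.hcomp_vid _ _)).trans
          (congrArg (fun z => N.dom.vcomp _ (N.dom.vcomp _ z))
            (DblFunctor.sq_vid (Slice.Hom.arr F) _))
  map_lunit m := by
    cases m <;> first
      | rfl
      | exact DblFunctor.map_lunit (Slice.Hom.arr F) _
      | exact (N.dom.vid_vcomp _).trans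
          ((N.dom.vid_vcomp _).trans (DblFunctor.sq_vid (Slice.Hom.arr F) _))
  map_runit m := by
    cases m <;> first | rfl | exact DblFunctor.map_runit (Slice.Hom.arr F) _

/-- The collapse of a morphism of loose bimodules. -/
def map (F : M ⟶ N) : obj M ⟶ obj N :=
  InducedBicategory.mkHom (Slice.Hom.mk (M := bimod M) (N := bimod N) (mapFunctor F)
    (WalkingLoose.functor_ext (by rintro (_ | _) <;> rfl)))

/-- The collapse of a 2-cell on tight arrows. -/
def cellApp {F G : M ⟶ N} (α : F ⟶ G) : ∀ a : Obj M, Tight (mapObj F a) (mapObj G a)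
  | .pt => PUnit.unit
  | .of d => TightTrans.app (Slice.Hom₂.cell α) d.1

/-- The collapse of a 2-cell on squares. -/
def cellSq {F G : M ⟶ N} (α : F ⟶ G) : ∀ {a b : Obj M} (m : Loose a b),
    Sq (mapLoose F m) (mapLoose G m)
  | _, _, .pt => PUnit.unit
  | _, _, .het m => TightTrans.sq (Slice.Hom₂.cell α) m
  | _, _, .of m => TightTrans.sq (Slice.Hom₂.cell α) m

/-- The collapse of a 2-cell of loose bimodules, as a tight transformation. -/
def cell {F G : M ⟶ N} (α : F ⟶ G) : TightTrans (mapFunctor F) (mapFunctor G) where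
  app := cellApp α
  sq := cellSq α
  left_sq m := by cases m <;> first | rfl | exact TightTrans.left_sq _ _
  right_sq m := by cases m <;> first | rfl | exact TightTrans.right_sq _ _
  naturality {a b} f := by
    cases a <;> cases b <;> first
      | exact PEmpty.elim f
      | rfl
      | exact TightTrans.naturality (Slice.Hom₂.cell α) f
  sq_naturality {_ _ _ _ m n} s := by
    cases m <;> cases n <;> first
      | exact PEmpty.elim s
      | rfl
      | exact TightTrans.sq_naturality (Slice.Hom₂.cell α) s
  sq_comp m n := by
    cases m <;> cases n <;> first
      | rfl
      | exact TightTrans.sq_comp (Slice.Hom₂.cell α) _ _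
      | exact (N.dom.vid_vcomp _).trans (N.dom.vcomp_vid _).symm
  sq_unit a := by
    cases a <;> first | rfl | exact TightTrans.sq_unit (Slice.Hom₂.cell α) _

/-- The collapse of a 2-cell of loose bimodules. -/
def map₂ {F G : M ⟶ N} (α : F ⟶ G) : map F ⟶ map G :=
  InducedBicategory.Hom₂.mk (Slice.Hom₂.mk
    (F := InducedBicategory.Hom.hom (map F)) (G := InducedBicategory.Hom.hom (map G)) (cell α)
    (WalkingLoose.trans_ext _ _))

end Collapse

/-- The data of collapse: its action on loose bimodules, their morphisms and their 2-cells. -/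
def collapse : PrelaxFunctorStruct LBimod.{v, u} LModR.{v, u} where
  obj := Collapse.obj
  map := Collapse.map
  map₂ := Collapse.map₂

/-! ### The carrier -/

/-- The carrier of a loose bimodule: its objects are the heteromorphisms. -/
structure Carrier (M : LBimod.{v, u}) : Type u where
  dom : M.source.Obj
  cod : M.target.Obj
  arr : M.dom.Loose dom.1 cod.1

/-- The morphisms of the carrier are the squares between heteromorphisms. -/
instance (M : LBimod.{v, u}) : Category.{v} (Carrier M) where
  Hom m n := M.dom.Sq m.arr n.arr
  id m := M.dom.vid m.arr
  comp s t := M.dom.vcomp s t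
  id_comp s := M.dom.vid_vcomp s
  comp_id s := M.dom.vcomp_vid s
  assoc s t w := M.dom.vassoc s t w

/-- The projection of the carrier to the tight category of the target. -/
def Carrier.codomain (M : LBimod.{v, u}) : Carrier M ⥤ M.target.Obj where
  obj m := m.cod
  map s := M.dom.right s
  map_id m := M.dom.right_vid m.arr
  map_comp s t := M.dom.right_vcomp s t

/-- The functor between tight categories underlying a pseudo double functor. -/
def DblFunctor.tight {D E : DblCat.{v, u}} (F : D ⟶ E) : D.Obj ⥤ E.Obj where
  obj := DblFunctor.obj F
  map f := DblFunctor.map F f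
  map_id := DblFunctor.map_id F
  map_comp := DblFunctor.map_comp F

/-! ### Cartesian 2-categories and cartesian 2-functors -/

section Cartesian

universe w₁ w₂ v₁ v₂ u₁ u₂

variable {B : Type u₁} [Bicategory.{w₁, v₁} B] {C : Type u₂} [Bicategory.{w₂, v₂} C]

/-- 2-categorical terminal objects: every hom-category into `T` is isomorphic to the terminal
category. -/
structure IsTerminal₂ (T : B) : Prop where
  hom : ∀ Z : B, Nonempty (Unique (Z ⟶ T))
  cell : ∀ {Z : B} (f g : Z ⟶ T), Nonempty (Unique (f ⟶ g))

/-- 2-categorical binary products: composition with the projections is, for every `Z`, an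
isomorphism from the hom-category `(Z ⟶ P)` to the product `(Z ⟶ X) × (Z ⟶ Y)`. -/
structure IsBinaryProduct₂ {P X Y : B} (p : P ⟶ X) (q : P ⟶ Y) : Prop where
  hom : ∀ Z : B, Function.Bijective
    (fun h : Z ⟶ P => ((h ≫ p, h ≫ q) : (Z ⟶ X) × (Z ⟶ Y)))
  cell : ∀ {Z : B} (h k : Z ⟶ P), Function.Bijective
    (fun θ : h ⟶ k => ((θ ▷ p, θ ▷ q) : (h ≫ p ⟶ k ≫ p) × (h ≫ q ⟶ k ≫ q)))

variable (B) in
/-- A cartesian 2-category: it has a terminal object and binary products, in the 2-categorical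
sense. -/
structure IsCartesian₂ : Prop where
  terminal : ∃ T : B, IsTerminal₂ T
  product : ∀ X Y : B, ∃ (P : B) (p : P ⟶ X) (q : P ⟶ Y), IsBinaryProduct₂ p q

/-- A cartesian 2-functor: it preserves terminal objects and binary products. -/
structure PreservesFiniteProducts₂ (c : StrictPseudofunctor B C) : Prop where
  terminal : ∀ {T : B}, IsTerminal₂ T → IsTerminal₂ (c.obj T)
  product : ∀ {P X Y : B} {p : P ⟶ X} {q : P ⟶ Y},
    IsBinaryProduct₂ p q → IsBinaryProduct₂ (c.map p) (c.map q)

end Cartesian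

end LooseBimodule

open CategoryTheory LooseBimodule

namespace LooseBimodule

/-! ### Strict isomorphisms, terminal objects and products -/

section Invariance

universe w₁ w₂ v₁ v₂ u₁ u₂

variable {B : Type u₁} [Bicategory.{w₁, v₁} B] [Bicategory.Strict B]

/-! Everything rests on how little the walking loose arrow contains. Two double functors into it
agree as soon as they agree on objects, and parallel transformations into it are equal. Hence a
1-cell of loose bimodules is just a double functor preserving the labels 0 and 1, and every tight
transformation between two of them is a 2-cell (`homMk`, `cellMk`). The product of two loose
bimodules is therefore the fibre product of their collages: pairs of objects with equal labels,
arbitrary pairs of arrows and squares between them, all operations componentwise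
(`isBinaryProduct₂_prod`). The terminal object is the walking loose arrow over itself. Both
constructions stay among the bimodules with terminal source, and a full sub-2-category reflects
terminal objects and products, so right modules are cartesian as well.

Collapse is strictly functorial because on the target and on heteromorphisms it repeats the given
data, and at the point nothing can vary. The coherence cells of the 2-categories involved are
`eqToHom`s, so compatibility with whiskering is a comparison of components (`LModR.conj_eq`).

For the preservation of finite products, limits in this strict sense are unique up to a strictly
invertible 1-cell, strict 2-functors preserve such 1-cells, and precomposition with one preserves
limit cones. So one terminal object and one product of each pair suffice
(`PreservesFiniteProducts₂.of_exists`). The collapse of the walking loose arrow is another copy of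
it: it still has the property `IsWalking`, from which terminality follows.

For products, a heteromorphism of the collapse of `prod M N` is a pair of heteromorphisms of `M` and
`N` with the pair of their sources forgotten. Those sources only need the common label 0, so the
pair is arbitrary: it is the same thing as a pair of heteromorphisms of the two collapses. The
canonical comparison is thus invertible, and `unprodFunctor` is its inverse. The work lies in the
fact that two loose arrows of the collapses are related only through the labels of their ends;
`ProdLoose` turns this into agreement of constructors, after which each law is a law of `prod M N`
or holds trivially at the point.

Finally, the objects of the collapse with label 1 are those of the target, and its loose arrows from
label 0 to label 1 are the heteromorphisms, so the isomorphisms of targets and of carriers do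
nothing to the underlying data. -/

theorem whiskerRight_comp_eq {X Y Z W : B} {f g : Z ⟶ X} (θ : f ⟶ g) (e : X ⟶ Y) (p : Y ⟶ W) :
    θ ▷ (e ≫ p) = eqToHom (Bicategory.Strict.assoc _ _ _).symm ≫ θ ▷ e ▷ p ≫
      eqToHom (Bicategory.Strict.assoc _ _ _) := by
  rw [whiskerRight_comp, Bicategory.Strict.associator_eqToIso,
    Bicategory.Strict.associator_eqToIso]
  rfl

/-- Strict associativity and unitality are propositional equalities of 1-cells, so 2-cells must be
transported along them; this says that such a transport never loses information. -/
theorem bijective_eqToHom_conj {X Y : B} {f f' g g' : X ⟶ Y} (h : f' = f) (h' : g = g') :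
    Function.Bijective (fun θ : f ⟶ g => eqToHom h ≫ θ ≫ eqToHom h') := by
  subst h h'
  simpa using! Function.bijective_id

/-- Whiskering twice is, up to associators, whiskering with `e ≫ e' = 𝟙 X`, and that is conjugation
by unitors. In a strict bicategory all of these are `eqToHom`s. Only one of the two inverse laws
enters, so the statement applies to both composites of a strictly invertible 1-cell. -/
theorem bijective_whiskerRight_whiskerRight {X Y Z : B} {e : X ⟶ Y} {e' : Y ⟶ X}
    (h : e ≫ e' = 𝟙 X) (f g : Z ⟶ X) :
    Function.Bijective (fun θ : f ⟶ g => θ ▷ e ▷ e') := by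
  have hf : (f ≫ e) ≫ e' = f := by rw [Bicategory.Strict.assoc, h, Bicategory.Strict.comp_id]
  have hg : (g ≫ e) ≫ e' = g := by rw [Bicategory.Strict.assoc, h, Bicategory.Strict.comp_id]
  convert bijective_eqToHom_conj hf hg.symm using 2 with θ
  have h1 := whiskerRight_comp_eq θ e e'
  have h2 := whiskerRight_id θ
  rw [Bicategory.Strict.rightUnitor_eqToIso, Bicategory.Strict.rightUnitor_eqToIso] at h2
  rw [whiskerRight_congr h, h2] at h1
  -- `h1` expresses whiskering with the composite through `θ ▷ e ▷ e'`; cancelling the two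
  -- associators solves it for the latter.
  have h3 := congrArg (fun x => eqToHom (Bicategory.Strict.assoc f e e') ≫ x ≫
    eqToHom (Bicategory.Strict.assoc g e e').symm) h1
  simpa using h3.symm

/-- Whiskering with a strictly invertible 1-cell is bijective on 2-cells. -/
theorem bijective_whiskerRight {X Y Z : B} {e : X ⟶ Y} {e' : Y ⟶ X}
    (h : e ≫ e' = 𝟙 X) (h' : e' ≫ e = 𝟙 Y) (f g : Z ⟶ X) :
    Function.Bijective (fun θ : f ⟶ g => θ ▷ e) := by
  refine ⟨fun θ θ' w => (bijective_whiskerRight_whiskerRight h f g).1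
    (congrArg (fun γ : f ≫ e ⟶ g ≫ e => γ ▷ e') w), fun γ => ?_⟩
  -- Two-out-of-six: the preimage of `γ ▷ e'` under double whiskering is a preimage of `γ`, because
  -- whiskering with `e'` and then `e` is injective.
  obtain ⟨θ, hθ⟩ := (bijective_whiskerRight_whiskerRight h f g).2 (γ ▷ e')
  exact ⟨θ, (bijective_whiskerRight_whiskerRight h' _ _).1
    (congrArg (fun γ : (f ≫ e) ≫ e' ⟶ (g ≫ e) ≫ e' => γ ▷ e) hθ)⟩

/-- Composition with a strictly invertible 1-cell is bijective on 1-cells. -/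
theorem bijective_comp {X Y : B} {e : X ⟶ Y} {e' : Y ⟶ X}
    (h : e ≫ e' = 𝟙 X) (h' : e' ≫ e = 𝟙 Y) (Z : B) :
    Function.Bijective (fun f : Z ⟶ X => f ≫ e) :=
  Function.bijective_iff_has_inverse.2 ⟨fun f => f ≫ e',
    fun f => by
      change (f ≫ e) ≫ e' = f
      rw [Bicategory.Strict.assoc, h, Bicategory.Strict.comp_id],
    fun f => by
      change (f ≫ e') ≫ e = f
      rw [Bicategory.Strict.assoc, h', Bicategory.Strict.comp_id]⟩

theorem IsTerminal₂.hom_eq {T Z : B} (hT : IsTerminal₂ T) (f g : Z ⟶ T) : f = g :=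
  have ⟨_⟩ := hT.hom Z
  Subsingleton.elim f g

theorem IsTerminal₂.exists_iso {T T' : B} (hT : IsTerminal₂ T) (hT' : IsTerminal₂ T') :
    ∃ (e : T ⟶ T') (e' : T' ⟶ T), e ≫ e' = 𝟙 T ∧ e' ≫ e = 𝟙 T' :=
  have ⟨i⟩ := hT.hom T'
  have ⟨i'⟩ := hT'.hom T
  ⟨i'.default, i.default, hT.hom_eq _ _, hT'.hom_eq _ _⟩

theorem IsTerminal₂.of_iso {T T' : B} (hT' : IsTerminal₂ T') {e : T ⟶ T'} {e' : T' ⟶ T}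
    (h : e ≫ e' = 𝟙 T) (h' : e' ≫ e = 𝟙 T') : IsTerminal₂ T where
  hom Z := by
    obtain ⟨i⟩ := hT'.hom Z
    exact ⟨⟨⟨i.default ≫ e'⟩, fun f => (bijective_comp h h' Z).1 (hT'.hom_eq _ _)⟩⟩
  cell {Z} f g := by
    obtain ⟨i⟩ := hT'.cell (f ≫ e) (g ≫ e)
    obtain ⟨θ, -⟩ := (bijective_whiskerRight h h' f g).2 i.default
    exact ⟨⟨⟨θ⟩, fun θ' => (bijective_whiskerRight h h' f g).1 (Subsingleton.elim _ _)⟩⟩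

/-- The usual uniqueness argument, with equalities of 1-cells throughout: the part of the universal
property about 1-cells alone already gives a strict isomorphism of cones. -/
theorem IsBinaryProduct₂.exists_iso {P P' X Y : B} {p : P ⟶ X} {q : P ⟶ Y} {p' : P' ⟶ X}
    {q' : P' ⟶ Y} (hp : IsBinaryProduct₂ p q) (hp' : IsBinaryProduct₂ p' q') :
    ∃ (e : P ⟶ P') (e' : P' ⟶ P), e ≫ e' = 𝟙 P ∧ e' ≫ e = 𝟙 P' ∧ e ≫ p' = p ∧ e ≫ q' = q := by
  obtain ⟨e, he⟩ := (hp'.hom P).2 (p, q)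
  obtain ⟨e', he'⟩ := (hp.hom P').2 (p', q')
  obtain ⟨h1, h2⟩ := Prod.ext_iff.1 he
  obtain ⟨h3, h4⟩ := Prod.ext_iff.1 he'
  dsimp only at h1 h2 h3 h4
  refine ⟨e, e', (hp.hom P).1 (Prod.ext ?_ ?_), (hp'.hom P').1 (Prod.ext ?_ ?_), h1, h2⟩ <;>
    simp only [Bicategory.Strict.assoc, Bicategory.Strict.id_comp, h1, h2, h3, h4]

theorem IsBinaryProduct₂.of_iso {P P' X Y : B} {p : P ⟶ X} {q : P ⟶ Y} {p' : P' ⟶ X}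
    {q' : P' ⟶ Y} (hp' : IsBinaryProduct₂ p' q') {e : P ⟶ P'} {e' : P' ⟶ P}
    (h : e ≫ e' = 𝟙 P) (h' : e' ≫ e = 𝟙 P') (hp : e ≫ p' = p) (hq : e ≫ q' = q) :
    IsBinaryProduct₂ p q where
  hom Z := by
    subst hp hq
    simpa only [Function.comp_def, Bicategory.Strict.assoc] using
      (hp'.hom Z).comp (bijective_comp h h' Z)
  cell {Z} f g := by
    subst hp hq
    have h1 := (hp'.cell _ _).comp (bijective_whiskerRight h h' f g)
    -- Whiskering with `e` and then with a projection differs from whiskering with their composite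
    -- by conjugation with associators, which is bijective in each component.
    have h2 := (Function.Bijective.prodMap
      (bijective_eqToHom_conj (Bicategory.Strict.assoc f e p').symm
        (Bicategory.Strict.assoc g e p'))
      (bijective_eqToHom_conj (Bicategory.Strict.assoc f e q').symm
        (Bicategory.Strict.assoc g e q'))).comp h1
    simpa only [Function.comp_def, Prod.map, ← whiskerRight_comp_eq] using h2

/-- A strict pseudofunctor preserves finite products as soon as it preserves one terminal object
and one product of each pair of objects. -/
theorem PreservesFiniteProducts₂.of_exists {C : Type u₂} [Bicategory.{w₂, v₂} C]
    [Bicategory.Strict C] (c : StrictPseudofunctor B C)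
    (hT : ∃ T : B, IsTerminal₂ T ∧ IsTerminal₂ (c.obj T))
    (hP : ∀ X Y : B, ∃ (P : B) (p : P ⟶ X) (q : P ⟶ Y),
      IsBinaryProduct₂ p q ∧ IsBinaryProduct₂ (c.map p) (c.map q)) :
    PreservesFiniteProducts₂ c where
  terminal {T} hT' := by
    obtain ⟨T₀, h, h'⟩ := hT
    obtain ⟨e, e', h1, h2⟩ := hT'.exists_iso h
    exact h'.of_iso (e := c.map e) (e' := c.map e') (by rw [← c.map_comp, h1, c.map_id])
      (by rw [← c.map_comp, h2, c.map_id])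
  product {P X Y p q} hp := by
    obtain ⟨P₀, p₀, q₀, h, h'⟩ := hP X Y
    obtain ⟨e, e', h1, h2, h3, h4⟩ := hp.exists_iso h
    exact h'.of_iso (e := c.map e) (e' := c.map e') (by rw [← c.map_comp, h1, c.map_id])
      (by rw [← c.map_comp, h2, c.map_id]) (by rw [← c.map_comp, h3])
      (by rw [← c.map_comp, h4])

end Invariance

/-! ### Terminal objects and products in full sub-2-categories -/

section Induced

universe w₁ v₁ u₁ u₂

variable {B : Type u₁} [Bicategory.{w₁, v₁} B] {C : Type u₂} {F : C → B}

/-- Full sub-2-categories reflect terminal objects. -/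
theorem IsTerminal₂.of_induced {T : InducedBicategory B F} (h : IsTerminal₂ (F T)) :
    IsTerminal₂ T where
  hom Z := by
    obtain ⟨i⟩ := h.hom (F Z)
    exact ⟨⟨⟨InducedBicategory.mkHom i.default⟩,
      fun f => InducedBicategory.hom_ext (Subsingleton.elim _ _)⟩⟩
  cell {Z} f g := by
    obtain ⟨i⟩ := h.cell f.hom g.hom
    exact ⟨⟨⟨InducedBicategory.Hom₂.mk i.default⟩,
      fun θ => InducedBicategory.hom₂_ext (Subsingleton.elim _ _)⟩⟩

/-- Full sub-2-categories reflect binary products. -/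
theorem IsBinaryProduct₂.of_induced {P X Y : InducedBicategory B F} {p : P ⟶ X} {q : P ⟶ Y}
    (h : IsBinaryProduct₂ p.hom q.hom) : IsBinaryProduct₂ p q where
  hom Z := by
    refine ⟨fun f g w => InducedBicategory.hom_ext ((h.hom (F Z)).1 (Prod.ext ?_ ?_)),
      fun ⟨a, b⟩ => ?_⟩
    · exact congrArg InducedBicategory.Hom.hom (congrArg Prod.fst w)
    · exact congrArg InducedBicategory.Hom.hom (congrArg Prod.snd w)
    · obtain ⟨k, hk⟩ := (h.hom (F Z)).2 (a.hom, b.hom)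
      exact ⟨InducedBicategory.mkHom k, Prod.ext
        (InducedBicategory.hom_ext (congrArg Prod.fst hk))
        (InducedBicategory.hom_ext (congrArg Prod.snd hk))⟩
  cell {Z} f g := by
    refine ⟨fun θ θ' w => InducedBicategory.hom₂_ext ((h.cell f.hom g.hom).1 (Prod.ext ?_ ?_)),
      fun ⟨a, b⟩ => ?_⟩
    · exact congrArg InducedBicategory.Hom₂.hom (congrArg Prod.fst w)
    · exact congrArg InducedBicategory.Hom₂.hom (congrArg Prod.snd w)
    · obtain ⟨k, hk⟩ := (h.cell f.hom g.hom).2 (a.hom, b.hom)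
      exact ⟨InducedBicategory.Hom₂.mk k, Prod.ext
        (InducedBicategory.hom₂_ext (congrArg Prod.fst hk))
        (InducedBicategory.hom₂_ext (congrArg Prod.snd hk))⟩

end Induced

/-! ### Binary products of loose bimodules -/

namespace LBimod

/-- The fibre product of the collages of two loose bimodules over the walking loose arrow. -/
def prodCollage (M N : LBimod.{v, u}) : DblCat.{v, u} where
  Obj := {x : M.dom.Obj × N.dom.Obj // M.label x.1 = N.label x.2}
  tight :=
    { Hom := fun a b => (a.1.1 ⟶ b.1.1) × (a.1.2 ⟶ b.1.2)
      id := fun a => (𝟙 a.1.1, 𝟙 a.1.2)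
      comp := fun f g => (f.1 ≫ g.1, f.2 ≫ g.2)
      id_comp := fun f => Prod.ext (Category.id_comp f.1) (Category.id_comp f.2)
      comp_id := fun f => Prod.ext (Category.comp_id f.1) (Category.comp_id f.2)
      assoc := fun f g h => Prod.ext (Category.assoc f.1 g.1 h.1) (Category.assoc f.2 g.2 h.2) }
  Loose a b := M.dom.Loose a.1.1 b.1.1 × N.dom.Loose a.1.2 b.1.2
  Sq m n := M.dom.Sq m.1 n.1 × N.dom.Sq m.2 n.2
  left s := (M.dom.left s.1, N.dom.left s.2)
  right s := (M.dom.right s.1, N.dom.right s.2)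
  vid m := (M.dom.vid m.1, N.dom.vid m.2)
  vcomp s t := (M.dom.vcomp s.1 t.1, N.dom.vcomp s.2 t.2)
  vid_vcomp s := Prod.ext (M.dom.vid_vcomp s.1) (N.dom.vid_vcomp s.2)
  vcomp_vid s := Prod.ext (M.dom.vcomp_vid s.1) (N.dom.vcomp_vid s.2)
  vassoc s t w := Prod.ext (M.dom.vassoc s.1 t.1 w.1) (N.dom.vassoc s.2 t.2 w.2)
  left_vid m := Prod.ext (M.dom.left_vid m.1) (N.dom.left_vid m.2)
  right_vid m := Prod.ext (M.dom.right_vid m.1) (N.dom.right_vid m.2)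
  left_vcomp s t := Prod.ext (M.dom.left_vcomp s.1 t.1) (N.dom.left_vcomp s.2 t.2)
  right_vcomp s t := Prod.ext (M.dom.right_vcomp s.1 t.1) (N.dom.right_vcomp s.2 t.2)
  unit a := (M.dom.unit a.1.1, N.dom.unit a.1.2)
  unitSq f := (M.dom.unitSq f.1, N.dom.unitSq f.2)
  left_unitSq f := Prod.ext (M.dom.left_unitSq f.1) (N.dom.left_unitSq f.2)
  right_unitSq f := Prod.ext (M.dom.right_unitSq f.1) (N.dom.right_unitSq f.2)
  unitSq_id a := Prod.ext (M.dom.unitSq_id a.1.1) (N.dom.unitSq_id a.1.2)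
  unitSq_comp f g := Prod.ext (M.dom.unitSq_comp f.1 g.1) (N.dom.unitSq_comp f.2 g.2)
  comp m n := (M.dom.comp m.1 n.1, N.dom.comp m.2 n.2)
  hcomp s t h := (M.dom.hcomp s.1 t.1 (congrArg Prod.fst h),
    N.dom.hcomp s.2 t.2 (congrArg Prod.snd h))
  left_hcomp s t _ := Prod.ext (M.dom.left_hcomp s.1 t.1 _) (N.dom.left_hcomp s.2 t.2 _)
  right_hcomp s t _ := Prod.ext (M.dom.right_hcomp s.1 t.1 _) (N.dom.right_hcomp s.2 t.2 _)
  hcomp_vid m n := Prod.ext (M.dom.hcomp_vid m.1 n.1) (N.dom.hcomp_vid m.2 n.2)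
  hcomp_vcomp s t h s' t' h' := Prod.ext
    (M.dom.hcomp_vcomp s.1 t.1 (congrArg Prod.fst h) s'.1 t'.1 (congrArg Prod.fst h'))
    (N.dom.hcomp_vcomp s.2 t.2 (congrArg Prod.snd h) s'.2 t'.2 (congrArg Prod.snd h'))
  assoc m n p := (M.dom.assoc m.1 n.1 p.1, N.dom.assoc m.2 n.2 p.2)
  left_assoc _ _ _ := Prod.ext (M.dom.left_assoc _ _ _) (N.dom.left_assoc _ _ _)
  right_assoc _ _ _ := Prod.ext (M.dom.right_assoc _ _ _) (N.dom.right_assoc _ _ _)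
  assoc_inv m n p :=
    have ⟨t, h⟩ := M.dom.assoc_inv m.1 n.1 p.1
    have ⟨t', h'⟩ := N.dom.assoc_inv m.2 n.2 p.2
    ⟨(t, t'), Prod.ext h.1 h'.1, Prod.ext h.2 h'.2⟩
  assoc_naturality s t w h h' := Prod.ext
    (M.dom.assoc_naturality s.1 t.1 w.1 (congrArg Prod.fst h) (congrArg Prod.fst h'))
    (N.dom.assoc_naturality s.2 t.2 w.2 (congrArg Prod.snd h) (congrArg Prod.snd h'))
  lunit m := (M.dom.lunit m.1, N.dom.lunit m.2)
  left_lunit _ := Prod.ext (M.dom.left_lunit _) (N.dom.left_lunit _)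
  right_lunit _ := Prod.ext (M.dom.right_lunit _) (N.dom.right_lunit _)
  lunit_inv m :=
    have ⟨t, h⟩ := M.dom.lunit_inv m.1
    have ⟨t', h'⟩ := N.dom.lunit_inv m.2
    ⟨(t, t'), Prod.ext h.1 h'.1, Prod.ext h.2 h'.2⟩
  lunit_naturality s := Prod.ext (M.dom.lunit_naturality s.1) (N.dom.lunit_naturality s.2)
  runit m := (M.dom.runit m.1, N.dom.runit m.2)
  left_runit _ := Prod.ext (M.dom.left_runit _) (N.dom.left_runit _)
  right_runit _ := Prod.ext (M.dom.right_runit _) (N.dom.right_runit _)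
  runit_inv m :=
    have ⟨t, h⟩ := M.dom.runit_inv m.1
    have ⟨t', h'⟩ := N.dom.runit_inv m.2
    ⟨(t, t'), Prod.ext h.1 h'.1, Prod.ext h.2 h'.2⟩
  runit_naturality s := Prod.ext (M.dom.runit_naturality s.1) (N.dom.runit_naturality s.2)
  pentagon m n p q := Prod.ext (M.dom.pentagon m.1 n.1 p.1 q.1) (N.dom.pentagon m.2 n.2 p.2 q.2)
  triangle m n := Prod.ext (M.dom.triangle m.1 n.1) (N.dom.triangle m.2 n.2)

/-- The product of two loose bimodules. -/
def prod (M N : LBimod.{v, u}) : LBimod.{v, u} where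
  dom := prodCollage M N
  hom := WalkingLoose.lift (prodCollage M N) (fun x => M.label x.1.1)
    (fun f => (DblFunctor.map M.hom f.1).down.down)
    (fun m => DblFunctor.loose M.hom m.1)

/-- The underlying double functor of the first projection. -/
def fstFunctor (M N : LBimod.{v, u}) : DblFunctor (prodCollage M N) M.dom where
  obj x := x.1.1
  map f := f.1
  map_id _ := rfl
  map_comp _ _ := rfl
  loose m := m.1
  sq s := s.1
  left_sq _ := rfl
  right_sq _ := rfl
  sq_vid _ := rfl
  sq_vcomp _ _ := rfl
  μ m n := M.dom.vid _
  left_μ _ _ := M.dom.left_vid _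
  right_μ _ _ := M.dom.right_vid _
  μ_inv _ _ := ⟨M.dom.vid _, M.dom.vid_vcomp _, M.dom.vid_vcomp _⟩
  μ_naturality s t h := (M.dom.vcomp_vid _).trans (M.dom.vid_vcomp _).symm
  η a := M.dom.vid _
  left_η _ := M.dom.left_vid _
  right_η _ := M.dom.right_vid _
  η_inv _ := ⟨M.dom.vid _, M.dom.vid_vcomp _, M.dom.vid_vcomp _⟩
  η_naturality f := (M.dom.vcomp_vid _).trans (M.dom.vid_vcomp _).symm
  map_assoc m n p := by simp [prodCollage]
  map_lunit m := by simp [prodCollage]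
  map_runit m := by simp [prodCollage]

/-- The underlying double functor of the second projection. -/
def sndFunctor (M N : LBimod.{v, u}) : DblFunctor (prodCollage M N) N.dom where
  obj x := x.1.2
  map f := f.2
  map_id _ := rfl
  map_comp _ _ := rfl
  loose m := m.2
  sq s := s.2
  left_sq _ := rfl
  right_sq _ := rfl
  sq_vid _ := rfl
  sq_vcomp _ _ := rfl
  μ m n := N.dom.vid _
  left_μ _ _ := N.dom.left_vid _
  right_μ _ _ := N.dom.right_vid _
  μ_inv _ _ := ⟨N.dom.vid _, N.dom.vid_vcomp _, N.dom.vid_vcomp _⟩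
  μ_naturality s t h := (N.dom.vcomp_vid _).trans (N.dom.vid_vcomp _).symm
  η a := N.dom.vid _
  left_η _ := N.dom.left_vid _
  right_η _ := N.dom.right_vid _
  η_inv _ := ⟨N.dom.vid _, N.dom.vid_vcomp _, N.dom.vid_vcomp _⟩
  η_naturality f := (N.dom.vcomp_vid _).trans (N.dom.vid_vcomp _).symm
  map_assoc m n p := by simp [prodCollage]
  map_lunit m := by simp [prodCollage]
  map_runit m := by simp [prodCollage]

/-- A label-preserving double functor is a morphism of loose bimodules. -/
def homMk {M N : LBimod.{v, u}} (F : DblFunctor M.dom N.dom)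
    (h : ∀ x, N.label (F.obj x) = M.label x) : M ⟶ N :=
  Slice.Hom.mk (M := M) (N := N) F (WalkingLoose.functor_ext h)

/-- Every tight transformation between morphisms of loose bimodules is a 2-cell. -/
def cellMk {M N : LBimod.{v, u}} {F G : M ⟶ N}
    (α : TightTrans (Slice.Hom.arr F) (Slice.Hom.arr G)) : F ⟶ G :=
  Slice.Hom₂.mk (F := F) (G := G) α (WalkingLoose.trans_ext _ _)

/-- The first projection. -/
def fst (M N : LBimod.{v, u}) : prod M N ⟶ M := homMk (M := prod M N) (fstFunctor M N) fun _ => rfl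

/-- The second projection. -/
def snd (M N : LBimod.{v, u}) : prod M N ⟶ N :=
  homMk (M := prod M N) (sndFunctor M N) fun x => x.2.symm

variable {M N Z : LBimod.{v, u}}

/-- The pairing of double functors over the walking loose arrow. -/
def pairFunctor (F : DblFunctor Z.dom M.dom) (G : DblFunctor Z.dom N.dom)
    (h : ∀ z, M.label (F.obj z) = N.label (G.obj z)) : DblFunctor Z.dom (prodCollage M N) where
  obj z := ⟨(F.obj z, G.obj z), h z⟩
  map f := (F.map f, G.map f)
  map_id a := Prod.ext (F.map_id a) (G.map_id a)
  map_comp f g := Prod.ext (F.map_comp f g) (G.map_comp f g)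
  loose m := (F.loose m, G.loose m)
  sq s := (F.sq s, G.sq s)
  left_sq s := Prod.ext (F.left_sq s) (G.left_sq s)
  right_sq s := Prod.ext (F.right_sq s) (G.right_sq s)
  sq_vid m := Prod.ext (F.sq_vid m) (G.sq_vid m)
  sq_vcomp s t := Prod.ext (F.sq_vcomp s t) (G.sq_vcomp s t)
  μ m n := (F.μ m n, G.μ m n)
  left_μ m n := Prod.ext (F.left_μ m n) (G.left_μ m n)
  right_μ m n := Prod.ext (F.right_μ m n) (G.right_μ m n)
  μ_inv m n :=
    have ⟨t, h⟩ := F.μ_inv m n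
    have ⟨t', h'⟩ := G.μ_inv m n
    ⟨(t, t'), Prod.ext h.1 h'.1, Prod.ext h.2 h'.2⟩
  μ_naturality s t h := Prod.ext (F.μ_naturality s t h) (G.μ_naturality s t h)
  η a := (F.η a, G.η a)
  left_η a := Prod.ext (F.left_η a) (G.left_η a)
  right_η a := Prod.ext (F.right_η a) (G.right_η a)
  η_inv a :=
    have ⟨t, h⟩ := F.η_inv a
    have ⟨t', h'⟩ := G.η_inv a
    ⟨(t, t'), Prod.ext h.1 h'.1, Prod.ext h.2 h'.2⟩
  η_naturality f := Prod.ext (F.η_naturality f) (G.η_naturality f)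
  map_assoc m n p := Prod.ext (F.map_assoc m n p) (G.map_assoc m n p)
  map_lunit m := Prod.ext (F.map_lunit m) (G.map_lunit m)
  map_runit m := Prod.ext (F.map_runit m) (G.map_runit m)

/-- The pairing of morphisms of loose bimodules. -/
def pair (F : Z ⟶ M) (G : Z ⟶ N) : Z ⟶ prod M N :=
  homMk (N := prod M N) (pairFunctor (Slice.Hom.arr F) (Slice.Hom.arr G)
    fun z => (label_map F z).trans (label_map G z).symm) (label_map F)

/-- The projections are strict, so the two sides agree definitionally on objects, arrows and
squares. Only the comparison squares differ, by a vertical composite with an identity square. The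
same holds for `pair_snd` and `pair_eta`. -/
theorem pair_fst (F : Z ⟶ M) (G : Z ⟶ N) : pair F G ≫ fst M N = F :=
  Slice.Hom.ext (DblFunctor.ext_data (fun _ => rfl) (fun _ => HEq.rfl) (fun _ => HEq.rfl)
    (fun _ => HEq.rfl) (fun _ _ => heq_of_eq (M.dom.vid_vcomp _))
    (fun _ => heq_of_eq (M.dom.vid_vcomp _)))

theorem pair_snd (F : Z ⟶ M) (G : Z ⟶ N) : pair F G ≫ snd M N = G :=
  Slice.Hom.ext (DblFunctor.ext_data (fun _ => rfl) (fun _ => HEq.rfl) (fun _ => HEq.rfl)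
    (fun _ => HEq.rfl) (fun _ _ => heq_of_eq (N.dom.vid_vcomp _))
    (fun _ => heq_of_eq (N.dom.vid_vcomp _)))

theorem pair_eta (H : Z ⟶ prod M N) : pair (H ≫ fst M N) (H ≫ snd M N) = H :=
  Slice.Hom.ext (DblFunctor.ext_data (fun _ => rfl) (fun _ => HEq.rfl) (fun _ => HEq.rfl)
    (fun _ => HEq.rfl)
    (fun _ _ => heq_of_eq (Prod.ext (M.dom.vid_vcomp _) (N.dom.vid_vcomp _)))
    (fun _ => heq_of_eq (Prod.ext (M.dom.vid_vcomp _) (N.dom.vid_vcomp _))))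

/-- The pairing of transformations. -/
def pairTrans {H K : DblFunctor Z.dom (prodCollage M N)}
    (α : TightTrans (H.comp (fstFunctor M N)) (K.comp (fstFunctor M N)))
    (β : TightTrans (H.comp (sndFunctor M N)) (K.comp (sndFunctor M N))) : TightTrans H K where
  app a := (α.app a, β.app a)
  sq m := (α.sq m, β.sq m)
  left_sq m := Prod.ext (α.left_sq m) (β.left_sq m)
  right_sq m := Prod.ext (α.right_sq m) (β.right_sq m)
  naturality f := Prod.ext (α.naturality f) (β.naturality f)
  sq_naturality s := Prod.ext (α.sq_naturality s) (β.sq_naturality s)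
  -- The comparison squares of `H.comp (fstFunctor M N)` are those of `H` preceded by an identity
  -- square coming from the projection; these identities are removed on both sides of the law for
  -- `α`, and likewise for `β`.
  sq_comp m n := Prod.ext
    ((congrArg (fun z => M.dom.vcomp z _) (M.dom.vid_vcomp _)).symm.trans
      ((α.sq_comp m n).trans (congrArg (M.dom.vcomp _) (M.dom.vid_vcomp _))))
    ((congrArg (fun z => N.dom.vcomp z _) (N.dom.vid_vcomp _)).symm.trans
      ((β.sq_comp m n).trans (congrArg (N.dom.vcomp _) (N.dom.vid_vcomp _))))
  sq_unit a := Prod.ext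
    ((congrArg (fun z => M.dom.vcomp z _) (M.dom.vid_vcomp _)).symm.trans
      ((α.sq_unit a).trans (congrArg (M.dom.vcomp _) (M.dom.vid_vcomp _))))
    ((congrArg (fun z => N.dom.vcomp z _) (N.dom.vid_vcomp _)).symm.trans
      ((β.sq_unit a).trans (congrArg (N.dom.vcomp _) (N.dom.vid_vcomp _))))

/-- On 1-cells, `pair` is a two-sided inverse of composition with the projections. On 2-cells, a
transformation into the fibre product is a pair of transformations, and the slice condition is
automatic since parallel transformations into the walking loose arrow are equal. -/
theorem isBinaryProduct₂_prod (M N : LBimod.{v, u}) : IsBinaryProduct₂ (fst M N) (snd M N) where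
  hom Z := by
    refine ⟨fun H K w => ?_, fun ⟨F, G⟩ => ⟨pair F G, Prod.ext (pair_fst F G) (pair_snd F G)⟩⟩
    rw [← pair_eta H, ← pair_eta K]
    exact congrArg (fun x : (Z ⟶ M) × (Z ⟶ N) => pair x.1 x.2) w
  cell {Z} H K := by
    refine ⟨fun α β w => Slice.Hom₂.ext (DblCat.hom_ext₂ (fun a => Prod.ext ?_ ?_)
      (fun m => Prod.ext ?_ ?_)), fun ⟨α, β⟩ =>
        ⟨cellMk (pairTrans (Slice.Hom₂.cell α) (Slice.Hom₂.cell β)), rfl⟩⟩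
    · exact congrArg (fun x => TightTrans.app (Slice.Hom₂.cell (Prod.fst x)) a) w
    · exact congrArg (fun x => TightTrans.app (Slice.Hom₂.cell (Prod.snd x)) a) w
    · exact congrArg (fun x => TightTrans.sq (Slice.Hom₂.cell (Prod.fst x)) m) w
    · exact congrArg (fun x => TightTrans.sq (Slice.Hom₂.cell (Prod.snd x)) m) w

/-- The source of a product of loose right modules is terminal. -/
theorem isTerminal_source_prod (hM : M.source.IsTerminal) (hN : N.source.IsTerminal) :
    (prod M N).source.IsTerminal where
  obj := by
    obtain ⟨i⟩ := hM.obj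
    obtain ⟨j⟩ := hN.obj
    refine ⟨⟨⟨⟨⟨(i.default.1, j.default.1), i.default.2.trans j.default.2.symm⟩, i.default.2⟩⟩,
      fun a => ?_⟩⟩
    have h1 := i.uniq ⟨a.1.1.1, a.2⟩
    -- The label of a pair is read off its first coordinate; the second coordinate lies over 0
    -- because the labels agree.
    have h2 := j.uniq ⟨a.1.1.2, a.1.2.symm.trans a.2⟩
    exact Subtype.ext (Subtype.ext (Prod.ext (congrArg Subtype.val h1) (congrArg Subtype.val h2)))
  tight a b := by
    obtain ⟨i⟩ := hM.tight ⟨a.1.1.1, a.2⟩ ⟨b.1.1.1, b.2⟩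
    obtain ⟨j⟩ := hN.tight ⟨a.1.1.2, a.1.2.symm.trans a.2⟩ ⟨b.1.1.2, b.1.2.symm.trans b.2⟩
    exact ⟨⟨⟨(i.default, j.default)⟩, fun f => Prod.ext (i.uniq f.1) (j.uniq f.2)⟩⟩
  loose a b := by
    obtain ⟨i⟩ := hM.loose ⟨a.1.1.1, a.2⟩ ⟨b.1.1.1, b.2⟩
    obtain ⟨j⟩ := hN.loose ⟨a.1.1.2, a.1.2.symm.trans a.2⟩ ⟨b.1.1.2, b.1.2.symm.trans b.2⟩
    exact ⟨⟨⟨(i.default, j.default)⟩, fun f => Prod.ext (i.uniq f.1) (j.uniq f.2)⟩⟩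
  sq {a b c d} m n := by
    obtain ⟨i⟩ := hM.sq (a := ⟨a.1.1.1, a.2⟩) (b := ⟨b.1.1.1, b.2⟩) (c := ⟨c.1.1.1, c.2⟩)
      (d := ⟨d.1.1.1, d.2⟩) m.1 n.1
    obtain ⟨j⟩ := hN.sq (a := ⟨a.1.1.2, a.1.2.symm.trans a.2⟩)
      (b := ⟨b.1.1.2, b.1.2.symm.trans b.2⟩) (c := ⟨c.1.1.2, c.1.2.symm.trans c.2⟩)
      (d := ⟨d.1.1.2, d.1.2.symm.trans d.2⟩) m.2 n.2
    exact ⟨⟨⟨(i.default, j.default)⟩, fun f => Prod.ext (i.uniq f.1) (j.uniq f.2)⟩⟩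

end LBimod

/-! ### Terminal loose bimodules -/

namespace LBimod

/-- A loose bimodule with exactly one object, loose arrow and square over each object, loose arrow
and square of the walking loose arrow. -/
structure IsWalking (M : LBimod.{v, u}) : Prop where
  label : Function.Bijective M.label
  tight : ∀ a b : M.dom.Obj, Subsingleton (a ⟶ b)
  loose : ∀ a b : M.dom.Obj, Subsingleton (M.dom.Loose a b)
  sq : ∀ {a b c d : M.dom.Obj} (m : M.dom.Loose a b) (n : M.dom.Loose c d),
    Subsingleton (M.dom.Sq m n)
  exists_loose : ∀ a b : M.dom.Obj, LooseArr (M.label a) (M.label b) →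
    Nonempty (M.dom.Loose a b)

/-- The walking loose arrow, as a loose bimodule over itself. -/
def walking : LBimod.{v, u} where
  dom := WalkingLoose
  hom := 𝟙 WalkingLoose

theorem isWalking_walking : IsWalking walking.{v, u} where
  label := Function.bijective_id
  tight _ _ := ⟨fun _ _ => WalkingLoose.tight_eq _ _⟩
  loose _ _ := ⟨fun _ _ => WalkingLoose.loose_eq _ _⟩
  sq _ _ := ⟨fun _ _ => WalkingLoose.sq_eq _ _⟩
  exists_loose _ _ m := ⟨m⟩

/-- Tight arrows of the walking loose arrow are proofs of equality. -/
theorem label_eq_of_tight (Z : LBimod.{v, u}) {a b : Z.dom.Obj} (f : a ⟶ b) :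
    Z.label a = Z.label b :=
  (DblFunctor.map Z.hom f).down.down

/-! ### Terminality from the property `IsWalking` -/

namespace IsWalking

variable {M Z : LBimod.{v, u}} (h : IsWalking M)
include h

theorem nonempty_tight {a b : M.dom.Obj} (w : M.label a = M.label b) : Nonempty (a ⟶ b) := by
  obtain rfl := h.label.1 w
  exact ⟨𝟙 a⟩

/-- Injectivity of the label identifies the corners, and parallel loose arrows are equal, so an
identity square will do. Together with uniqueness of squares this makes every construction into `M`
a matter of labels. -/
theorem nonempty_sq {a b c d : M.dom.Obj} (w : M.label a = M.label c)
    (w' : M.label b = M.label d) (m : M.dom.Loose a b) (n : M.dom.Loose c d) :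
    Nonempty (M.dom.Sq m n) := by
  obtain rfl := h.label.1 w
  obtain rfl := h.label.1 w'
  obtain rfl := (h.loose a b).elim m n
  exact ⟨M.dom.vid m⟩

/-- There is a square back, and any such square is an inverse because parallel squares are equal. -/
theorem inv_sq {a b : M.dom.Obj} {m n : M.dom.Loose a b} (s : M.dom.Sq m n) :
    ∃ t, M.dom.vcomp s t = M.dom.vid m ∧ M.dom.vcomp t s = M.dom.vid n :=
  have ⟨t⟩ := h.nonempty_sq rfl rfl n m
  ⟨t, (h.sq _ _).elim _ _, (h.sq _ _).elim _ _⟩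

/-- A double functor into a walking loose arrow is determined by its action on objects. -/
theorem functor_ext {D : DblCat.{v, u}} {F G : D ⟶ M.dom}
    (w : ∀ a, DblFunctor.obj F a = DblFunctor.obj G a) : F = G := by
  have ht : ∀ {a a' b b' : M.dom.Obj} (_ : a = a') (_ : b = b') (f : a ⟶ b) (f' : a' ⟶ b'),
      HEq f f' := by
    rintro a _ b _ rfl rfl f f'
    exact heq_of_eq ((h.tight a b).elim _ _)
  have hl : ∀ {a a' b b' : M.dom.Obj} (_ : a = a') (_ : b = b') (m : M.dom.Loose a b)
      (m' : M.dom.Loose a' b'), HEq m m' := by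
    rintro a _ b _ rfl rfl m m'
    exact heq_of_eq ((h.loose a b).elim _ _)
  have hs : ∀ {a a' b b' c c' d d' : M.dom.Obj} (_ : a = a') (_ : b = b') (_ : c = c')
      (_ : d = d') (m : M.dom.Loose a b) (m' : M.dom.Loose a' b') (n : M.dom.Loose c d)
      (n' : M.dom.Loose c' d') (s : M.dom.Sq m n) (s' : M.dom.Sq m' n'), HEq s s' := by
    rintro a _ b _ c _ d _ rfl rfl rfl rfl m m' n n' s s'
    obtain rfl := (h.loose a b).elim m m'
    obtain rfl := (h.loose c d).elim n n'
    exact heq_of_eq ((h.sq m n).elim _ _)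
  exact DblFunctor.ext_data w (fun _ => ht (w _) (w _) _ _) (fun _ => hl (w _) (w _) _ _)
    (fun _ => hs (w _) (w _) (w _) (w _) _ _ _ _ _ _)
    (fun _ _ => hs (w _) (w _) (w _) (w _) _ _ _ _ _ _)
    (fun _ => hs (w _) (w _) (w _) (w _) _ _ _ _ _ _)

/-- Each piece of data exists for reasons of labels and is chosen arbitrarily. No choice has to be
coherent with another: all the laws are equalities between parallel tight arrows or parallel squares
of `M`. -/
theorem exists_functor : ∃ F : DblFunctor Z.dom M.dom, ∀ z, M.label (F.obj z) = Z.label z := by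
  -- A section of the label map of `M`; an object of `Z` is sent to the object of `M` chosen for its
  -- label.
  choose obj hobj using h.label.2
  have hmap : ∀ {a b : Z.dom.Obj} (_ : a ⟶ b), Nonempty (obj (Z.label a) ⟶ obj (Z.label b)) :=
    fun f => h.nonempty_tight (by rw [hobj, hobj]; exact Z.label_eq_of_tight f)
  have hloose : ∀ {a b : Z.dom.Obj} (_ : Z.dom.Loose a b),
      Nonempty (M.dom.Loose (obj (Z.label a)) (obj (Z.label b))) :=
    fun m => h.exists_loose _ _ (by rw [hobj, hobj]; exact DblFunctor.loose Z.hom m)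
  have hsq : ∀ {a b c d : Z.dom.Obj} {m : Z.dom.Loose a b} {n : Z.dom.Loose c d}
      (_ : Z.dom.Sq m n), Nonempty (M.dom.Sq (hloose m).some (hloose n).some) :=
    fun s => h.nonempty_sq (by rw [hobj, hobj]; exact Z.label_eq_of_tight (Z.dom.left s))
      (by rw [hobj, hobj]; exact Z.label_eq_of_tight (Z.dom.right s)) _ _
  have hμ : ∀ {a b c : Z.dom.Obj} (m : Z.dom.Loose a b) (n : Z.dom.Loose b c),
      Nonempty (M.dom.Sq (M.dom.comp (hloose m).some (hloose n).some)
        (hloose (Z.dom.comp m n)).some) :=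
    fun _ _ => h.nonempty_sq rfl rfl _ _
  have hη : ∀ a : Z.dom.Obj,
      Nonempty (M.dom.Sq (M.dom.unit (obj (Z.label a))) (hloose (Z.dom.unit a)).some) :=
    fun _ => h.nonempty_sq rfl rfl _ _
  refine ⟨{
    obj := fun z => obj (Z.label z)
    map := fun f => (hmap f).some
    map_id := fun _ => (h.tight _ _).elim _ _
    map_comp := fun _ _ => (h.tight _ _).elim _ _
    loose := fun m => (hloose m).some
    sq := fun s => (hsq s).some
    left_sq := fun _ => (h.tight _ _).elim _ _
    right_sq := fun _ => (h.tight _ _).elim _ _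
    sq_vid := fun _ => (h.sq _ _).elim _ _
    sq_vcomp := fun _ _ => (h.sq _ _).elim _ _
    μ := fun m n => (hμ m n).some
    left_μ := fun _ _ => (h.tight _ _).elim _ _
    right_μ := fun _ _ => (h.tight _ _).elim _ _
    μ_inv := fun _ _ => h.inv_sq _
    μ_naturality := fun _ _ _ => (h.sq _ _).elim _ _
    η := fun a => (hη a).some
    left_η := fun _ => (h.tight _ _).elim _ _
    right_η := fun _ => (h.tight _ _).elim _ _
    η_inv := fun _ => h.inv_sq _
    η_naturality := fun _ => (h.sq _ _).elim _ _
    map_assoc := fun _ _ _ => (h.sq _ _).elim _ _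
    map_lunit := fun _ => (h.sq _ _).elim _ _
    map_runit := fun _ => (h.sq _ _).elim _ _ }, fun z => hobj _⟩

theorem exists_trans (F G : Z ⟶ M) :
    Nonempty (TightTrans (Slice.Hom.arr F) (Slice.Hom.arr G)) := by
  have w : ∀ z, M.label (DblFunctor.obj (Slice.Hom.arr F) z) =
      M.label (DblFunctor.obj (Slice.Hom.arr G) z) :=
    fun z => (label_map F z).trans (label_map G z).symm
  have hsq : ∀ {a b : Z.dom.Obj} (m : Z.dom.Loose a b), Nonempty (M.dom.Sq
      (DblFunctor.loose (Slice.Hom.arr F) m) (DblFunctor.loose (Slice.Hom.arr G) m)) :=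
    fun _ => h.nonempty_sq (w _) (w _) _ _
  exact ⟨{
    app := fun z => (h.nonempty_tight (w z)).some
    sq := fun m => (hsq m).some
    left_sq := fun _ => (h.tight _ _).elim _ _
    right_sq := fun _ => (h.tight _ _).elim _ _
    naturality := fun _ => (h.tight _ _).elim _ _
    sq_naturality := fun _ => (h.sq _ _).elim _ _
    sq_comp := fun _ _ => (h.sq _ _).elim _ _
    sq_unit := fun _ => (h.sq _ _).elim _ _ }⟩

/-- Existence comes from `exists_functor` and `exists_trans`; uniqueness holds because labels are
preserved and separate the objects of `M`, while everything above the objects is unique. -/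
theorem isTerminal₂ : IsTerminal₂ M where
  hom Z := by
    obtain ⟨F, hF⟩ := h.exists_functor (Z := Z)
    exact ⟨⟨⟨homMk F hF⟩, fun G => Slice.Hom.ext
      (h.functor_ext fun z => h.label.1 ((label_map G z).trans (hF z).symm))⟩⟩
  cell F G := by
    obtain ⟨α⟩ := h.exists_trans F G
    exact ⟨⟨⟨cellMk α⟩, fun β => Slice.Hom₂.ext (DblCat.hom_ext₂
      (fun _ => (h.tight _ _).elim _ _) (fun _ => (h.sq _ _).elim _ _))⟩⟩

theorem isTerminal_source : M.source.IsTerminal := by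
  have hs : ∀ a b : M.source.Obj, a = b := fun a b =>
    Subtype.ext (h.label.1 (a.2.trans b.2.symm))
  have hl : ∀ a b : M.source.Obj, M.label a.1 = M.label b.1 := fun a b => a.2.trans b.2.symm
  refine ⟨?_, fun a b => ?_, fun a b => ?_, fun {a b c d} m n => ?_⟩
  · obtain ⟨x, hx⟩ := h.label.2 LooseObj.zero
    exact ⟨⟨⟨⟨x, hx⟩⟩, fun _ => hs _ _⟩⟩
  · obtain ⟨f⟩ := h.nonempty_tight (hl a b)
    exact ⟨⟨⟨f⟩, fun _ => (h.tight _ _).elim _ _⟩⟩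
  · obtain ⟨m⟩ := h.exists_loose a.1 b.1 (by rw [hl a b]; exact LooseArr.unit _)
    exact ⟨⟨⟨m⟩, fun _ => (h.loose _ _).elim _ _⟩⟩
  · obtain ⟨s⟩ := h.nonempty_sq (hl a c) (hl b d) m n
    exact ⟨⟨⟨s⟩, fun _ => (h.sq _ _).elim _ _⟩⟩

/-- The collapse of a walking loose arrow is a walking loose arrow. -/
theorem collapse : IsWalking (Collapse.bimod M) where
  label := by
    constructor
    · rintro (_ | d) (_ | d') w
      · rfl
      · cases w
      · cases w
      · exact congrArg Collapse.Obj.of (Subtype.ext (h.label.1 (d.2.trans d'.2.symm)))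
    · rintro (_ | _)
      · exact ⟨Collapse.Obj.pt, rfl⟩
      · obtain ⟨x, hx⟩ := h.label.2 LooseObj.one
        exact ⟨Collapse.Obj.of ⟨x, hx⟩, rfl⟩
  tight := by
    rintro (_ | d) (_ | d')
    · exact inferInstanceAs (Subsingleton PUnit)
    · exact inferInstanceAs (Subsingleton PEmpty)
    · exact inferInstanceAs (Subsingleton PEmpty)
    · exact h.tight d.1 d'.1
  loose a b := by
    change Subsingleton (Collapse.Loose a b)
    refine ⟨fun m n => ?_⟩
    cases m with
    | pt => cases n; rfl
    | @het d₀ d₁ m =>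
      cases n with
      | @het d₀' _ n =>
        -- Forgetting sources could create several parallel heteromorphisms; it does not here, since
        -- only one object of `M` lies over 0.
        obtain rfl : d₀ = d₀' := Subtype.ext (h.label.1 (d₀.2.trans d₀'.2.symm))
        rw [(h.loose _ _).elim m n]
    | of m =>
      cases n with
      | of n => rw [(h.loose _ _).elim m n]
  sq {a b c d} m n := by
    change Collapse.Loose a b at m
    change Collapse.Loose c d at n
    change Subsingleton (Collapse.Sq m n)
    cases m <;> cases n <;> first
      | exact ⟨fun x => PEmpty.elim x⟩
      | exact ⟨fun _ _ => rfl⟩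
      | exact h.sq _ _
  exists_loose := by
    rintro (_ | d) (_ | d') m
    · exact ⟨Collapse.Loose.pt⟩
    · obtain ⟨x, hx⟩ := h.label.2 LooseObj.zero
      obtain ⟨n⟩ := h.exists_loose x d'.1 (by rw [hx, d'.2]; exact LooseArr.two)
      exact ⟨Collapse.Loose.het (d₀ := ⟨x, hx⟩) n⟩
    -- The walking loose arrow has no loose arrow from 1 to 0.
    · cases m
    · obtain ⟨n⟩ := h.exists_loose d.1 d'.1 (by rw [d.2, d'.2]; exact LooseArr.unit _)
      exact ⟨Collapse.Loose.of n⟩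

end IsWalking

theorem isCartesian₂ : IsCartesian₂ LBimod.{v, u} where
  terminal := ⟨walking, isWalking_walking.isTerminal₂⟩
  product M N := ⟨prod M N, fst M N, snd M N, isBinaryProduct₂_prod M N⟩

end LBimod

/-! ### Finite products of loose right modules -/

/-- The walking loose arrow, as a loose right module. -/
def LModR.walking : LModR.{v, u} :=
  ⟨LBimod.walking, LBimod.isWalking_walking.isTerminal_source⟩

/-- The product of two loose right modules. -/
def LModR.prod (M N : LModR.{v, u}) : LModR.{v, u} :=
  ⟨LBimod.prod M.1 N.1, LBimod.isTerminal_source_prod M.2 N.2⟩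

/-- The first projection of a product of loose right modules. -/
def LModR.fst (M N : LModR.{v, u}) : LModR.prod M N ⟶ M :=
  InducedBicategory.mkHom (LBimod.fst M.1 N.1)

/-- The second projection of a product of loose right modules. -/
def LModR.snd (M N : LModR.{v, u}) : LModR.prod M N ⟶ N :=
  InducedBicategory.mkHom (LBimod.snd M.1 N.1)

theorem LModR.isCartesian₂ : IsCartesian₂ LModR.{v, u} where
  terminal := ⟨LModR.walking,
    IsTerminal₂.of_induced (T := LModR.walking) LBimod.isWalking_walking.isTerminal₂⟩
  product M N := ⟨LModR.prod M N, LModR.fst M N, LModR.snd M N,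
    IsBinaryProduct₂.of_induced (p := LModR.fst M N) (q := LModR.snd M N)
      (LBimod.isBinaryProduct₂_prod M.1 N.1)⟩

/-! ### Collapse is a 2-functor -/

theorem LModR.hom₂_ext {A B : LModR.{v, u}} {F G : A ⟶ B} {α β : F ⟶ G}
    (h₁ : ∀ a, TightTrans.app (Slice.Hom₂.cell (InducedBicategory.Hom₂.hom α)) a =
      TightTrans.app (Slice.Hom₂.cell (InducedBicategory.Hom₂.hom β)) a)
    (h₂ : ∀ {a b : A.1.dom.Obj} (m : A.1.dom.Loose a b),
      TightTrans.sq (Slice.Hom₂.cell (InducedBicategory.Hom₂.hom α)) m =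
        TightTrans.sq (Slice.Hom₂.cell (InducedBicategory.Hom₂.hom β)) m) : α = β :=
  InducedBicategory.hom₂_ext (Slice.Hom₂.ext (DblCat.hom_ext₂ h₁ h₂))

/-- A 2-cell which is composed with identities on both sides. -/
theorem LModR.conj_eq {A B : LModR.{v, u}} {F F' G G' : A ⟶ B} (hF : F = F') (hG : G' = G)
    (α : F ⟶ G) (β : F' ⟶ G')
    (h₁ : ∀ a, HEq (TightTrans.app (Slice.Hom₂.cell (InducedBicategory.Hom₂.hom α)) a)
      (TightTrans.app (Slice.Hom₂.cell (InducedBicategory.Hom₂.hom β)) a))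
    (h₂ : ∀ {a b : A.1.dom.Obj} (m : A.1.dom.Loose a b),
      HEq (TightTrans.sq (Slice.Hom₂.cell (InducedBicategory.Hom₂.hom α)) m)
        (TightTrans.sq (Slice.Hom₂.cell (InducedBicategory.Hom₂.hom β)) m)) :
    α = eqToHom hF ≫ β ≫ eqToHom hG := by
  subst hF hG
  simp only [eqToHom_refl, Category.id_comp, Category.comp_id]
  exact LModR.hom₂_ext (fun a => eq_of_heq (h₁ a)) (fun m => eq_of_heq (h₂ m))

namespace Collapse

theorem map_id (M : LBimod.{v, u}) : map (𝟙 M) = 𝟙 (obj M) := by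
  refine InducedBicategory.hom_ext (Slice.Hom.ext (DblFunctor.ext_data ?_ ?_ ?_ ?_ ?_ ?_))
  · rintro (_ | _) <;> rfl
  · rintro (_ | _) (_ | _) f <;> first | exact PEmpty.elim f | exact HEq.rfl
  · rintro _ _ (_ | _ | _) <;> exact HEq.rfl
  · rintro _ _ _ _ (_ | _ | _) (_ | _ | _) s <;> first | exact PEmpty.elim s | exact HEq.rfl
  · rintro _ _ _ (_ | _ | _) n <;> cases n <;> exact HEq.rfl
  · rintro (_ | _) <;> exact HEq.rfl

/-- On each constructor both sides unfold to the same data of `F` and `G`. The one discrepancy is in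
the comparison squares with the point on the left: an identity square on one side, and on the other
an identity followed by the image under `G` of an identity. -/
theorem map_comp {M N P : LBimod.{v, u}} (F : M ⟶ N) (G : N ⟶ P) :
    map (F ≫ G) = map F ≫ map G := by
  refine InducedBicategory.hom_ext (Slice.Hom.ext (DblFunctor.ext_data ?_ ?_ ?_ ?_ ?_ ?_))
  · rintro (_ | _) <;> rfl
  · rintro (_ | _) (_ | _) f <;> first | exact PEmpty.elim f | exact HEq.rfl
  · rintro _ _ (_ | _ | _) <;> exact HEq.rfl
  · rintro _ _ _ _ (_ | _ | _) (_ | _ | _) s <;> first | exact PEmpty.elim s | exact HEq.rfl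
  · rintro _ _ _ (_ | _ | _) n <;> cases n <;> first
      | exact HEq.rfl
      | exact heq_of_eq ((P.dom.vid_vcomp _).trans
          (DblFunctor.sq_vid (Slice.Hom.arr G) _)).symm
  · rintro (_ | _) <;> exact HEq.rfl

theorem map₂_id {M N : LBimod.{v, u}} (F : M ⟶ N) : map₂ (𝟙 F) = 𝟙 (map F) := by
  refine LModR.hom₂_ext ?_ ?_
  · rintro (_ | _) <;> rfl
  · rintro _ _ (_ | _ | _) <;> rfl

theorem map₂_comp {M N : LBimod.{v, u}} {F G H : M ⟶ N} (α : F ⟶ G) (β : G ⟶ H) :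
    map₂ (α ≫ β) = map₂ α ≫ map₂ β := by
  refine LModR.hom₂_ext ?_ ?_
  · rintro (_ | _) <;> rfl
  · rintro _ _ (_ | _ | _) <;> rfl

end Collapse

/-- Collapse as a strict 2-functor. -/
def collapse₂ : StrictPseudofunctor LBimod.{v, u} LModR.{v, u} :=
  StrictPseudofunctor.mk''
    { collapse with
      map₂_id := Collapse.map₂_id
      map₂_comp := Collapse.map₂_comp
      map_id := Collapse.map_id
      map_comp := Collapse.map_comp
      map₂_whisker_left := fun F _ _ η => by
        -- The required cells are conjugate by the `eqToHom`s of `map_comp`, so it is enough that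
        -- their components agree heterogeneously, which holds by definition on each constructor.
        refine LModR.conj_eq (Collapse.map_comp F _) (Collapse.map_comp F _).symm
          (Collapse.map₂ (F ◁ η)) (Collapse.map F ◁ Collapse.map₂ η) ?_ ?_
        · rintro (_ | _) <;> exact HEq.rfl
        · rintro _ _ (_ | _ | _) <;> exact HEq.rfl
      map₂_whisker_right := fun η G => by
        refine LModR.conj_eq (Collapse.map_comp _ G) (Collapse.map_comp _ G).symm
          (Collapse.map₂ (η ▷ G)) (Collapse.map₂ η ▷ Collapse.map G) ?_ ?_
        · rintro (_ | _) <;> exact HEq.rfl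
        · rintro _ _ (_ | _ | _) <;> exact HEq.rfl }

theorem collapse₂_toPrelaxFunctorStruct :
    collapse₂.toPrelaxFunctorStruct = collapse.{v, u} := rfl

/-! ### Collapse preserves products -/

namespace Collapse

open LBimod

variable {M N : LBimod.{v, u}}

/-- Objects of two collapses with the same label. -/
abbrev Compat (a : Obj M) (a' : Obj N) : Prop := (bimod M).label a = (bimod N).label a'

/-- The compatible pairs of loose arrows of two collapses. -/
inductive ProdLoose : ∀ {a b : Obj M} {a' b' : Obj N}, Loose a b → Loose a' b' → Type (max u v)
  | pt : ProdLoose Loose.pt Loose.pt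
  | het {d₀ d₁ d₀' d₁'} (m : M.dom.Loose d₀.1 d₁.1) (m' : N.dom.Loose d₀'.1 d₁'.1) :
      ProdLoose (Loose.het (d₀ := d₀) (d₁ := d₁) m) (Loose.het (d₀ := d₀') (d₁ := d₁') m')
  | of {d₀ d₁ d₀' d₁'} (m : M.dom.Loose d₀.1 d₁.1) (m' : N.dom.Loose d₀'.1 d₁'.1) :
      ProdLoose (Loose.of (d := d₀) (d' := d₁) m) (Loose.of (d := d₀') (d' := d₁') m')

/-- Loose arrows between objects with the same labels are compatible. -/
def prodLoose {a b : Obj M} {a' b' : Obj N} (ha : Compat a a')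
    (hb : Compat b b') (m : Loose a b) (m' : Loose a' b') :
    ProdLoose m m' :=
  match m, m', ha, hb with
  | .pt, .pt, _, _ => .pt
  | .het m, .het m', _, _ => .het m m'
  | .of m, .of m', _, _ => .of m m'
  | .pt, .het _, _, h => LooseObj.noConfusion h
  | .pt, .of _, h, _ => LooseObj.noConfusion h
  | .het _, .pt, _, h => LooseObj.noConfusion h
  | .het _, .of _, h, _ => LooseObj.noConfusion h
  | .of _, .pt, h, _ => LooseObj.noConfusion h
  | .of _, .het _, h, _ => LooseObj.noConfusion h

/-- A pair of objects with the same label, as an object of the product. -/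
abbrev fiberPair {i : LooseObj} (d : (M.fiber i).Obj) (d' : (N.fiber i).Obj) :
    ((prod M N).fiber i).Obj :=
  ⟨⟨(d.1, d'.1), d.2.trans d'.2.symm⟩, d.2⟩

/-- A pair of loose arrows, as a loose arrow of the product. -/
abbrev loosePair {i j : LooseObj} {d : (M.fiber i).Obj} {d' : (N.fiber i).Obj}
    {e : (M.fiber j).Obj} {e' : (N.fiber j).Obj} (m : M.dom.Loose d.1 e.1)
    (m' : N.dom.Loose d'.1 e'.1) : (prod M N).dom.Loose (fiberPair d d').1 (fiberPair e e').1 :=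
  (m, m')

/-- A compatible pair of objects of two collapses, as an object of the collapse of the product. -/
def unprodObj : ∀ (a : Obj M) (a' : Obj N), Compat a a' →
    Obj (prod M N)
  | .pt, .pt, _ => .pt
  | .of d, .of d', _ => .of (fiberPair d d')
  | .pt, .of _, h => LooseObj.noConfusion h
  | .of _, .pt, h => LooseObj.noConfusion h

/-- The action of `unprodObj` on tight arrows. -/
def unprodTight : ∀ {a b : Obj M} {a' b' : Obj N} (ha : Compat a a')
    (hb : Compat b b'), Tight a b → Tight a' b' →
      Tight (unprodObj a a' ha) (unprodObj b b' hb)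
  | .pt, .pt, .pt, .pt, _, _, _, _ => PUnit.unit
  | .of _, .of _, .of _, .of _, _, _, f, f' => (f, f')
  | .pt, .of _, _, _, _, _, f, _ => PEmpty.elim f
  | .of _, .pt, _, _, _, _, f, _ => PEmpty.elim f
  | .pt, .pt, .of _, _, h, _, _, _ => LooseObj.noConfusion h
  | .pt, .pt, _, .of _, _, h, _, _ => LooseObj.noConfusion h
  | .of _, .of _, .pt, _, h, _, _, _ => LooseObj.noConfusion h
  | .of _, .of _, _, .pt, _, h, _, _ => LooseObj.noConfusion h

/-- The action of `unprodObj` on loose arrows. -/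
def ProdLoose.unprod : ∀ {a b : Obj M} {a' b' : Obj N} {m : Loose a b} {m' : Loose a' b'}
    (_ : ProdLoose m m') (ha : Compat a a')
    (hb : Compat b b'),
    Loose (unprodObj a a' ha) (unprodObj b b' hb)
  | _, _, _, _, _, _, .pt, _, _ => .pt
  | _, _, _, _, _, _, .het m m', _, _ => .het (loosePair m m')
  | _, _, _, _, _, _, .of m m', _, _ => .of (loosePair m m')

/-- The action of `unprodObj` on squares. -/
def ProdLoose.unprodSq : ∀ {a b c d : Obj M} {a' b' c' d' : Obj N} {m : Loose a b}
    {m' : Loose a' b'} {n : Loose c d} {n' : Loose c' d'} (v : ProdLoose m m')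
    (w : ProdLoose n n') (ha : Compat a a')
    (hb : Compat b b') (hc : Compat c c')
    (hd : Compat d d') (_ : Sq m n) (_ : Sq m' n'),
    Sq (v.unprod ha hb) (w.unprod hc hd)
  | _, _, _, _, _, _, _, _, _, _, _, _, .pt, .pt, _, _, _, _, _, _ => PUnit.unit
  | _, _, _, _, _, _, _, _, _, _, _, _, .het _ _, .het _ _, _, _, _, _, s, s' => (s, s')
  | _, _, _, _, _, _, _, _, _, _, _, _, .of _ _, .of _ _, _, _, _, _, s, s' => (s, s')
  | _, _, _, _, _, _, _, _, _, _, _, _, .pt, .het _ _, _, _, _, _, s, _ => PEmpty.elim s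
  | _, _, _, _, _, _, _, _, _, _, _, _, .pt, .of _ _, _, _, _, _, s, _ => PEmpty.elim s
  | _, _, _, _, _, _, _, _, _, _, _, _, .het _ _, .pt, _, _, _, _, s, _ => PEmpty.elim s
  | _, _, _, _, _, _, _, _, _, _, _, _, .het _ _, .of _ _, _, _, _, _, s, _ => PEmpty.elim s
  | _, _, _, _, _, _, _, _, _, _, _, _, .of _ _, .pt, _, _, _, _, s, _ => PEmpty.elim s
  | _, _, _, _, _, _, _, _, _, _, _, _, .of _ _, .het _ _, _, _, _, _, s, _ => PEmpty.elim s

/-- The composition of compatible pairs. -/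
def ProdLoose.comp {a b c : Obj M} {a' b' c' : Obj N} {m : Loose a b} {m' : Loose a' b'}
    {n : Loose b c} {n' : Loose b' c'} (v : ProdLoose m m') (w : ProdLoose n n') :
    ProdLoose (Collapse.comp m n) (Collapse.comp m' n') :=
  match v, w with
  | .pt, w => w
  | .het m m', .of n n' => .het (M.dom.comp m n) (N.dom.comp m' n')
  | .of m m', .of n n' => .of (M.dom.comp m n) (N.dom.comp m' n')

/-- The identity compatible pairs. -/
def ProdLoose.unit : ∀ {a : Obj M} {a' : Obj N}, Compat a a' →
    ProdLoose (Collapse.unit a) (Collapse.unit a')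
  | .pt, .pt, _ => .pt
  | .of d, .of d', _ => .of (M.dom.unit d.1) (N.dom.unit d'.1)
  | .pt, .of _, h => LooseObj.noConfusion h
  | .of _, .pt, h => LooseObj.noConfusion h

/-- `ProdLoose` is data only so that loose arrows and squares can be defined by matching on it; it
carries no choice. The witness that `prodLoose` gives for a composite or a loose identity does not
reduce to `ProdLoose.comp` or `ProdLoose.unit` on variables. The lemmas below therefore accept
arbitrary witnesses and use this instance to replace them. -/
instance {a b : Obj M} {a' b' : Obj N} (m : Loose a b) (m' : Loose a' b') :
    Subsingleton (ProdLoose m m') :=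
  ⟨fun v w => by cases v <;> cases w <;> rfl⟩

/-! ### The laws for merging compatible pairs -/

section

variable {a b c d e f : Obj M} {a' b' c' d' e' f' : Obj N}
  {m : Loose a b} {m' : Loose a' b'} {n : Loose b c} {n' : Loose b' c'} {p : Loose c d}
  {p' : Loose c' d'}

/-- Compatible pairs on the same loose arrows have the same image under `ProdLoose.unprod`. -/
def ProdLoose.canon : ∀ {a b : Obj M} {a' b' : Obj N} {m : Loose a b} {m' : Loose a' b'}
    (v x : ProdLoose m m') (ha : Compat a a') (hb : Compat b b'),
    Sq (v.unprod ha hb) (x.unprod ha hb)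
  | _, _, _, _, _, _, .pt, .pt, _, _ => PUnit.unit
  | _, _, _, _, _, _, .het _ _, .het _ _, _, _ => (prod M N).dom.vid _
  | _, _, _, _, _, _, .of _ _, .of _ _, _, _ => (prod M N).dom.vid _

/-- The comparison of composites for `ProdLoose.unprod`. -/
def unprodμ : ∀ {a b c : Obj M} {a' b' c' : Obj N} {m : Loose a b} {m' : Loose a' b'}
    {n : Loose b c} {n' : Loose b' c'} (v : ProdLoose m m') (w : ProdLoose n n')
    (x : ProdLoose (comp m n) (comp m' n')) (ha : Compat a a') (hb : Compat b b')
    (hc : Compat c c'),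
    Sq (comp (v.unprod ha hb) (w.unprod hb hc)) (x.unprod ha hc)
  | _, _, _, _, _, _, _, _, _, _, .pt, w, x, ha, _, hc => w.canon x ha hc
  | _, _, _, _, _, _, _, _, _, _, .het m m', .of n n', x, ha, _, hc =>
    (ProdLoose.het (M.dom.comp m n) (N.dom.comp m' n')).canon x ha hc
  | _, _, _, _, _, _, _, _, _, _, .of m m', .of n n', x, ha, _, hc =>
    (ProdLoose.of (M.dom.comp m n) (N.dom.comp m' n')).canon x ha hc

/-- The comparison of loose identities for `ProdLoose.unprod`. -/
def unprodη : ∀ {a : Obj M} {a' : Obj N} (x : ProdLoose (unit a) (unit a')) (ha : Compat a a'),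
    Sq (unit (unprodObj a a' ha)) (x.unprod ha ha)
  | .pt, .pt, .pt, _ => PUnit.unit
  | .of _, .of _, .of _ _, _ => (prod M N).dom.vid _
  | .pt, .of _, _, h => LooseObj.noConfusion h
  | .of _, .pt, _, h => LooseObj.noConfusion h

/-- Here and below, mixed cases are ruled out by unequal labels or by an empty type of arrows or
squares; in the remaining ones everything is componentwise in `M` and `N`, or trivial at the point.
-/
theorem unprodTight_id (ha : Compat a a') :
    unprodTight ha ha (tightId a) (tightId a') = tightId (unprodObj a a' ha) := by
  cases a <;> cases a' <;> first | exact LooseObj.noConfusion ha | rfl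

theorem unprodTight_comp (ha : Compat a a') (hb : Compat b b') (hc : Compat c c')
    (f : Tight a b) (f' : Tight a' b') (g : Tight b c) (g' : Tight b' c') :
    unprodTight ha hc (tightComp f g) (tightComp f' g') =
      tightComp (unprodTight ha hb f f') (unprodTight hb hc g g') := by
  cases a <;> cases a' <;> first
    | exact LooseObj.noConfusion ha
    | (cases b <;> first
        | exact PEmpty.elim f
        | (cases b' <;> first
            | exact PEmpty.elim f'
            | (cases c <;> first
                | exact PEmpty.elim g
                | (cases c' <;> first
                    | exact PEmpty.elim g'
                    | rfl))))

section Squares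

variable {m : Loose a b} {m' : Loose a' b'} {n : Loose c d} {n' : Loose c' d'}
  {p : Loose e f} {p' : Loose e' f'}

theorem left_unprodSq (v : ProdLoose m m') (w : ProdLoose n n') (ha : Compat a a')
    (hb : Compat b b') (hc : Compat c c') (hd : Compat d d') (s : Sq m n) (s' : Sq m' n') :
    left (v.unprodSq w ha hb hc hd s s') = unprodTight ha hc (left s) (left s') := by
  cases v <;> cases w <;> first | exact PEmpty.elim s | rfl

theorem right_unprodSq (v : ProdLoose m m') (w : ProdLoose n n') (ha : Compat a a')
    (hb : Compat b b') (hc : Compat c c') (hd : Compat d d') (s : Sq m n) (s' : Sq m' n') :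
    right (v.unprodSq w ha hb hc hd s s') = unprodTight hb hd (right s) (right s') := by
  cases v <;> cases w <;> first | exact PEmpty.elim s | rfl

theorem unprodSq_vid (v : ProdLoose m m') (ha : Compat a a') (hb : Compat b b') :
    v.unprodSq v ha hb ha hb (vid m) (vid m') = vid (v.unprod ha hb) := by
  cases v <;> rfl

theorem unprodSq_vcomp (v : ProdLoose m m') (w : ProdLoose n n') (x : ProdLoose p p')
    (ha : Compat a a') (hb : Compat b b') (hc : Compat c c') (hd : Compat d d')
    (he : Compat e e') (hf : Compat f f') (s : Sq m n) (s' : Sq m' n') (t : Sq n p)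
    (t' : Sq n' p') :
    v.unprodSq x ha hb he hf (vcomp s t) (vcomp s' t') =
      vcomp (v.unprodSq w ha hb hc hd s s') (w.unprodSq x hc hd he hf t t') := by
  cases v <;> cases w <;> first
    | exact PEmpty.elim s
    | (cases x <;> first | exact PEmpty.elim t | rfl)

end Squares

theorem left_unprodμ (v : ProdLoose m m') (w : ProdLoose n n')
    (x : ProdLoose (comp m n) (comp m' n')) (ha : Compat a a') (hb : Compat b b')
    (hc : Compat c c') : left (unprodμ v w x ha hb hc) = tightId _ := by
  obtain rfl := Subsingleton.elim x (v.comp w)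
  cases v <;> cases w <;> first | rfl | exact (prod M N).dom.left_vid _

theorem right_unprodμ (v : ProdLoose m m') (w : ProdLoose n n')
    (x : ProdLoose (comp m n) (comp m' n')) (ha : Compat a a') (hb : Compat b b')
    (hc : Compat c c') : right (unprodμ v w x ha hb hc) = tightId _ := by
  obtain rfl := Subsingleton.elim x (v.comp w)
  cases v <;> cases w <;> first | rfl | exact (prod M N).dom.right_vid _

theorem unprodμ_inv (v : ProdLoose m m') (w : ProdLoose n n')
    (x : ProdLoose (comp m n) (comp m' n')) (ha : Compat a a') (hb : Compat b b')
    (hc : Compat c c') : ∃ t, vcomp (unprodμ v w x ha hb hc) t = vid _ ∧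
      vcomp t (unprodμ v w x ha hb hc) = vid _ := by
  obtain rfl := Subsingleton.elim x (v.comp w)
  cases v <;> cases w <;> first
    | exact ⟨PUnit.unit, rfl, rfl⟩
    | exact ⟨(prod M N).dom.vid _, (prod M N).dom.vid_vcomp _, (prod M N).dom.vid_vcomp _⟩

/-- With composite witnesses in place of `x` and `k`, both comparison squares are identities, and
composites merge componentwise; what remains is the unit laws for vertical composition. -/
theorem unprodμ_naturality {e' f' : Obj N} {g : Obj M} {g' : Obj N}
    {q : Loose e f} {q' : Loose e' f'} {r : Loose f g} {r' : Loose f' g'}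
    (v : ProdLoose m m') (w : ProdLoose n n') (x : ProdLoose (comp m n) (comp m' n'))
    (y : ProdLoose q q') (z : ProdLoose r r') (k : ProdLoose (comp q r) (comp q' r'))
    (ha : Compat a a') (hb : Compat b b') (hc : Compat c c') (he : Compat e e')
    (hf : Compat f f') (hg : Compat g g') (s : Sq m q) (s' : Sq m' q') (t : Sq n r)
    (t' : Sq n' r') (h : right s = left t) (h' : right s' = left t')
    (h'' : right (v.unprodSq y ha hb he hf s s') = left (w.unprodSq z hb hc hf hg t t')) :
    vcomp (hcomp (v.unprodSq y ha hb he hf s s') (w.unprodSq z hb hc hf hg t t') h'')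
        (unprodμ y z k he hf hg) =
      vcomp (unprodμ v w x ha hb hc)
        (x.unprodSq k ha hc he hg (hcomp s t h) (hcomp s' t' h')) := by
  obtain rfl := Subsingleton.elim x (v.comp w)
  obtain rfl := Subsingleton.elim k (y.comp z)
  cases v <;> cases y <;> first
    | exact PEmpty.elim s
    | skip
  · cases w <;> cases z <;> first
      | exact PEmpty.elim t
      | rfl
      | exact ((prod M N).dom.vcomp_vid _).trans ((prod M N).dom.vid_vcomp _).symm
  · cases w; cases z
    exact ((prod M N).dom.vcomp_vid _).trans ((prod M N).dom.vid_vcomp _).symm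
  · cases w; cases z
    exact ((prod M N).dom.vcomp_vid _).trans ((prod M N).dom.vid_vcomp _).symm

theorem left_unprodη (x : ProdLoose (unit a) (unit a')) (ha : Compat a a') :
    left (unprodη x ha) = tightId _ := by
  obtain rfl := Subsingleton.elim x (.unit ha)
  cases a <;> cases a' <;> first
    | exact LooseObj.noConfusion ha
    | rfl
    | exact (prod M N).dom.left_vid _

theorem right_unprodη (x : ProdLoose (unit a) (unit a')) (ha : Compat a a') :
    right (unprodη x ha) = tightId _ := by
  obtain rfl := Subsingleton.elim x (.unit ha)
  cases a <;> cases a' <;> first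
    | exact LooseObj.noConfusion ha
    | rfl
    | exact (prod M N).dom.right_vid _

theorem unprodη_inv (x : ProdLoose (unit a) (unit a')) (ha : Compat a a') :
    ∃ t, vcomp (unprodη x ha) t = vid _ ∧ vcomp t (unprodη x ha) = vid _ := by
  obtain rfl := Subsingleton.elim x (.unit ha)
  cases a <;> cases a' <;> first
    | exact LooseObj.noConfusion ha
    | exact ⟨PUnit.unit, rfl, rfl⟩
    | exact ⟨(prod M N).dom.vid _, (prod M N).dom.vid_vcomp _, (prod M N).dom.vid_vcomp _⟩

theorem unprodη_naturality (x : ProdLoose (unit a) (unit a')) (y : ProdLoose (unit b) (unit b'))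
    (ha : Compat a a') (hb : Compat b b') (f : Tight a b) (f' : Tight a' b') :
    vcomp (unitSq (unprodTight ha hb f f')) (unprodη y hb) =
      vcomp (unprodη x ha) (x.unprodSq y ha ha hb hb (unitSq f) (unitSq f')) := by
  obtain rfl := Subsingleton.elim x (.unit ha)
  obtain rfl := Subsingleton.elim y (.unit hb)
  cases a <;> cases a' <;> first
    | exact LooseObj.noConfusion ha
    | (cases b <;> first
        | exact PEmpty.elim f
        | (cases b' <;> first
            | exact PEmpty.elim f'
            | rfl
            | exact ((prod M N).dom.vcomp_vid _).trans ((prod M N).dom.vid_vcomp _).symm))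

/-- All comparisons are identity squares. When no factor is the point, this is the associativity
coherence of the identity double functor on the product. When the leading factor is the point, its
action is trivial and the associator of the collapse is itself an identity. -/
theorem unprod_assoc (v : ProdLoose m m') (w : ProdLoose n n') (x : ProdLoose p p')
    (vw : ProdLoose (comp m n) (comp m' n')) (wx : ProdLoose (comp n p) (comp n' p'))
    (k : ProdLoose (comp (comp m n) p) (comp (comp m' n') p'))
    (l : ProdLoose (comp m (comp n p)) (comp m' (comp n' p')))
    (ha : Compat a a') (hb : Compat b b') (hc : Compat c c') (hd : Compat d d')
    (h : right (unprodμ v w vw ha hb hc) = left (vid (x.unprod hc hd)))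
    (h' : right (vid (v.unprod ha hb)) = left (unprodμ w x wx hb hc hd)) :
    vcomp (hcomp (unprodμ v w vw ha hb hc) (vid (x.unprod hc hd)) h)
        (vcomp (unprodμ vw x k ha hc hd)
          (k.unprodSq l ha hd ha hd (assoc m n p) (assoc m' n' p'))) =
      vcomp (assoc (v.unprod ha hb) (w.unprod hb hc) (x.unprod hc hd))
        (vcomp (hcomp (vid (v.unprod ha hb)) (unprodμ w x wx hb hc hd) h')
          (unprodμ v wx l ha hb hd)) := by
  obtain rfl := Subsingleton.elim vw (v.comp w)
  obtain rfl := Subsingleton.elim wx (w.comp x)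
  obtain rfl := Subsingleton.elim k ((v.comp w).comp x)
  obtain rfl := Subsingleton.elim l (v.comp (w.comp x))
  cases v with
  | pt =>
    cases w with
    | pt =>
      cases x with
      | pt => rfl
      | het p p' => rfl
    | het n n' =>
      cases x with
      | of p p' =>
        exact congrArg (fun z => (prod M N).dom.vcomp z _) ((prod M N).dom.hcomp_vid _ _)
  | het m m' =>
    cases w with
    | of n n' =>
      cases x with
      | of p p' =>
        exact (DblFunctor.id (prod M N).dom).map_assoc
          (loosePair m m') (loosePair n n') (loosePair p p')
  | of m m' =>
    cases w with
    | of n n' =>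
      cases x with
      | of p p' =>
        exact (DblFunctor.id (prod M N).dom).map_assoc
          (loosePair m m') (loosePair n n') (loosePair p p')

theorem unprod_lunit (v : ProdLoose m m') (x : ProdLoose (unit a) (unit a'))
    (y : ProdLoose (comp (unit a) m) (comp (unit a') m')) (ha : Compat a a') (hb : Compat b b')
    (h : right (unprodη x ha) = left (vid (v.unprod ha hb))) :
    vcomp (hcomp (unprodη x ha) (vid (v.unprod ha hb)) h)
        (vcomp (unprodμ x v y ha ha hb) (y.unprodSq v ha hb ha hb (lunit m) (lunit m'))) =
      lunit (v.unprod ha hb) := by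
  obtain rfl := Subsingleton.elim x (.unit ha)
  obtain rfl := Subsingleton.elim y (.comp (.unit ha) v)
  cases v with
  | pt => rfl
  -- The left unitor at a heteromorphism is an identity, the point acting trivially; it is not the
  -- left unitor of the product.
  | het m m' => exact ((prod M N).dom.vid_vcomp _).trans ((prod M N).dom.vid_vcomp _)
  | of m m' => exact (DblFunctor.id (prod M N).dom).map_lunit _

theorem unprod_runit (v : ProdLoose m m') (x : ProdLoose (unit b) (unit b'))
    (y : ProdLoose (comp m (unit b)) (comp m' (unit b'))) (ha : Compat a a') (hb : Compat b b')
    (h : right (vid (v.unprod ha hb)) = left (unprodη x hb)) :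
    vcomp (hcomp (vid (v.unprod ha hb)) (unprodη x hb) h)
        (vcomp (unprodμ v x y ha hb hb) (y.unprodSq v ha hb ha hb (runit m) (runit m'))) =
      runit (v.unprod ha hb) := by
  obtain rfl := Subsingleton.elim x (.unit hb)
  obtain rfl := Subsingleton.elim y (.comp v (.unit hb))
  cases v with
  | pt => rfl
  | het m m' => exact (DblFunctor.id (prod M N).dom).map_runit _
  | of m m' => exact (DblFunctor.id (prod M N).dom).map_runit _

end

/-! ### The comparison of the two products -/

variable (M N : LBimod.{v, u})

/-- The comparison from the product of two collapses to the collapse of the product. -/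
def unprodFunctor : DblFunctor (prodCollage (bimod M) (bimod N)) (collage (prod M N)) where
  obj a := unprodObj a.1.1 a.1.2 a.2
  map {a b} f := unprodTight a.2 b.2 f.1 f.2
  map_id a := unprodTight_id a.2
  map_comp {a b c} f g := unprodTight_comp a.2 b.2 c.2 f.1 f.2 g.1 g.2
  loose {a b} m := (prodLoose a.2 b.2 m.1 m.2).unprod a.2 b.2
  sq {a b c d m n} s := (prodLoose a.2 b.2 m.1 m.2).unprodSq (prodLoose c.2 d.2 n.1 n.2)
    a.2 b.2 c.2 d.2 s.1 s.2
  left_sq s := left_unprodSq _ _ _ _ _ _ s.1 s.2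
  right_sq s := right_unprodSq _ _ _ _ _ _ s.1 s.2
  sq_vid _ := unprodSq_vid _ _ _
  sq_vcomp s t := unprodSq_vcomp _ _ _ _ _ _ _ _ _ s.1 s.2 t.1 t.2
  μ {a b c} m n := unprodμ (prodLoose a.2 b.2 m.1 m.2) (prodLoose b.2 c.2 n.1 n.2)
    (prodLoose a.2 c.2 _ _) a.2 b.2 c.2
  left_μ _ _ := left_unprodμ _ _ _ _ _ _
  right_μ _ _ := right_unprodμ _ _ _ _ _ _
  μ_inv _ _ := unprodμ_inv _ _ _ _ _ _
  μ_naturality s t h := unprodμ_naturality _ _ _ _ _ _ _ _ _ _ _ _ s.1 s.2 t.1 t.2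
    (congrArg Prod.fst h) (congrArg Prod.snd h) _
  η a := unprodη (prodLoose a.2 a.2 _ _) a.2
  left_η _ := left_unprodη _ _
  right_η _ := right_unprodη _ _
  η_inv _ := unprodη_inv _ _
  η_naturality {a b} f := unprodη_naturality _ _ a.2 b.2 f.1 f.2
  map_assoc _ _ _ := unprod_assoc _ _ _ _ _ _ _ _ _ _ _ _ _
  map_lunit _ := unprod_lunit _ _ _ _ _ _
  map_runit _ := unprod_runit _ _ _ _ _ _

/-- The collapse of a morphism, as a morphism of loose bimodules. -/
def mapHom {M N : LBimod.{v, u}} (F : M ⟶ N) : bimod M ⟶ bimod N := (map F).hom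

section

variable {M N : LBimod.{v, u}} {a b c d : Obj M} {a' b' c' d' : Obj N} {m : Loose a b}
  {m' : Loose a' b'}

/-- This equality is not definitional for variable objects, so the companion statements for arrows,
squares and comparisons are heterogeneous. Together they are the hypotheses that
`DblFunctor.ext_data` needs for `unprodHom_map_fst`; the statements about `snd` play the same role
for `unprodHom_map_snd`. -/
theorem mapObj_fst_unprodObj (ha : Compat a a') : mapObj (fst M N) (unprodObj a a' ha) = a := by
  cases a <;> cases a' <;> first | exact LooseObj.noConfusion ha | rfl

theorem mapObj_snd_unprodObj (ha : Compat a a') : mapObj (snd M N) (unprodObj a a' ha) = a' := by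
  cases a <;> cases a' <;> first | exact LooseObj.noConfusion ha | rfl

theorem mapTight_fst_unprodTight (ha : Compat a a') (hb : Compat b b') (f : Tight a b)
    (f' : Tight a' b') : HEq (mapTight (fst M N) (unprodTight ha hb f f')) f := by
  cases a <;> cases a' <;> first
    | exact LooseObj.noConfusion ha
    | (cases b <;> first
        | exact PEmpty.elim f
        | (cases b' <;> first
            | exact PEmpty.elim f'
            | exact HEq.rfl))

theorem mapTight_snd_unprodTight (ha : Compat a a') (hb : Compat b b') (f : Tight a b)
    (f' : Tight a' b') : HEq (mapTight (snd M N) (unprodTight ha hb f f')) f' := by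
  cases a <;> cases a' <;> first
    | exact LooseObj.noConfusion ha
    | (cases b <;> first
        | exact PEmpty.elim f
        | (cases b' <;> first
            | exact PEmpty.elim f'
            | exact HEq.rfl))

theorem mapLoose_fst_unprod (v : ProdLoose m m') (ha : Compat a a') (hb : Compat b b') :
    HEq (mapLoose (fst M N) (v.unprod ha hb)) m := by
  cases v <;> exact HEq.rfl

theorem mapLoose_snd_unprod (v : ProdLoose m m') (ha : Compat a a') (hb : Compat b b') :
    HEq (mapLoose (snd M N) (v.unprod ha hb)) m' := by
  cases v <;> exact HEq.rfl

theorem mapSq_fst_unprodSq {n : Loose c d} {n' : Loose c' d'} (v : ProdLoose m m')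
    (w : ProdLoose n n') (ha : Compat a a') (hb : Compat b b') (hc : Compat c c')
    (hd : Compat d d') (s : Sq m n) (s' : Sq m' n') :
    HEq (mapSq (fst M N) (v.unprodSq w ha hb hc hd s s')) s := by
  cases v <;> cases w <;> first | exact PEmpty.elim s | exact HEq.rfl

theorem mapSq_snd_unprodSq {n : Loose c d} {n' : Loose c' d'} (v : ProdLoose m m')
    (w : ProdLoose n n') (ha : Compat a a') (hb : Compat b b') (hc : Compat c c')
    (hd : Compat d d') (s : Sq m n) (s' : Sq m' n') :
    HEq (mapSq (snd M N) (v.unprodSq w ha hb hc hd s s')) s' := by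
  cases v <;> cases w <;> first | exact PEmpty.elim s | exact HEq.rfl

theorem mapμ_fst_unprodμ {n : Loose b c} {n' : Loose b' c'} (v : ProdLoose m m')
    (w : ProdLoose n n') (x : ProdLoose (comp m n) (comp m' n')) (ha : Compat a a')
    (hb : Compat b b') (hc : Compat c c') :
    HEq (vcomp (mapμ (fst M N) (v.unprod ha hb) (w.unprod hb hc))
      (mapSq (fst M N) (unprodμ v w x ha hb hc))) (vid (comp m n)) := by
  obtain rfl := Subsingleton.elim x (v.comp w)
  cases v <;> cases w <;> first | exact HEq.rfl | exact heq_of_eq (M.dom.vid_vcomp _)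

theorem mapμ_snd_unprodμ {n : Loose b c} {n' : Loose b' c'} (v : ProdLoose m m')
    (w : ProdLoose n n') (x : ProdLoose (comp m n) (comp m' n')) (ha : Compat a a')
    (hb : Compat b b') (hc : Compat c c') :
    HEq (vcomp (mapμ (snd M N) (v.unprod ha hb) (w.unprod hb hc))
      (mapSq (snd M N) (unprodμ v w x ha hb hc))) (vid (comp m' n')) := by
  obtain rfl := Subsingleton.elim x (v.comp w)
  cases v <;> cases w <;> first | exact HEq.rfl | exact heq_of_eq (N.dom.vid_vcomp _)

theorem mapη_fst_unprodη (x : ProdLoose (unit a) (unit a')) (ha : Compat a a') :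
    HEq (vcomp (mapη (fst M N) (unprodObj a a' ha)) (mapSq (fst M N) (unprodη x ha)))
      (vid (unit a)) := by
  obtain rfl := Subsingleton.elim x (.unit ha)
  cases a <;> cases a' <;> first
    | exact LooseObj.noConfusion ha
    | exact HEq.rfl
    | exact heq_of_eq (M.dom.vid_vcomp _)

theorem mapη_snd_unprodη (x : ProdLoose (unit a) (unit a')) (ha : Compat a a') :
    HEq (vcomp (mapη (snd M N) (unprodObj a a' ha)) (mapSq (snd M N) (unprodη x ha)))
      (vid (unit a')) := by
  obtain rfl := Subsingleton.elim x (.unit ha)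
  cases a <;> cases a' <;> first
    | exact LooseObj.noConfusion ha
    | exact HEq.rfl
    | exact heq_of_eq (N.dom.vid_vcomp _)

end

variable (M N : LBimod.{v, u})

/-- The comparison from the product of two collapses to the collapse of the product, as a
morphism of loose bimodules. -/
def unprodHom : prod (bimod M) (bimod N) ⟶ bimod (prod M N) :=
  homMk (M := prod (bimod M) (bimod N)) (N := bimod (prod M N)) (unprodFunctor M N) (by
    rintro ⟨⟨_ | _, _ | _⟩, h⟩ <;> first | exact LooseObj.noConfusion h | rfl)

theorem unprodHom_map_fst : unprodHom M N ≫ (mapHom (fst M N)) = fst (bimod M) (bimod N) :=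
  Slice.Hom.ext (DblFunctor.ext_data (fun a => mapObj_fst_unprodObj a.2)
    (fun {a b} f => mapTight_fst_unprodTight a.2 b.2 f.1 f.2)
    (fun _ => mapLoose_fst_unprod _ _ _) (fun s => mapSq_fst_unprodSq _ _ _ _ _ _ s.1 s.2)
    (fun _ _ => mapμ_fst_unprodμ _ _ _ _ _ _) (fun _ => mapη_fst_unprodη _ _))

theorem unprodHom_map_snd : unprodHom M N ≫ (mapHom (snd M N)) = snd (bimod M) (bimod N) :=
  Slice.Hom.ext (DblFunctor.ext_data (fun a => mapObj_snd_unprodObj a.2)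
    (fun {a b} f => mapTight_snd_unprodTight a.2 b.2 f.1 f.2)
    (fun _ => mapLoose_snd_unprod _ _ _) (fun s => mapSq_snd_unprodSq _ _ _ _ _ _ s.1 s.2)
    (fun _ _ => mapμ_snd_unprodμ _ _ _ _ _ _) (fun _ => mapη_snd_unprodη _ _))

/-- A constructor of the collapse of the product is split into its two coordinates and merged again,
which changes nothing; only identity squares remain in the comparisons. -/
theorem pair_map_unprodHom :
    pair (mapHom (fst M N)) (mapHom (snd M N)) ≫ unprodHom M N = 𝟙 (bimod (prod M N)) := by
  refine Slice.Hom.ext (DblFunctor.ext_data ?_ ?_ ?_ ?_ ?_ ?_)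
  · rintro (_ | _) <;> rfl
  · rintro (_ | _) (_ | _) f <;> first | exact PEmpty.elim f | exact HEq.rfl
  · rintro _ _ (_ | _ | _) <;> exact HEq.rfl
  · rintro _ _ _ _ (_ | _ | _) (_ | _ | _) s <;> first | exact PEmpty.elim s | exact HEq.rfl
  · rintro _ _ _ (_ | _ | _) n <;> cases n <;> first
      | exact HEq.rfl
      | exact heq_of_eq ((prod M N).dom.vid_vcomp _)
  · rintro (_ | _) <;> first
      | exact HEq.rfl
      | exact heq_of_eq ((prod M N).dom.vid_vcomp _)

/-- The collapsed projections are the projections of the product of the collapses, precomposed with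
the canonical comparison, so they inherit the universal property once the comparison is strictly
invertible. -/
theorem isBinaryProduct₂_map :
    IsBinaryProduct₂ (mapHom (fst M N)) (mapHom (snd M N)) := by
  refine (isBinaryProduct₂_prod (bimod M) (bimod N)).of_iso (pair_map_unprodHom M N) ?_
    (pair_fst _ _) (pair_snd _ _)
  -- The other composite is an endomorphism of a product, so it is the identity as soon as its two
  -- projections are the projections.
  refine ((isBinaryProduct₂_prod (bimod M) (bimod N)).hom _).1 (Prod.ext ?_ ?_)
  · exact (Bicategory.Strict.assoc _ _ _).trans
      ((congrArg (fun F => unprodHom M N ≫ F) (pair_fst _ _)).trans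
        ((unprodHom_map_fst M N).trans (Bicategory.Strict.id_comp _).symm))
  · exact (Bicategory.Strict.assoc _ _ _).trans
      ((congrArg (fun F => unprodHom M N ≫ F) (pair_snd _ _)).trans
        ((unprodHom_map_snd M N).trans (Bicategory.Strict.id_comp _).symm))

end Collapse

/-- By invariance under strict isomorphism only the explicit terminal object and products matter,
and their images may be tested in `LBimod`, where right modules form a full sub-2-category. -/
theorem preservesFiniteProducts₂_collapse₂ : PreservesFiniteProducts₂ collapse₂.{v, u} :=
  .of_exists _
    ⟨LBimod.walking, LBimod.isWalking_walking.isTerminal₂,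
      IsTerminal₂.of_induced (T := Collapse.obj LBimod.walking)
        LBimod.isWalking_walking.collapse.isTerminal₂⟩
    fun M N => ⟨LBimod.prod M N, LBimod.fst M N, LBimod.snd M N, LBimod.isBinaryProduct₂_prod M N,
      IsBinaryProduct₂.of_induced (p := Collapse.map (LBimod.fst M N))
        (q := Collapse.map (LBimod.snd M N)) (Collapse.isBinaryProduct₂_map M N)⟩

/-! ### The target and the carrier of the collapse -/

namespace Collapse

variable (M : LBimod.{v, u})

variable {M} in
/-- The object of `M` underlying an object of the target of the collapse. -/
def targetObj : (bimod M).target.Obj → M.target.Obj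
  | ⟨.of d, _⟩ => d
  | ⟨.pt, h⟩ => LooseObj.noConfusion h

variable {M} in
/-- The loose arrow of `M` underlying a loose arrow of the target of the collapse. -/
def targetLoose : ∀ {a b : Obj M} (ha : (bimod M).label a = .one) (hb : (bimod M).label b = .one),
    Loose a b → M.target.Loose (targetObj ⟨a, ha⟩) (targetObj ⟨b, hb⟩)
  | _, _, _, _, .of m => m
  | _, _, h, _, .pt => LooseObj.noConfusion h
  | _, _, h, _, .het _ => LooseObj.noConfusion h

variable {M} in
/-- The tight arrow of `M` underlying a tight arrow of the target of the collapse. -/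
def targetTight : ∀ {a b : Obj M} (ha : (bimod M).label a = .one) (hb : (bimod M).label b = .one),
    Tight a b → ((targetObj ⟨a, ha⟩ : M.target.Obj) ⟶ targetObj ⟨b, hb⟩)
  | .of _, .of _, _, _, f => f
  | .pt, _, h, _, _ => LooseObj.noConfusion h
  | .of _, .pt, _, h, _ => LooseObj.noConfusion h

variable {M} in
/-- The square of `M` underlying a square of the target of the collapse. -/
def targetSq : ∀ {a b c d : Obj M} (ha : (bimod M).label a = .one)
    (hb : (bimod M).label b = .one) (hc : (bimod M).label c = .one)
    (hd : (bimod M).label d = .one) {m : Loose a b} {n : Loose c d}, Sq m n →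
      M.target.Sq (targetLoose ha hb m) (targetLoose hc hd n)
  | _, _, _, _, _, _, _, _, .of _, .of _, s => s
  | _, _, _, _, _, _, _, _, .of _, .het _, s => PEmpty.elim s
  | _, _, _, _, _, _, _, _, .of _, .pt, s => PEmpty.elim s
  | _, _, _, _, h, _, _, _, .pt, _, _ => LooseObj.noConfusion h
  | _, _, _, _, h, _, _, _, .het _, _, _ => LooseObj.noConfusion h

variable {M} in
/-- The comparison of composites for `targetLoose`. -/
def targetμ : ∀ {a b c : Obj M} (ha : (bimod M).label a = .one) (hb : (bimod M).label b = .one)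
    (hc : (bimod M).label c = .one) (m : Loose a b) (n : Loose b c),
    M.target.Sq (M.target.comp (targetLoose ha hb m) (targetLoose hb hc n))
      (targetLoose ha hc (comp m n))
  | _, _, _, _, _, _, .of _, .of _ => M.dom.vid _
  | _, _, _, h, _, _, .pt, _ => LooseObj.noConfusion h
  | _, _, _, h, _, _, .het _, _ => LooseObj.noConfusion h

variable {M} in
/-- The comparison of loose identities for `targetLoose`. -/
def targetη : ∀ {a : Obj M} (ha : (bimod M).label a = .one),
    M.target.Sq (M.target.unit (targetObj ⟨a, ha⟩)) (targetLoose ha ha (unit a))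
  | .of _, _ => M.dom.vid _
  | .pt, h => LooseObj.noConfusion h

/-- The double functor from the target of the collapse to the target. -/
def targetHom : DblFunctor (bimod M).target M.target where
  obj := targetObj
  map {a b} f := targetTight a.2 b.2 f
  map_id := by
    rintro ⟨_ | _, h⟩ <;> first | exact LooseObj.noConfusion h | rfl
  map_comp := by
    rintro ⟨_ | _, ha⟩ ⟨_ | _, hb⟩ ⟨_ | _, hc⟩ f g <;> first
      | exact LooseObj.noConfusion ha
      | exact LooseObj.noConfusion hb
      | exact LooseObj.noConfusion hc
      | rfl
  loose {a b} m := targetLoose a.2 b.2 m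
  sq {a b c d _ _} s := targetSq a.2 b.2 c.2 d.2 s
  -- Label 1 at the left end leaves `of` as the only constructor for the loose arrow, where all the
  -- data is that of `M`; the later fields are split in the same way, or by the constructors of
  -- objects.
  left_sq := by
    rintro ⟨_, ha⟩ ⟨_, hb⟩ ⟨_, hc⟩ ⟨_, hd⟩ (_ | _ | _) (_ | _ | _) s <;> first
      | exact LooseObj.noConfusion ha
      | exact PEmpty.elim s
      | rfl
  right_sq := by
    rintro ⟨_, ha⟩ ⟨_, hb⟩ ⟨_, hc⟩ ⟨_, hd⟩ (_ | _ | _) (_ | _ | _) s <;> first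
      | exact LooseObj.noConfusion ha
      | exact PEmpty.elim s
      | rfl
  sq_vid := by
    rintro ⟨_, ha⟩ ⟨_, hb⟩ (_ | _ | _) <;> first
      | exact LooseObj.noConfusion ha
      | rfl
  sq_vcomp := by
    rintro ⟨_, ha⟩ ⟨_, hb⟩ ⟨_, hc⟩ ⟨_, hd⟩ ⟨_, he⟩ ⟨_, hf⟩ (_ | _ | _) (_ | _ | _) n s t <;> first
      | exact LooseObj.noConfusion ha
      | exact PEmpty.elim s
      | (cases n <;> first
          | exact PEmpty.elim t
          | rfl)
  μ {a b c} m n := targetμ a.2 b.2 c.2 m n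
  left_μ := by
    rintro ⟨_, ha⟩ ⟨_, hb⟩ ⟨_, hc⟩ (_ | _ | _) n <;> first
      | exact LooseObj.noConfusion ha
      | (cases n; exact M.dom.left_vid _)
  right_μ := by
    rintro ⟨_, ha⟩ ⟨_, hb⟩ ⟨_, hc⟩ (_ | _ | _) n <;> first
      | exact LooseObj.noConfusion ha
      | (cases n; exact M.dom.right_vid _)
  μ_inv := by
    rintro ⟨_, ha⟩ ⟨_, hb⟩ ⟨_, hc⟩ (_ | _ | _) n <;> first
      | exact LooseObj.noConfusion ha
      | (cases n; exact ⟨M.dom.vid _, M.dom.vid_vcomp _, M.dom.vid_vcomp _⟩)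
  μ_naturality := by
    rintro ⟨_, ha⟩ ⟨_, hb⟩ ⟨_, hc⟩ ⟨_, ha'⟩ ⟨_, hb'⟩ ⟨_, hc'⟩ (_ | _ | _) n m' n' s t h <;> first
      | exact LooseObj.noConfusion ha
      | (cases n
         cases m' <;> first
          | exact PEmpty.elim s
          | (cases n'
             exact (M.dom.vcomp_vid _).trans (M.dom.vid_vcomp _).symm))
  η a := targetη a.2
  left_η := by
    rintro ⟨_ | _, ha⟩ <;> first | exact LooseObj.noConfusion ha | exact M.dom.left_vid _
  right_η := by
    rintro ⟨_ | _, ha⟩ <;> first | exact LooseObj.noConfusion ha | exact M.dom.right_vid _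
  η_inv := by
    rintro ⟨_ | _, ha⟩ <;> first
      | exact LooseObj.noConfusion ha
      | exact ⟨M.dom.vid _, M.dom.vid_vcomp _, M.dom.vid_vcomp _⟩
  η_naturality := by
    rintro ⟨_ | _, ha⟩ ⟨_ | _, hb⟩ f <;> first
      | exact LooseObj.noConfusion ha
      | exact LooseObj.noConfusion hb
      | exact (M.dom.vcomp_vid _).trans (M.dom.vid_vcomp _).symm
  map_assoc := by
    rintro ⟨_, ha⟩ ⟨_, hb⟩ ⟨_, hc⟩ ⟨_, hd⟩ (_ | _ | _) n p <;> first
      | exact LooseObj.noConfusion ha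
      | (cases n; cases p; exact (DblFunctor.id M.dom).map_assoc _ _ _)
  map_lunit := by
    rintro ⟨_, ha⟩ ⟨_, hb⟩ (_ | _ | _) <;> first
      | exact LooseObj.noConfusion ha
      | exact (DblFunctor.id M.dom).map_lunit _
  map_runit := by
    rintro ⟨_, ha⟩ ⟨_, hb⟩ (_ | _ | _) <;> first
      | exact LooseObj.noConfusion ha
      | exact (DblFunctor.id M.dom).map_runit _

/-- The double functor from the target to the target of the collapse. -/
def targetInv : DblFunctor M.target (bimod M).target where
  obj d := ⟨.of d, rfl⟩
  map f := f
  map_id _ := rfl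
  map_comp _ _ := rfl
  loose m := Loose.of m
  sq s := s
  left_sq _ := rfl
  right_sq _ := rfl
  sq_vid _ := rfl
  sq_vcomp _ _ := rfl
  μ m n := M.dom.vid (M.dom.comp m n)
  left_μ _ _ := M.dom.left_vid _
  right_μ _ _ := M.dom.right_vid _
  μ_inv _ _ := ⟨M.dom.vid _, M.dom.vid_vcomp _, M.dom.vid_vcomp _⟩
  μ_naturality _ _ _ := (M.dom.vcomp_vid _).trans (M.dom.vid_vcomp _).symm
  η a := M.dom.vid (M.dom.unit a.1)
  left_η _ := M.dom.left_vid _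
  right_η _ := M.dom.right_vid _
  η_inv _ := ⟨M.dom.vid _, M.dom.vid_vcomp _, M.dom.vid_vcomp _⟩
  η_naturality _ := (M.dom.vcomp_vid _).trans (M.dom.vid_vcomp _).symm
  map_assoc m n p := (DblFunctor.id M.dom).map_assoc m n p
  map_lunit m := (DblFunctor.id M.dom).map_lunit m
  map_runit m := (DblFunctor.id M.dom).map_runit m

/-- The target of the collapse is the target. -/
def targetIso : (bimod M).target ≅ M.target where
  hom := targetHom M
  inv := targetInv M
  hom_inv_id := by
    refine DblFunctor.ext_data ?_ ?_ ?_ ?_ ?_ ?_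
    · rintro ⟨_ | _, ha⟩ <;> first | exact LooseObj.noConfusion ha | rfl
    · rintro ⟨_ | _, ha⟩ ⟨_ | _, hb⟩ f <;> first
        | exact LooseObj.noConfusion ha
        | exact LooseObj.noConfusion hb
        | exact HEq.rfl
    · rintro ⟨_, ha⟩ ⟨_, hb⟩ (_ | _ | _) <;> first
        | exact LooseObj.noConfusion ha
        | exact HEq.rfl
    · rintro ⟨_, ha⟩ ⟨_, hb⟩ ⟨_, hc⟩ ⟨_, hd⟩ (_ | _ | _) (_ | _ | _) s <;> first
        | exact LooseObj.noConfusion ha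
        | exact PEmpty.elim s
        | exact HEq.rfl
    · rintro ⟨_, ha⟩ ⟨_, hb⟩ ⟨_, hc⟩ (_ | _ | _) n <;> first
        | exact LooseObj.noConfusion ha
        | (cases n; exact heq_of_eq (M.dom.vid_vcomp _))
    · rintro ⟨_ | _, ha⟩ <;> first
        | exact LooseObj.noConfusion ha
        | exact heq_of_eq (M.dom.vid_vcomp _)
  inv_hom_id := DblFunctor.ext_data (fun _ => rfl) (fun _ => HEq.rfl) (fun _ => HEq.rfl)
    (fun _ => HEq.rfl) (fun _ _ => heq_of_eq (M.dom.vid_vcomp _))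
    (fun _ => heq_of_eq (M.dom.vid_vcomp _))

/-! ### The carrier of the collapse -/

variable {M} in
/-- The heteromorphism of `M` underlying a heteromorphism of the collapse. -/
def carrierObj : Carrier (bimod M) → Carrier M
  | ⟨⟨_, _⟩, ⟨_, _⟩, .het (d₀ := d₀) (d₁ := d₁) m⟩ => ⟨d₀, d₁, m⟩
  | ⟨⟨_, _⟩, ⟨_, h⟩, .pt⟩ => LooseObj.noConfusion h
  | ⟨⟨_, h⟩, ⟨_, _⟩, .of _⟩ => LooseObj.noConfusion h

variable {M} in
/-- The square of `M` underlying a square between heteromorphisms of the collapse. -/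
def carrierMap : ∀ {x y : Carrier (bimod M)}, (x ⟶ y) → (carrierObj x ⟶ carrierObj y)
  | ⟨⟨_, _⟩, ⟨_, _⟩, .het _⟩, ⟨⟨_, _⟩, ⟨_, _⟩, .het _⟩, s => s
  | ⟨⟨_, _⟩, ⟨_, h⟩, .pt⟩, _, _ => LooseObj.noConfusion h
  | ⟨⟨_, h⟩, ⟨_, _⟩, .of _⟩, _, _ => LooseObj.noConfusion h
  | ⟨⟨_, _⟩, ⟨_, _⟩, .het _⟩, ⟨⟨_, _⟩, ⟨_, h⟩, .pt⟩, _ => LooseObj.noConfusion h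
  | ⟨⟨_, _⟩, ⟨_, _⟩, .het _⟩, ⟨⟨_, h⟩, ⟨_, _⟩, .of _⟩, _ => LooseObj.noConfusion h

variable {M} in
-- Of the three kinds of loose arrow only `het` runs from label 0 to label 1. Since `carrierObj` and
-- `carrierMap` compute only on that constructor, this principle and its analogue for morphisms
-- reduce the equalities below to definitional ones.
theorem carrier_cases {motive : Carrier (bimod M) → Prop}
    (het : ∀ (d₀ : M.source.Obj) (d₁ : M.target.Obj) (m : M.dom.Loose d₀.1 d₁.1),
      motive ⟨⟨.pt, rfl⟩, ⟨.of d₁, rfl⟩, Loose.het m⟩) (x : Carrier (bimod M)) : motive x :=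
  match x with
  | ⟨⟨_, _⟩, ⟨_, _⟩, .het _⟩ => het _ _ _
  | ⟨⟨_, _⟩, ⟨_, h⟩, .pt⟩ => LooseObj.noConfusion h
  | ⟨⟨_, h⟩, ⟨_, _⟩, .of _⟩ => LooseObj.noConfusion h

variable {M} in
theorem carrier_hom_cases {motive : ∀ {x y : Carrier (bimod M)}, (x ⟶ y) → Prop}
    (het : ∀ {d₀ e₀ : M.source.Obj} {d₁ e₁ : M.target.Obj} (m : M.dom.Loose d₀.1 d₁.1)
      (n : M.dom.Loose e₀.1 e₁.1) (s : M.dom.Sq m n),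
      motive (x := ⟨⟨.pt, rfl⟩, ⟨.of d₁, rfl⟩, Loose.het m⟩)
        (y := ⟨⟨.pt, rfl⟩, ⟨.of e₁, rfl⟩, Loose.het n⟩) s)
    {x y : Carrier (bimod M)} (s : x ⟶ y) : motive s :=
  carrier_cases (motive := fun x => ∀ s : x ⟶ y, motive s)
    (fun _ _ m => carrier_cases (motive := fun y => ∀ s : _ ⟶ y, motive s)
      (fun _ _ n => het m n) y) x s

/-- The functor from the carrier of the collapse to the carrier. -/
def carrierHom : Carrier (bimod M) ⥤ Carrier M where
  obj := carrierObj
  map := carrierMap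
  map_id := carrier_cases fun _ _ _ => rfl
  map_comp {_ _ z} s t := carrier_hom_cases (motive := fun {_ y} s => ∀ t : y ⟶ z,
    carrierMap (s ≫ t) = carrierMap s ≫ carrierMap t) (fun _ _ _ => carrier_cases
      (motive := fun z => ∀ t : _ ⟶ z, carrierMap (_ ≫ t) = carrierMap _ ≫ carrierMap t)
      (fun _ _ _ _ => rfl) z) s t

/-- The functor from the carrier to the carrier of the collapse. -/
def carrierInv : Carrier M ⥤ Carrier (bimod M) where
  obj m := ⟨⟨.pt, rfl⟩, ⟨.of m.cod, rfl⟩, Loose.het m.arr⟩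
  map s := s

/-- The carrier of the collapse is the carrier. -/
def carrierIso : Cat.of (Carrier (bimod M)) ≅ Cat.of (Carrier M) where
  hom := (carrierHom M).toCatHom
  inv := (carrierInv M).toCatHom
  hom_inv_id := congrArg Functor.toCatHom (CategoryTheory.Functor.hext
    (F := carrierHom M ⋙ carrierInv M) (G := 𝟭 _) (carrier_cases fun _ _ _ => rfl)
    fun _ _ s => carrier_hom_cases (motive := fun s =>
      HEq ((carrierHom M ⋙ carrierInv M).map s) s) (fun _ _ _ => HEq.rfl) s)
  inv_hom_id := rfl

/-- On `Loose.het m` both functors return the target object of `m`, and on a square its right side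
as computed in `M`; the collapse forgets only sources and left sides. -/
theorem carrierIso_codomain :
    (carrierIso M).hom.toFunctor ⋙ Carrier.codomain M =
      Carrier.codomain (bimod M) ⋙ DblFunctor.tight (targetIso M).hom :=
  CategoryTheory.Functor.hext (carrier_cases fun _ _ _ => rfl) fun _ _ s =>
    carrier_hom_cases (motive := fun s =>
      HEq ((Carrier.codomain M).map (carrierMap s))
        ((targetHom M).map ((Carrier.codomain (bimod M)).map s))) (fun _ _ _ => HEq.rfl) s

end Collapse

end LooseBimodule

theorem mainTheorem4 :
    IsCartesian₂ LBimod.{v, u} ∧ IsCartesian₂ LModR.{v, u} ∧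
      (∃ c : StrictPseudofunctor LBimod.{v, u} LModR.{v, u},
        c.toPrelaxFunctorStruct = collapse.{v, u} ∧ PreservesFiniteProducts₂ c) ∧
      ∀ M : LBimod.{v, u},
        ∃ (T : (Collapse.bimod M).target ≅ M.target)
          (K : Cat.of (Carrier (Collapse.bimod M)) ≅ Cat.of (Carrier M)),
          K.hom.toFunctor ⋙ Carrier.codomain M =
            Carrier.codomain (Collapse.bimod M) ⋙ DblFunctor.tight T.hom := by
  refine ⟨LBimod.isCartesian₂, LModR.isCartesian₂,
    ⟨collapse₂, collapse₂_toPrelaxFunctorStruct, preservesFiniteProducts₂_collapse₂⟩,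
    fun M => ⟨Collapse.targetIso M, Collapse.carrierIso M, Collapse.carrierIso_codomain M⟩⟩
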